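/- **Definitions.** Let $M$ be a compact connected metric space with metric $\theta$ and a Borel measure $\mu$, normalized by $\mu(M)=1$ and $\operatorname{diam} M=1$. For $y\in M$ and $0\le r<1$ let $B(y,r)=\{x\in M:\theta(x,y)<r\}$, and let $B(y,r)=M$ for $r\ge 1$; put $v(y,r)=\mu(B(y,r))$. For an $N$-point subset $D_N\subset M$, a Borel probability measure $\xi$ on $[0,1]$ and $0<p<\infty$, define $$\mathcal L_p[M,\xi,D_N]=\Big(\iint_{M\times[0,1]}\big|\#(B(y,r)\cap D_N)-N\,v(y,r)\big|^p\,d\mu(y)\,d\xi(r)\Big)^{1/p},\qquad \lambda_p[M,\xi,N]=\inf_{D_N\subset M,\ \#D_N=N}\mathcal L_p[M,\xi,D_N].$$ *Condition A* (with exponent $d$): there are constants $d>0$ and $c_1>0$ with $c_1^{-1}r^d\le v(y,r)\le c_1r^d$ for all $y\in M$ and $r\in[0,1]$. *Condition B*: there is a constant $c_2>0$ with $|v(y,r_1)-v(y,r_2)|\le c_2|r_1-r_2|$ for all $y\in M$ and $r_1,r_2\in[0,1]$. **Theorem 1.1.** Let $M$ be a compact connected metric measure space, normalized as above, that satisfies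 Condition A with exponent $d$ and Condition B. Then there is a constant $c_3>0$ depending only on $M$ (that is, on the metric measure space) such that for all integers $N\ge 1$, all $0<p<\infty$ and all Borel probability measures $\xi$ on $[0,1]$, $$\lambda_p[M,\xi,N]\le c_3\,(p+1)^{1/2}\,N^{\frac12-\frac1{2d}}.$$ In particular, the same bound, with $c_3$ depending only on $M$, holds for every compact connected smooth Riemannian manifold $M$ (without boundary) of dimension $d\ge1$, where $\theta$ is the geodesic distance divided by the diameter of $M$ and $\mu$ is the Riemannian measure divided by the total volume of $M$. -/

import Mathlib

open scoped Manifold ContDiff Bundle ENNReal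

noncomputable section

/-! ### Ball discrepancies with respect to a distance function `θ` (normalized to diameter one) -/

/-- The ball `B(y, r) = {x | θ(x, y) < r}`, with the convention `B(y, r) = M` for `r ≥ 1`
(for a nonnegative `θ` it is empty for `r ≤ 0`). -/
def distBall {M : Type*} (θ : M → M → ℝ) (y : M) (r : ℝ) : Set M :=
  {x | θ x y < r ∨ 1 ≤ r}

/-- The volume `v(y, r) = μ(B(y, r))`. -/
def ballVolume {M : Type*} [MeasurableSpace M] (θ : M → M → ℝ) (μ : MeasureTheory.Measure M)
    (y : M) (r : ℝ) : ℝ :=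
  μ.real (distBall θ y r)

/-- Ahlfors regularity of dimension `d`: `c₁⁻¹ r ^ d ≤ v(y, r) ≤ c₁ r ^ d` for `0 ≤ r ≤ 1`. -/
def ConditionA {M : Type*} [MeasurableSpace M] (θ : M → M → ℝ) (μ : MeasureTheory.Measure M)
    (d : ℝ) : Prop :=
  0 < d ∧ ∃ c₁ : ℝ, 0 < c₁ ∧ ∀ y : M, ∀ r ∈ Set.Icc (0 : ℝ) 1,
    c₁⁻¹ * r ^ d ≤ ballVolume θ μ y r ∧ ballVolume θ μ y r ≤ c₁ * r ^ d

/-- The volume `v(y, r)` is Lipschitz in `r ∈ [0, 1]`, uniformly in `y`. -/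
def ConditionB {M : Type*} [MeasurableSpace M] (θ : M → M → ℝ) (μ : MeasureTheory.Measure M) :
    Prop :=
  ∃ c₂ : ℝ, 0 < c₂ ∧ ∀ y : M, ∀ r₁ ∈ Set.Icc (0 : ℝ) 1, ∀ r₂ ∈ Set.Icc (0 : ℝ) 1,
    |ballVolume θ μ y r₁ - ballVolume θ μ y r₂| ≤ c₂ * |r₁ - r₂|

/-- The local discrepancy `#(B(y, r) ∩ D) - N v(y, r)` of a finite set `D` with `N` points. -/
def localDiscrepancy {M : Type*} [MeasurableSpace M] (θ : M → M → ℝ)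
    (μ : MeasureTheory.Measure M) (D : Finset M) (y : M) (r : ℝ) : ℝ :=
  (Set.ncard (distBall θ y r ∩ (D : Set M)) : ℝ) - (D.card : ℝ) * ballVolume θ μ y r

/-- The `L_p`-discrepancy of `D`, as an extended nonnegative real. -/
def lpDiscrepancy {M : Type*} [MeasurableSpace M] (θ : M → M → ℝ)
    (μ : MeasureTheory.Measure M) (ξ : MeasureTheory.Measure unitInterval) (p : ℝ)
    (D : Finset M) : ℝ≥0∞ :=
  (∫⁻ z : M × unitInterval,
    ENNReal.ofReal (|localDiscrepancy θ μ D z.1 (z.2 : ℝ)| ^ p) ∂(μ.prod ξ)) ^ (1 / p)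

/-- The extremal `L_p`-discrepancy: the infimum of the `L_p`-discrepancies of all `N`-point
subsets. (The infimum over an empty family would be `∞`.) -/
def extremalLpDiscrepancy {M : Type*} [MeasurableSpace M] (θ : M → M → ℝ)
    (μ : MeasureTheory.Measure M) (ξ : MeasureTheory.Measure unitInterval) (p : ℝ) (N : ℕ) :
    ℝ≥0∞ :=
  ⨅ (D : Finset M) (_ : D.card = N), lpDiscrepancy θ μ ξ p D

/-! ### The Riemannian measure -/

section Riemannian

variable {d : ℕ} {M : Type*} [TopologicalSpace M] [ChartedSpace (EuclideanSpace ℝ (Fin d)) M]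
  [IsManifold (𝓡 d) ∞ M] [Bundle.RiemannianBundle (fun x : M => TangentSpace (𝓡 d) x)]

/-- The coordinate vector field `∂/∂uᵢ` of the chart at `x`, at the point with coordinates `u`. -/
def coordVector (x : M) (u : EuclideanSpace ℝ (Fin d)) (i : Fin d) :
    TangentSpace (𝓡 d) ((chartAt (EuclideanSpace ℝ (Fin d)) x).symm u) :=
  mfderiv (𝓡 d) (𝓡 d) (chartAt (EuclideanSpace ℝ (Fin d)) x).symm u
    (EuclideanSpace.single i (1 : ℝ))

/-- The matrix `g_{ij} = ⟨∂/∂uᵢ, ∂/∂uⱼ⟩` of the metric tensor in the chart at `x`. -/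
def metricMatrix (x : M) (u : EuclideanSpace ℝ (Fin d)) : Matrix (Fin d) (Fin d) ℝ :=
  Matrix.of fun i j => inner ℝ (coordVector x u i) (coordVector x u j)

/-- The measure `√(det g) du` on the domain of the chart at `x`, as a measure on `M`. -/
def chartMeasure [MeasurableSpace M] (x : M) : MeasureTheory.Measure M :=
  ((MeasureTheory.volume.restrict (chartAt (EuclideanSpace ℝ (Fin d)) x).target).withDensity
    fun u => ENNReal.ofReal (Real.sqrt (metricMatrix x u).det)).map
      (chartAt (EuclideanSpace ℝ (Fin d)) x).symm

variable (d M) in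
/-- The Riemannian measure, given by `√(det g) du` in every chart. Since the measures
`√(det g) du` of two charts agree on the overlap of their domains, they are the restrictions
of one measure on `M` to the chart domains, and this measure is their least upper bound. -/
def riemannianMeasure [MeasurableSpace M] : MeasureTheory.Measure M :=
  ⨆ x : M, chartMeasure (d := d) x

end Riemannian

end

/-!
The upper bound for the extremal discrepancy is obtained with jittered sampling. A compact
connected metric space whose measure takes all intermediate values can be cut into `N` parts of
measure `1 / N` and diameter `O(N ^ (-1 / d))` (`exists_equal_measure_partition`): a maximal
separated set is arranged as a tree with edges of comparable length, which is where connectedness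
enters, and the cells of the tree pass their surplus to their parents, from the leaves to the root.
One random point is chosen in every part, independently. For a fixed ball only the parts that meet
its boundary contribute to the discrepancy; they lie in an annulus of width `O(N ^ (-1 / d))`, so
by Condition B there are `O(N ^ (1 - 1 / d))` of them (`card_boundary_parts_le`). By Hoeffding's
lemma the discrepancy is sub-Gaussian with this variance (`lintegral_rpow_count_le`), and
integration over all balls shows that some choice of points satisfies the bound
(`exists_extremalLpDiscrepancy_le`).

For a compact Riemannian manifold the lower volume bound is a comparison with the Euclidean metric
in charts. The substance is Condition B: the volume of `{r₁ ≤ dist · y < r₂}` is at most a constant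
times `r₂ - r₁`, for all radii, also beyond the injectivity radius. Instead of Jacobi fields, the
proof uses that the squared distance to a point is semiconcave in every chart, uniformly in the
point (`IsMetricChart.dist_sq_add_dist_sq_le_of_bounded`): in a chart the squared distance between
nearby points is given by the metric tensor up to third order errors (`exists_isMetricChart`), so a
chain of `n` equal steps along a minimal connection can be displaced in two opposite directions,
with second order change of its energy as `n → ∞`.

For a semiconcave function `D ^ 2`, testing the second difference inequality with a cutoff of slope
comparable to the inverse of the width of the annulus, and summing by parts, bounds the `L²`
increments of `D ^ 2` over the annulus by a multiple of its width
(`IsDistanceLike.integral_increment_le`). Since `D` decreases at a definite rate in a cone of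
directions towards the base point, these increments are also bounded below by the measure of the
annulus, and this gives the linear bound (`exists_measure_annulus_le`). The Riemannian measure is
comparable to Lebesgue measure in a chart by the change of variables formula
(`riemannianMeasure_apply`, `exists_riemannianMeasure_bounds`), and compactness makes all bounds
uniform (`exists_riemannianMeasure_annulus_le_and_le_ball`).
-/

/-! ### Partition into parts of equal measure and small diameter -/

section Partition

open MeasureTheory

/-- A set whose measure is `n * ε` can be cut into `n` pieces of measure `ε`, if the measure
has the intermediate value property. -/
lemma exists_equal_pieces {M : Type*} [MeasurableSpace M] {μ : Measure M} [IsFiniteMeasure μ]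
    (hsplit : ∀ A : Set M, MeasurableSet A → ∀ t : ℝ, 0 ≤ t → t ≤ μ.real A →
      ∃ B ⊆ A, MeasurableSet B ∧ μ.real B = t)
    {ε : ℝ} (hε : 0 ≤ ε) (n : ℕ) :
    ∀ T : Set M, MeasurableSet T → μ.real T = n * ε →
      ∃ P : Fin n → Set M, (∀ i, MeasurableSet (P i)) ∧ (∀ i, P i ⊆ T) ∧
        (∀ i j, i ≠ j → Disjoint (P i) (P j)) ∧ ∀ i, μ.real (P i) = ε := by
  induction n with
  | zero => exact fun T _ _ => ⟨fun i => i.elim0, fun i => i.elim0, fun i => i.elim0,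
      fun i => i.elim0, fun i => i.elim0⟩
  | succ n ih =>
    intro T hT hμ
    obtain ⟨B, hBT, hB, hμB⟩ := hsplit T hT ε hε (by
      rw [hμ]; push_cast; nlinarith [mul_nonneg (Nat.cast_nonneg (α := ℝ) n) hε])
    obtain ⟨P, hP, hPT, hPd, hPμ⟩ := ih (T \ B) (hT.diff hB) (by
      rw [measureReal_sdiff hBT hB, hμ, hμB]; push_cast; ring)
    refine ⟨Fin.cons B P, ?_, ?_, ?_, ?_⟩
    · exact fun i => Fin.cases (by simpa using hB) (fun i => by simpa using hP i) i
    · exact fun i => Fin.cases (by simpa using hBT)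
        (fun i => by simpa using (hPT i).trans Set.sdiff_subset) i
    · have hBP : ∀ i, Disjoint B (P i) := fun i =>
        Set.disjoint_sdiff_right.mono_right (hPT i)
      intro i j
      refine Fin.cases ?_ (fun i => ?_) i <;> refine Fin.cases ?_ (fun j => ?_) j
      · simp
      · intro _; simpa using hBP j
      · intro _; simpa using (hBP i).symm
      · intro hij; simpa using hPd i j (fun h => hij (by rw [h]))
    · exact fun i => Fin.cases (by simpa using hμB) (fun i => by simpa using hPμ i) i

/-- The rearrangement step. The cells `T 0, …, T (k - 1)` are processed from the last to the
first: `T k` is cut into pieces of measure `ε`, and the remainder, taken inside the core `W k`,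
is handed over to the cell of an earlier nearby centre. -/
lemma exists_equal_pieces_of_cells {M : Type*} [MetricSpace M] [MeasurableSpace M]
    {μ : Measure M} [IsFiniteMeasure μ]
    (hsplit : ∀ A : Set M, MeasurableSet A → ∀ t : ℝ, 0 ≤ t → t ≤ μ.real A →
      ∃ B ⊆ A, MeasurableSet B ∧ μ.real B = t)
    {ε ρ : ℝ} (hε : 0 < ε) (s : ℕ → M) (W : ℕ → Set M) (k : ℕ)
    (hWs : ∀ j < k + 1, W j ⊆ Metric.ball (s j) (2 * ρ)) (hWm : ∀ j < k + 1, MeasurableSet (W j))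
    (hW : ∀ j < k + 1, ε ≤ μ.real (W j))
    (hs : ∀ j, 0 < j → j < k + 1 → ∃ i < j, dist (s j) (s i) < 3 * ρ) :
    ∀ (T : ℕ → Set M) (n : ℕ), (∀ j < k + 1, MeasurableSet (T j)) → (∀ j < k + 1, W j ⊆ T j) →
      (∀ j < k + 1, T j ⊆ Metric.ball (s j) (5 * ρ)) →
      (∀ i < k + 1, ∀ j < k + 1, i ≠ j → Disjoint (T i) (T j)) →
      ∑ j ∈ Finset.range (k + 1), μ.real (T j) = n * ε →
      ∃ P : Fin n → Set M, (∀ i, MeasurableSet (P i)) ∧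
        (∀ i, P i ⊆ ⋃ l < k + 1, T l) ∧
        (∀ i j, i ≠ j → Disjoint (P i) (P j)) ∧ (∀ i, μ.real (P i) = ε) ∧
        ∀ i, ∃ x, P i ⊆ Metric.ball x (5 * ρ) := by
  induction k with
  | zero =>
    intro T n hT hWT hTs hTd hsum
    obtain ⟨P, hP, hPT, hPd, hPμ⟩ := exists_equal_pieces hsplit hε.le n (T 0) (hT 0 (by simp))
      (by simpa using hsum)
    exact ⟨P, hP, fun i => by simpa using hPT i, hPd, hPμ,
      fun i => ⟨s 0, (hPT i).trans (hTs 0 (by simp))⟩⟩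
  | succ k ih =>
    intro T n hT hWT hTs hTd hsum
    set t := μ.real (T (k + 1)) with ht
    have ht0 : 0 ≤ t / ε := by positivity
    set m := ⌊t / ε⌋₊ with hm
    have h1 : (m : ℝ) * ε ≤ t := by
      have := Nat.floor_le ht0
      rwa [le_div_iff₀ hε] at this
    have h2 : t < (m + 1 : ℝ) * ε := by
      have := Nat.lt_floor_add_one (t / ε)
      rwa [div_lt_iff₀ hε] at this
    obtain ⟨Q, hQW, hQ, hμQ⟩ := hsplit (W (k + 1)) (hWm _ (by omega)) (t - m * ε) (by linarith)
      (by linarith [hW (k + 1) (by omega)])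
    have hQT : Q ⊆ T (k + 1) := hQW.trans (hWT _ (by omega))
    obtain ⟨P₁, hP₁, hP₁T, hP₁d, hP₁μ⟩ := exists_equal_pieces hsplit hε.le m (T (k + 1) \ Q)
      ((hT _ (by omega)).diff hQ) (by rw [measureReal_sdiff hQT hQ, hμQ]; ring)
    obtain ⟨i₀, hi₀, hdist⟩ := hs (k + 1) (by omega) (by omega)
    set T' := Function.update T i₀ (T i₀ ∪ Q) with hT'
    have hQd : ∀ j < k + 1, Disjoint Q (T j) := fun j hj =>
      (hTd (k + 1) (by omega) j (by omega) (by omega)).mono_left hQT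
    have hT'sum : ∑ j ∈ Finset.range (k + 1), μ.real (T' j) =
        ∑ j ∈ Finset.range (k + 1), μ.real (T j) + (t - m * ε) := by
      have hi : i₀ ∈ Finset.range (k + 1) := Finset.mem_range.2 hi₀
      rw [← Finset.add_sum_erase _ _ hi, ← Finset.add_sum_erase _ (fun j => μ.real (T j)) hi]
      have : ∑ j ∈ (Finset.range (k + 1)).erase i₀, μ.real (T' j) =
          ∑ j ∈ (Finset.range (k + 1)).erase i₀, μ.real (T j) := by
        refine Finset.sum_congr rfl fun j hj => ?_
        rw [hT', Function.update_of_ne (Finset.ne_of_mem_erase hj)]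
      rw [this, hT', Function.update_self, measureReal_union (hQd i₀ hi₀).symm hQ, hμQ]
      ring
    rw [Finset.sum_range_succ, ← ht] at hsum
    have hmn : m ≤ n := by
      have : (0 : ℝ) ≤ ∑ j ∈ Finset.range (k + 1), μ.real (T j) :=
        Finset.sum_nonneg fun _ _ => measureReal_nonneg
      have : (m : ℝ) * ε ≤ n * ε := by linarith
      exact_mod_cast le_of_mul_le_mul_right this hε
    obtain ⟨n', rfl⟩ := Nat.exists_eq_add_of_le hmn
    have hT'cases : ∀ j, T' j ⊆ T j ∪ Q := fun j => by
      by_cases h : j = i₀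
      · subst h; simp [hT']
      · simp [hT', Function.update_of_ne h]
    obtain ⟨P₂, hP₂, hP₂T, hP₂d, hP₂μ, hP₂s⟩ := ih (fun j hj => hWs j (by omega))
      (fun j hj => hWm j (by omega)) (fun j hj => hW j (by omega))
      (fun j hj hj' => hs j hj (by omega)) T' n'
      (fun j hj => by
        by_cases h : j = i₀
        · subst h; simpa [hT'] using (hT j (by omega)).union hQ
        · simpa [hT', Function.update_of_ne h] using hT j (by omega))
      (fun j hj => by
        by_cases h : j = i₀
        · subst h; simpa [hT'] using (hWT j (by omega)).trans Set.subset_union_left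
        · simpa [hT', Function.update_of_ne h] using hWT j (by omega))
      (fun j hj => by
        by_cases h : j = i₀
        · subst h
          simp only [hT', Function.update_self, Set.union_subset_iff]
          refine ⟨hTs j (by omega), fun x hx => ?_⟩
          have := hWs (k + 1) (by omega) (hQW hx)
          rw [Metric.mem_ball] at this ⊢
          linarith [dist_triangle x (s (k + 1)) (s j)]
        · simpa [hT', Function.update_of_ne h] using hTs j (by omega))
      (fun i hi j hj hij => by
        by_cases h : i = i₀
        · subst h
          rw [hT', Function.update_self, Function.update_of_ne (Ne.symm hij)]
          exact (hTd i (by omega) j (by omega) hij).union_left (hQd j hj)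
        · by_cases h' : j = i₀
          · subst h'
            rw [hT', Function.update_self, Function.update_of_ne hij]
            exact (hTd i (by omega) j (by omega) hij).union_right (hQd i hi).symm
          · rw [hT', Function.update_of_ne h, Function.update_of_ne h']
            exact hTd i (by omega) j (by omega) hij)
      (by rw [hT'sum]; push_cast at hsum; linarith)
    have hP₂U : ∀ i, P₂ i ⊆ (⋃ l < k + 1, T l) ∪ Q := fun i x hx => by
      obtain ⟨l, hl, h⟩ := Set.mem_iUnion₂.1 (hP₂T i hx)
      rcases hT'cases l h with h | h
      · exact Or.inl (Set.mem_biUnion (show l ∈ {l | l < k + 1} from hl) h)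
      · exact Or.inr h
    have hcross : ∀ i j, Disjoint (P₁ i) (P₂ j) := fun i j => by
      refine Set.disjoint_left.2 fun x hx hx' => ?_
      have hx1 := hP₁T i hx
      rcases hP₂U j hx' with h | h
      · obtain ⟨l, hl, h⟩ := Set.mem_iUnion₂.1 h
        exact Set.disjoint_left.1 (hTd l (by omega) (k + 1) (by omega) (by omega)) h hx1.1
      · exact hx1.2 h
    refine ⟨Fin.append P₁ P₂, ?_, ?_, ?_, ?_, ?_⟩
    · exact fun i => Fin.addCases (fun i => by simpa using hP₁ i) (fun i => by simpa using hP₂ i) i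
    · have hTk : ∀ l < k + 1 + 1, T l ⊆ ⋃ l < k + 1 + 1, T l := fun l hl =>
        Set.subset_biUnion_of_mem (u := fun l => T l) (show l ∈ {l | l < k + 1 + 1} from hl)
      refine fun i => Fin.addCases (fun i => ?_) (fun i => ?_) i
      · rw [Fin.append_left]
        exact ((hP₁T i).trans Set.sdiff_subset).trans (hTk _ (by omega))
      · rw [Fin.append_right]
        exact (hP₂U i).trans (Set.union_subset
          (Set.iUnion₂_subset fun l hl => hTk l (by omega)) (hQT.trans (hTk _ (by omega))))
    · intro i j
      refine Fin.addCases (fun i => ?_) (fun i => ?_) i <;>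
        refine Fin.addCases (fun j => ?_) (fun j => ?_) j
      · intro h; simpa using hP₁d i j (fun h' => h (by rw [h']))
      · intro _; simpa using hcross i j
      · intro _; simpa using (hcross j i).symm
      · intro h; simpa using hP₂d i j (fun h' => h (by rw [h']))
    · exact fun i => Fin.addCases (fun i => by simpa using hP₁μ i) (fun i => by simpa using hP₂μ i) i
    · exact fun i => Fin.addCases
        (fun i => ⟨s (k + 1), by
          simpa using ((hP₁T i).trans Set.sdiff_subset).trans (hTs (k + 1) (by omega))⟩)
        (fun i => by simpa using hP₂s i) i

/-- In a connected space, a maximal `2ρ`-separated sequence can be built so that every centre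
is within `3ρ` of an earlier one. The length of the sequence is bounded because the balls of
radius `ρ` are disjoint and have measure at least `ε`. -/
lemma exists_chained_net {M : Type*} [MetricSpace M] [ConnectedSpace M]
    [MeasurableSpace M] [BorelSpace M] {μ : Measure M} [IsFiniteMeasure μ] {ε ρ : ℝ} (hε : 0 < ε)
    (hρ : 0 < ρ) (hball : ∀ x : M, ε ≤ μ.real (Metric.ball x ρ)) :
    ∃ (k : ℕ) (s : ℕ → M), (∀ i j, i < j → j < k + 1 → 2 * ρ ≤ dist (s j) (s i)) ∧
      (∀ j, 0 < j → j < k + 1 → ∃ i < j, dist (s j) (s i) < 3 * ρ) ∧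
      ∀ x, ∃ i < k + 1, dist x (s i) < 2 * ρ := by
  classical
  by_contra! hcon
  have key : ∀ k : ℕ, ∃ s : ℕ → M, (∀ i j, i < j → j < k + 1 → 2 * ρ ≤ dist (s j) (s i)) ∧
      (∀ j, 0 < j → j < k + 1 → ∃ i < j, dist (s j) (s i) < 3 * ρ) := by
    intro k
    induction k with
    | zero =>
      obtain ⟨x⟩ : Nonempty M := inferInstance
      exact ⟨fun _ => x, fun i j _ _ => by omega, fun j _ _ => by omega⟩
    | succ k ih =>
      obtain ⟨s, h1, h2⟩ := ih
      obtain ⟨x, hx⟩ := hcon k s h1 h2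
      set U := ⋃ i ∈ Finset.range (k + 1), Metric.ball (s i) (2 * ρ) with hU
      have hUo : IsOpen U := isOpen_biUnion fun _ _ => Metric.isOpen_ball
      have hUne : U.Nonempty := ⟨s 0, by
        simp only [hU, Set.mem_iUnion]
        exact ⟨0, by simp, Metric.mem_ball_self (by positivity)⟩⟩
      have hUc : ¬ IsClosed U := fun hc => by
        have : U = Set.univ := IsClopen.eq_univ ⟨hc, hUo⟩ hUne
        have hxU : x ∈ U := this ▸ Set.mem_univ x
        simp only [hU, Set.mem_iUnion, Finset.mem_range, Metric.mem_ball] at hxU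
        obtain ⟨i, hi, h⟩ := hxU
        linarith [hx i hi]
      obtain ⟨z, hzc, hzU⟩ : ∃ z ∈ closure U, z ∉ U := by
        by_contra! h
        exact hUc (isClosed_of_closure_subset h)
      obtain ⟨y, hyU, hzy⟩ := Metric.mem_closure_iff.1 hzc ρ hρ
      simp only [hU, Set.mem_iUnion, Finset.mem_range, Metric.mem_ball, not_exists, not_lt]
        at hzU hyU
      obtain ⟨i, hi, hyi⟩ := hyU
      refine ⟨Function.update s (k + 1) z, fun a b hab hb => ?_, fun j hj hj' => ?_⟩
      · rw [Function.update_of_ne (a := a) (by omega)]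
        rcases Nat.lt_succ_iff_lt_or_eq.1 hb with hb | rfl
        · rw [Function.update_of_ne (by omega)]
          exact h1 a b hab hb
        · rw [Function.update_self]
          exact hzU a (by omega)
      · rcases Nat.lt_succ_iff_lt_or_eq.1 hj' with hj' | rfl
        · obtain ⟨a, ha, h⟩ := h2 j hj hj'
          refine ⟨a, ha, ?_⟩
          rwa [Function.update_of_ne (by omega), Function.update_of_ne (by omega)]
        · refine ⟨i, hi, ?_⟩
          rw [Function.update_self, Function.update_of_ne (by omega)]
          linarith [dist_triangle z y (s i)]
  obtain ⟨k, hk⟩ := exists_nat_gt (μ.real Set.univ / ε)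
  obtain ⟨s, h1, -⟩ := key k
  have hdisj : (↑(Finset.range (k + 1)) : Set ℕ).PairwiseDisjoint
      (fun i => Metric.ball (s i) ρ) := by
    intro i hi j hj hij
    refine Metric.ball_disjoint_ball ?_
    simp only [Finset.coe_range, Set.mem_Iio] at hi hj
    rcases lt_or_gt_of_ne hij with h | h
    · rw [dist_comm]; linarith [h1 i j h hj]
    · linarith [h1 j i h hi]
  have hsum := measureReal_biUnion_finset (μ := μ) hdisj (fun _ _ => measurableSet_ball)
  have h3 : ((k + 1 : ℕ) : ℝ) * ε ≤ ∑ i ∈ Finset.range (k + 1), μ.real (Metric.ball (s i) ρ) := by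
    have := Finset.card_nsmul_le_sum (Finset.range (k + 1))
      (fun i => μ.real (Metric.ball (s i) ρ)) ε (fun i _ => hball _)
    simpa using this
  have h4 : μ.real (⋃ i ∈ Finset.range (k + 1), Metric.ball (s i) ρ) ≤ μ.real Set.univ :=
    measureReal_mono (Set.subset_univ _)
  rw [div_lt_iff₀ hε] at hk
  push_cast at h3
  nlinarith

/-- A connected metric space with a probability measure that has the intermediate value
property, and for which balls of radius `ρ` have measure at least `1 / N`, splits into `N`
parts of measure `1 / N` and diameter at most `10 ρ`. -/
lemma exists_equal_measure_partition {M : Type*} [MetricSpace M] [ConnectedSpace M]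
    [MeasurableSpace M] [BorelSpace M] {μ : Measure M} [IsProbabilityMeasure μ]
    (hsplit : ∀ A : Set M, MeasurableSet A → ∀ t : ℝ, 0 ≤ t → t ≤ μ.real A →
      ∃ B ⊆ A, MeasurableSet B ∧ μ.real B = t)
    {N : ℕ} (hN : 1 ≤ N) {ρ : ℝ} (hρ : 0 < ρ)
    (hball : ∀ x : M, (1 / N : ℝ) ≤ μ.real (Metric.ball x ρ)) :
    ∃ P : Fin N → Set M, (∀ i, MeasurableSet (P i)) ∧
      (∀ i j, i ≠ j → Disjoint (P i) (P j)) ∧ (∀ i, μ.real (P i) = 1 / N) ∧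
      ∀ i, ∀ x ∈ P i, ∀ y ∈ P i, dist x y < 10 * ρ := by
  have hN0 : (0 : ℝ) < N := by exact_mod_cast hN
  have hε : (0 : ℝ) < 1 / N := by positivity
  obtain ⟨k, s, hsep, hchain, hcov⟩ := exists_chained_net hε hρ hball
  -- the cell `W j`: the ball of radius `ρ` at `s j`, and the points of the ball of radius `2ρ`
  -- that lie in no other small ball and in no earlier large ball
  let V : ℕ → Set M := fun j => Metric.ball (s j) (2 * ρ) \
    ((⋃ i ∈ Finset.range (k + 1), Metric.ball (s i) ρ) ∪
      ⋃ i ∈ Finset.range j, Metric.ball (s i) (2 * ρ))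
  let W : ℕ → Set M := fun j => Metric.ball (s j) ρ ∪ V j
  have hVm : ∀ j, MeasurableSet (V j) := fun j =>
    measurableSet_ball.diff ((Finset.measurableSet_biUnion _ fun _ _ => measurableSet_ball).union
      (Finset.measurableSet_biUnion _ fun _ _ => measurableSet_ball))
  have hWm : ∀ j, MeasurableSet (W j) := fun j => measurableSet_ball.union (hVm j)
  have hWs : ∀ j, W j ⊆ Metric.ball (s j) (2 * ρ) := fun j =>
    Set.union_subset (Metric.ball_subset_ball (by linarith)) Set.sdiff_subset
  have hWd' : ∀ i j, i < j → j < k + 1 → Disjoint (W i) (W j) := by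
    intro i j hij hj
    have hbb : Disjoint (Metric.ball (s i) ρ) (Metric.ball (s j) ρ) :=
      Metric.ball_disjoint_ball (by rw [dist_comm]; linarith [hsep i j hij hj])
    have hbV : ∀ a < k + 1, ∀ b, Disjoint (Metric.ball (s a) ρ) (V b) := fun a ha b =>
      Set.disjoint_left.2 fun x hx hx' => hx'.2 (Or.inl (by
        simp only [Set.mem_iUnion, Finset.mem_range]; exact ⟨a, ha, hx⟩))
    have hVV : Disjoint (V i) (V j) := Set.disjoint_left.2 fun x hx hx' => hx'.2 (Or.inr (by
      simp only [Set.mem_iUnion, Finset.mem_range]; exact ⟨i, hij, hx.1⟩))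
    exact (hbb.union_right (hbV i (by omega) j)).union_left
      ((hbV j hj i).symm.union_right hVV)
  have hWd : ∀ i < k + 1, ∀ j < k + 1, i ≠ j → Disjoint (W i) (W j) := by
    intro i hi j hj hij
    rcases lt_or_gt_of_ne hij with h | h
    · exact hWd' i j h hj
    · exact (hWd' j i h hi).symm
  have hWcov : ⋃ j ∈ Finset.range (k + 1), W j = Set.univ := by
    refine Set.eq_univ_of_forall fun x => ?_
    simp only [Set.mem_iUnion, Finset.mem_range]
    by_cases hx : ∃ i < k + 1, x ∈ Metric.ball (s i) ρ
    · obtain ⟨i, hi, h⟩ := hx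
      exact ⟨i, hi, Or.inl h⟩
    · classical
      have hex := hcov x
      refine ⟨Nat.find hex, (Nat.find_spec hex).1, Or.inr ⟨(Nat.find_spec hex).2, ?_⟩⟩
      rintro (h | h)
      · simp only [Set.mem_iUnion, Finset.mem_range] at h
        obtain ⟨i, hi, h⟩ := h
        exact hx ⟨i, hi, h⟩
      · simp only [Set.mem_iUnion, Finset.mem_range] at h
        obtain ⟨i, hi, h⟩ := h
        exact Nat.find_min hex hi ⟨hi.trans (Nat.find_spec hex).1, h⟩
  have hsum : ∑ j ∈ Finset.range (k + 1), μ.real (W j) = (N : ℕ) * (1 / N : ℝ) := by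
    rw [← measureReal_biUnion_finset (fun i hi j hj hij => hWd i (by simpa using hi) j
      (by simpa using hj) hij) (fun j _ => hWm j), hWcov, probReal_univ]
    field_simp
  obtain ⟨P, hP, -, hPd, hPμ, hPs⟩ := exists_equal_pieces_of_cells hsplit hε s W k
    (fun j _ => hWs j) (fun j _ => hWm j)
    (fun j _ => (hball (s j)).trans (measureReal_mono Set.subset_union_left)) hchain W N
    (fun j _ => hWm j) (fun j _ => subset_rfl)
    (fun j _ => (hWs j).trans (Metric.ball_subset_ball (by linarith))) hWd hsum
  refine ⟨P, hP, hPd, hPμ, fun i x hx y hy => ?_⟩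
  obtain ⟨z, hz⟩ := hPs i
  have h1 := Metric.mem_ball.1 (hz hx)
  have h2 := Metric.mem_ball.1 (hz hy)
  linarith [dist_triangle_right x y z]

end Partition

/-! ### Random points in the parts of a partition -/

section RandomPoints

open MeasureTheory ProbabilityTheory

/-- The moments of a sub-Gaussian variable grow like those of a Gaussian one: comparing `|x| ^ q`
with `exp (t |x|)` for `t = √(q / K)`. -/
lemma lintegral_rpow_le_of_hasSubgaussianMGF {Ω : Type*} {mΩ : MeasurableSpace Ω} {μ : Measure Ω}
    [IsProbabilityMeasure μ] {X : Ω → ℝ} {c : NNReal} (hX : HasSubgaussianMGF X c μ) {K q : ℝ}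
    (hK : 0 < K) (hcK : c ≤ K) (hq : 1 ≤ q) :
    ∫⁻ w, ENNReal.ofReal (|X w| ^ q) ∂μ ≤ ENNReal.ofReal ((4 * √(q * K)) ^ q) := by
  have hq0 : 0 < q := by linarith
  set t := √(q / K) with ht
  have ht0 : 0 < t := Real.sqrt_pos.2 (by positivity)
  have ht2 : t ^ 2 = q / K := Real.sq_sqrt (by positivity)
  have hqt : q / t = √(q * K) := by
    rw [div_eq_iff ht0.ne', ht, ← Real.sqrt_mul (by positivity),
      show q * K * (q / K) = q ^ 2 by field_simp, Real.sqrt_sq hq0.le]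
  have hint : Integrable (fun w => (q / t) ^ q * (Real.exp (t * X w) + Real.exp (-t * X w))) μ :=
    ((hX.integrable_exp_mul t).add (hX.integrable_exp_mul (-t))).const_mul _
  have hpt : ∀ w, |X w| ^ q ≤ (q / t) ^ q * (Real.exp (t * X w) + Real.exp (-t * X w)) := by
    intro w
    have h1 : t * |X w| / q ≤ Real.exp (t * |X w| / q) :=
      (by linarith [Real.add_one_le_exp (t * |X w| / q)])
    have h2 : (t * |X w| / q) ^ q ≤ Real.exp (t * |X w|) := by
      refine (Real.rpow_le_rpow (by positivity) h1 hq0.le).trans_eq ?_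
      rw [← Real.exp_mul, div_mul_cancel₀ _ hq0.ne']
    have h3 : Real.exp (t * |X w|) ≤ Real.exp (t * X w) + Real.exp (-t * X w) := by
      rcases abs_cases (X w) with ⟨h, _⟩ | ⟨h, _⟩ <;> rw [h]
      · linarith [Real.exp_pos (-t * X w)]
      · rw [show t * -X w = -t * X w by ring]; linarith [Real.exp_pos (t * X w)]
    have h4 : |X w| ^ q = (q / t) ^ q * (t * |X w| / q) ^ q := by
      rw [← Real.mul_rpow (by positivity) (by positivity)]
      congr 1; field_simp
    rw [h4]
    exact mul_le_mul_of_nonneg_left (h2.trans h3) (by positivity)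
  have hmgf : ∀ s : ℝ, s ^ 2 = q / K → ∫ w, Real.exp (s * X w) ∂μ ≤ Real.exp (q / 2) := by
    intro s hs
    refine (hX.mgf_le s).trans (Real.exp_le_exp.2 ?_)
    rw [hs]
    have : (c : ℝ) * (q / K) ≤ K * (q / K) := mul_le_mul_of_nonneg_right hcK (by positivity)
    rw [mul_div_cancel₀ _ hK.ne'] at this
    linarith
  have hexp : Real.exp (q / 2) ≤ 2 ^ q := by
    have h : Real.exp (1 / 2) ≤ 2 := by
      have h1 : Real.exp (1 / 2) ^ 2 = Real.exp 1 := by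
        rw [← Real.exp_nat_mul]; norm_num
      nlinarith [Real.exp_one_lt_d9, Real.exp_pos (1 / 2)]
    calc Real.exp (q / 2) = Real.exp (1 / 2) ^ q := by rw [← Real.exp_mul]; ring_nf
      _ ≤ 2 ^ q := Real.rpow_le_rpow (Real.exp_pos _).le h hq0.le
  have htwo : (2 : ℝ) ≤ 2 ^ q := by
    simpa using Real.rpow_le_rpow_of_exponent_le (x := 2) (by norm_num) hq
  calc ∫⁻ w, ENNReal.ofReal (|X w| ^ q) ∂μ
      ≤ ∫⁻ w, ENNReal.ofReal ((q / t) ^ q * (Real.exp (t * X w) + Real.exp (-t * X w))) ∂μ :=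
        lintegral_mono fun w => ENNReal.ofReal_le_ofReal (hpt w)
    _ = ENNReal.ofReal (∫ w, (q / t) ^ q * (Real.exp (t * X w) + Real.exp (-t * X w)) ∂μ) :=
        (ofReal_integral_eq_lintegral_ofReal hint (ae_of_all _ fun w => by positivity)).symm
    _ ≤ ENNReal.ofReal ((4 * √(q * K)) ^ q) := by
        refine ENNReal.ofReal_le_ofReal ?_
        rw [integral_const_mul, integral_add (hX.integrable_exp_mul t) (hX.integrable_exp_mul (-t)),
          hqt, Real.mul_rpow (by norm_num) (by positivity), mul_comm ((4 : ℝ) ^ q),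
          show (4 : ℝ) = 2 * 2 by norm_num, Real.mul_rpow (by norm_num) (by norm_num)]
        refine mul_le_mul_of_nonneg_left ?_ (by positivity)
        have h1 := hmgf t ht2
        have h2 := hmgf (-t) (by rw [neg_sq, ht2])
        nlinarith

/-- For independent points `x i`, where `x i` has distribution `ν i`, the moments of the number
of points in `B`, minus its mean, are controlled by the number of indices `i` for which `B`
neither contains nor misses almost every point for `ν i`. -/
lemma lintegral_rpow_count_le {ι M : Type*} [Fintype ι] [MeasurableSpace M] (ν : ι → Measure M)
    [∀ i, IsProbabilityMeasure (ν i)] {B : Set M} (hB : MeasurableSet B) (S : Finset ι)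
    (hS : ∀ i ∉ S, (∀ᵐ x ∂ν i, x ∈ B) ∨ (∀ᵐ x ∂ν i, x ∉ B)) {K q : ℝ} (hK : 0 < K)
    (hSK : (S.card : ℝ) ≤ K) (hq : 1 ≤ q) :
    ∫⁻ x, ENNReal.ofReal (|∑ i, B.indicator 1 (x i) - ∑ i, (ν i).real B| ^ q)
      ∂(Measure.pi ν) ≤ ENNReal.ofReal ((4 * √(q * K)) ^ q) := by
  classical
  let c : ι → NNReal := fun i => if i ∈ S then (‖(1 : ℝ) - 0‖₊ / 2) ^ 2 else 0
  have hmeas : Measurable (B.indicator (1 : M → ℝ)) := measurable_one.indicator hB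
  have hmean : ∀ i, ∫ x, B.indicator (1 : M → ℝ) x ∂(ν i) = (ν i).real B := fun i =>
    integral_indicator_one hB
  have hsub : ∀ i, HasSubgaussianMGF (fun x => B.indicator 1 x - (ν i).real B) (c i) (ν i) := by
    intro i
    by_cases hi : i ∈ S
    · simp only [c, hi, if_true, ← hmean i]
      refine hasSubgaussianMGF_of_mem_Icc hmeas.aemeasurable (ae_of_all _ fun x => ?_)
      by_cases hx : x ∈ B <;> simp [hx]
    · simp only [c, hi, if_false]
      refine HasSubgaussianMGF.fun_zero.congr ?_
      rcases hS i hi with h | h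
      · have h1 : (ν i).real B = 1 := by
          rw [measureReal_def, (mem_ae_iff_prob_eq_one hB).1 h]; simp
        filter_upwards [h] with x hx
        simp [hx, h1]
      · have h1 : (ν i).real B = 0 := by
          rw [measureReal_def, (measure_eq_zero_iff_ae_notMem).2 h]; simp
        filter_upwards [h] with x hx
        simp [hx, h1]
  have hindep : iIndepFun (fun (i : ι) (x : ι → M) => B.indicator (1 : M → ℝ) (x i) -
      (ν i).real B) (Measure.pi ν) :=
    iIndepFun_pi (X := fun i x => B.indicator (1 : M → ℝ) x - (ν i).real B)
      fun i => (hmeas.sub_const _).aemeasurable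
  have hsub' : ∀ i, HasSubgaussianMGF (fun x : ι → M => B.indicator 1 (x i) - (ν i).real B)
      (c i) (Measure.pi ν) := fun i => by
    refine HasSubgaussianMGF.of_map (Y := fun x : ι → M => x i)
      (X := fun x => B.indicator 1 x - (ν i).real B) (measurable_pi_apply i).aemeasurable ?_
    have : (Measure.pi ν).map (fun x : ι → M => x i) = ν i := (measurePreserving_eval ν i).map_eq
    rw [this]
    exact hsub i
  have hsum := HasSubgaussianMGF.sum_of_iIndepFun hindep (s := Finset.univ) (c := c)
    fun i _ => hsub' i
  have hc : ((∑ i, c i : NNReal) : ℝ) ≤ K := by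
    refine le_trans ?_ hSK
    have h : ∑ i, c i ≤ ∑ i, if i ∈ S then 1 else 0 := by
      refine Finset.sum_le_sum fun i _ => ?_
      by_cases hi : i ∈ S <;> simp only [c, hi, if_true, if_false, le_refl]
      rw [← NNReal.coe_le_coe]; norm_num
    rw [Finset.sum_boole, Finset.filter_mem_eq_inter, Finset.univ_inter] at h
    exact_mod_cast h
  have := lintegral_rpow_le_of_hasSubgaussianMGF hsum hK hc hq
  simpa only [Finset.sum_sub_distrib] using this

end RandomPoints

/-! ### The discrepancy bound for metric measure spaces -/

section Discrepancy

open MeasureTheory ProbabilityTheory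

lemma distBall_mono {X : Type*} {θ : X → X → ℝ} {y : X} {r₁ r₂ : ℝ} (h : r₁ ≤ r₂) :
    distBall θ y r₁ ⊆ distBall θ y r₂ := fun _ hx => by
  rcases hx with hx | hx
  · exact Or.inl (hx.trans_le h)
  · exact Or.inr (hx.trans h)

variable {M : Type*} [MetricSpace M] {L : ℝ}

lemma measurableSet_setOf_mem_distBall [SecondCountableTopology M] [MeasurableSpace M]
    [BorelSpace M] :
    MeasurableSet {z : M × M × unitInterval |
      z.1 ∈ distBall (fun x y : M => dist x y / L) z.2.1 (z.2.2 : ℝ)} := by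
  have h1 : Measurable fun z : M × M × unitInterval => dist z.1 z.2.1 / L := by fun_prop
  have h2 : Measurable fun z : M × M × unitInterval => (z.2.2 : ℝ) := by fun_prop
  exact (measurableSet_lt h1 h2).union (measurableSet_le measurable_const h2)

lemma measurableSet_distBall [MeasurableSpace M] [BorelSpace M] (y : M) (r : ℝ) :
    MeasurableSet (distBall (fun x y : M => dist x y / L) y r) := by
  have h1 : Measurable fun x : M => dist x y / L := by fun_prop
  exact (measurableSet_lt h1 measurable_const).union (MeasurableSet.const (1 ≤ r))

/-- Under Condition B the measure takes all intermediate values: intersect with balls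
of growing radius around a fixed point. -/
lemma exists_subset_measureReal_eq [Nonempty M] [MeasurableSpace M] [BorelSpace M] (hL : 0 < L)
    {μ : Measure M} [IsFiniteMeasure μ] (hB : ConditionB (fun x y : M => dist x y / L) μ)
    (A : Set M) (hA : MeasurableSet A) (t : ℝ) (ht : 0 ≤ t) (htA : t ≤ μ.real A) :
    ∃ B ⊆ A, MeasurableSet B ∧ μ.real B = t := by
  obtain ⟨y⟩ := ‹Nonempty M›
  obtain ⟨c₂, hc₂, hlip⟩ := hB
  set θ : M → M → ℝ := fun x y => dist x y / L
  have hθm := measurableSet_distBall (M := M) (L := L) y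
  let f : ℝ → ℝ := fun r => μ.real (A ∩ distBall θ y r)
  have hf : ∀ r₁ ∈ Set.Icc (0 : ℝ) 1, ∀ r₂ ∈ Set.Icc (0 : ℝ) 1, r₁ ≤ r₂ →
      |f r₂ - f r₁| ≤ c₂ * |r₂ - r₁| := by
    intro r₁ h₁ r₂ h₂ hr
    refine le_trans ?_ (hlip y r₂ h₂ r₁ h₁)
    have hs : A ∩ distBall θ y r₁ ⊆ A ∩ distBall θ y r₂ :=
      Set.inter_subset_inter_right _ (distBall_mono hr)
    have e1 : f r₂ - f r₁ = μ.real ((A ∩ distBall θ y r₂) \ (A ∩ distBall θ y r₁)) :=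
      (measureReal_sdiff hs (hA.inter (hθm r₁))).symm
    have e2 : ballVolume θ μ y r₂ - ballVolume θ μ y r₁ =
        μ.real (distBall θ y r₂ \ distBall θ y r₁) :=
      (measureReal_sdiff (distBall_mono hr) (hθm r₁)).symm
    rw [e1, e2, abs_of_nonneg measureReal_nonneg, abs_of_nonneg measureReal_nonneg]
    exact measureReal_mono fun x hx => ⟨hx.1.2, fun h => hx.2 ⟨hx.1.1, h⟩⟩
  have hcont : ContinuousOn f (Set.Icc 0 1) := by
    have : LipschitzOnWith c₂.toNNReal f (Set.Icc 0 1) := by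
      refine LipschitzOnWith.of_dist_le_mul fun r₁ h₁ r₂ h₂ => ?_
      rw [Real.dist_eq, Real.dist_eq, Real.coe_toNNReal _ hc₂.le]
      rcases le_total r₁ r₂ with h | h
      · rw [abs_sub_comm, abs_sub_comm r₁]; exact hf r₁ h₁ r₂ h₂ h
      · exact hf r₂ h₂ r₁ h₁ h
    exact this.continuousOn
  have h0 : f 0 = 0 := by
    have : distBall θ y 0 = ∅ := Set.eq_empty_of_forall_notMem fun x hx => by
      rcases hx with hx | hx
      · exact absurd hx (not_lt.2 (by positivity))
      · norm_num at hx
    simp [f, this]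
  have h1 : f 1 = μ.real A := by
    have : distBall θ y 1 = Set.univ := Set.eq_univ_of_forall fun x => Or.inr le_rfl
    simp [f, this]
  obtain ⟨r, -, hr⟩ := intermediate_value_Icc zero_le_one hcont
    (show t ∈ Set.Icc (f 0) (f 1) by rw [h0, h1]; exact ⟨ht, htA⟩)
  exact ⟨_, Set.inter_subset_left, hA.inter (hθm r), hr⟩

/-- Only few parts of small diameter meet the boundary of a ball: they lie in an annulus, whose
measure is controlled by Condition B. -/
lemma card_boundary_parts_le [MeasurableSpace M] [BorelSpace M] (hL : 0 < L)
    {μ : Measure M} [IsProbabilityMeasure μ] {c₂ : ℝ} (hc₂ : 0 < c₂)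
    (hB : ∀ y : M, ∀ r₁ ∈ Set.Icc (0 : ℝ) 1, ∀ r₂ ∈ Set.Icc (0 : ℝ) 1,
      |ballVolume (fun x y : M => dist x y / L) μ y r₁ -
        ballVolume (fun x y : M => dist x y / L) μ y r₂| ≤ c₂ * |r₁ - r₂|)
    {N : ℕ} (hN : 1 ≤ N) {P : Fin N → Set M} (hP : ∀ i, MeasurableSet (P i))
    (hPd : ∀ i j, i ≠ j → Disjoint (P i) (P j)) (hPμ : ∀ i, μ.real (P i) = 1 / N) {δ : ℝ}
    (hPδ : ∀ i, ∀ x ∈ P i, ∀ y ∈ P i, dist x y < δ * L) (hδ : 0 < δ) (y : M) {r : ℝ} (hr : 0 ≤ r)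
    (S : Finset (Fin N))
    (hS : ∀ i ∈ S, (∃ x ∈ P i, x ∈ distBall (fun x y : M => dist x y / L) y r) ∧
      ∃ x ∈ P i, x ∉ distBall (fun x y : M => dist x y / L) y r) :
    (S.card : ℝ) ≤ N * (c₂ * (2 * δ)) := by
  set θ : M → M → ℝ := fun x y => dist x y / L with hθ
  have hN0 : (0 : ℝ) < N := by exact_mod_cast hN
  rcases S.eq_empty_or_nonempty with rfl | ⟨i₀, hi₀⟩
  · simp only [Finset.card_empty, Nat.cast_zero]; positivity
  have hr1 : r < 1 := by
    by_contra! h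
    obtain ⟨-, x, -, hx⟩ := hS i₀ hi₀
    exact hx (Or.inr h)
  have htri : ∀ i, ∀ x ∈ P i, ∀ z ∈ P i, θ z y < θ x y + δ := by
    intro i x hx z hz
    have h1 := hPδ i z hz x hx
    have h2 := dist_triangle z x y
    simp only [hθ]
    rw [div_add' _ _ _ hL.ne', div_lt_div_iff_of_pos_right hL]
    linarith
  set r₁ := max (r - δ) 0 with hr₁
  set r₂ := min (r + δ) 1 with hr₂
  have hr₁' : r₁ ∈ Set.Icc (0 : ℝ) 1 := ⟨le_max_right _ _, max_le (by linarith) zero_le_one⟩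
  have hr₂' : r₂ ∈ Set.Icc (0 : ℝ) 1 := ⟨le_min (by linarith) zero_le_one, min_le_right _ _⟩
  have hle : r₁ ≤ r₂ := max_le (le_min (by linarith) (by linarith)) hr₂'.1
  have hsub : (⋃ i ∈ S, P i) ⊆ distBall θ y r₂ \ distBall θ y r₁ := by
    refine Set.iUnion₂_subset fun i hi z hz => ?_
    obtain ⟨⟨x, hx, hxr⟩, x', hx', hxr'⟩ := hS i hi
    have hxr : θ x y < r := hxr.resolve_right (not_le.2 hr1)
    have hxr' : r ≤ θ x' y := not_lt.1 fun h => hxr' (Or.inl h)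
    refine ⟨?_, ?_⟩
    · rcases le_total (r + δ) 1 with h | h
      · left
        rw [hr₂, min_eq_left h]
        linarith [htri i x hx z hz]
      · right
        rw [hr₂, min_eq_right h]
    · rintro (h | h)
      · rcases lt_max_iff.1 h with h | h
        · linarith [htri i z hz x' hx']
        · exact absurd h (not_lt.2 (by simp only [hθ]; positivity))
      · have : r₁ < 1 := max_lt (by linarith) zero_lt_one
        linarith
  have hμU : μ.real (⋃ i ∈ S, P i) = S.card * (1 / N) := by
    rw [measureReal_biUnion_finset (fun i _ j _ hij => hPd i j hij) fun i _ => hP i,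
      Finset.sum_congr rfl fun i _ => hPμ i, Finset.sum_const, nsmul_eq_mul]
  have h1 := measureReal_mono (μ := μ) hsub
  rw [hμU, measureReal_sdiff (distBall_mono hle) (measurableSet_distBall y r₁)] at h1
  have h2 := (le_abs_self _).trans (hB y r₂ hr₂' r₁ hr₁')
  have h3 : |r₂ - r₁| ≤ 2 * δ := by
    rw [abs_of_nonneg (by linarith)]
    linarith [min_le_left (r + δ) 1, le_max_left (r - δ) 0]
  have h4 : (S.card : ℝ) * (1 / N) ≤ c₂ * (2 * δ) :=
    (h1.trans h2).trans (mul_le_mul_of_nonneg_left h3 hc₂.le)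
  rw [mul_one_div, div_le_iff₀ hN0] at h4
  linarith

/-- On a probability space a bound for the `L_{p+1}` norm is a bound for the `L_p` norm. -/
lemma lintegral_rpow_rpow_le_of_succ {Ω : Type*} {mΩ : MeasurableSpace Ω} {μ : Measure Ω}
    [IsProbabilityMeasure μ] {f : Ω → ℝ} (hf : Measurable f) {p b : ℝ} (hp : 0 < p) (hb : 0 ≤ b)
    (h : ∫⁻ z, ENNReal.ofReal (|f z| ^ (p + 1)) ∂μ ≤ ENNReal.ofReal (b ^ (p + 1))) :
    (∫⁻ z, ENNReal.ofReal (|f z| ^ p) ∂μ) ^ (1 / p) ≤ ENNReal.ofReal b := by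
  have h1 : ∀ q : ℝ, 0 < q →
      (∫⁻ z, ENNReal.ofReal (|f z| ^ q) ∂μ) ^ (1 / q) = eLpNorm' f q μ := by
    intro q hq
    rw [eLpNorm'_eq_lintegral_enorm]
    congr 1
    refine lintegral_congr fun z => ?_
    rw [← ENNReal.ofReal_rpow_of_nonneg (abs_nonneg _) hq.le, Real.enorm_eq_ofReal_abs]
  have hp1 : 0 < p + 1 := by linarith
  rw [h1 p hp]
  refine (eLpNorm'_le_eLpNorm'_of_exponent_le hp (by linarith : p ≤ p + 1) (μ := μ)
    hf.aestronglyMeasurable).trans ?_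
  rw [← h1 (p + 1) hp1]
  refine (ENNReal.rpow_le_rpow h (by positivity)).trans ?_
  rw [ENNReal.ofReal_rpow_of_nonneg (by positivity) (by positivity), ← Real.rpow_mul hb,
    mul_one_div_cancel hp1.ne', Real.rpow_one]

/-- The bound for the extremal discrepancy with respect to the scaled distance `dist x y / L`,
by jittered sampling on a partition of mesh `O(N ^ (-1 / d))`. -/
theorem exists_extremalLpDiscrepancy_le [CompactSpace M] [ConnectedSpace M]
    [MeasurableSpace M] [BorelSpace M] (μ : Measure M) [IsProbabilityMeasure μ] (hL : 0 < L)
    (hdiam : ∀ x y : M, dist x y ≤ L) {d : ℝ} (hd : 0 < d) {c : ℝ} (hc : 0 < c)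
    (hlow : ∀ y : M, ∀ r ∈ Set.Icc (0 : ℝ) 1,
      c * r ^ d ≤ ballVolume (fun x y : M => dist x y / L) μ y r)
    (hB : ConditionB (fun x y : M => dist x y / L) μ) :
    ∃ c₃ : ℝ, 0 < c₃ ∧ ∀ (N : ℕ), 1 ≤ N → ∀ (p : ℝ), 0 < p →
      ∀ (ξ : Measure unitInterval) [IsProbabilityMeasure ξ],
        extremalLpDiscrepancy (fun x y : M => dist x y / L) μ ξ p N ≤
          ENNReal.ofReal (c₃ * (p + 1) ^ (1 / 2 : ℝ) * (N : ℝ) ^ (1 / 2 - 1 / (2 * d) : ℝ)) := by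
  classical
  have hsplit := fun A hA t => exists_subset_measureReal_eq hL hB (μ := μ) A hA t
  obtain ⟨c₂, hc₂, hlip⟩ := hB
  set θ : M → M → ℝ := fun x y => dist x y / L with hθ
  refine ⟨4 * √(c₂ * 40 * c ^ (-(1 / d))), by positivity, fun N hN p hp ξ _ => ?_⟩
  have hN0 : (0 : ℝ) < N := by exact_mod_cast hN
  -- `r₀` is the radius for which the lower bound on the volume equals `1 / N`
  set r₀ := (c * N) ^ (-(1 / d)) with hr₀
  have hr₀pos : 0 < r₀ := by positivity
  have hr₀d : c * r₀ ^ d = 1 / N := by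
    rw [hr₀, ← Real.rpow_mul (by positivity), neg_mul, one_div_mul_cancel hd.ne', Real.rpow_neg_one]
    field_simp
  have hball : ∀ x : M, (1 / N : ℝ) ≤ μ.real (Metric.ball x (2 * r₀ * L)) := by
    intro x
    rcases le_or_gt r₀ 1 with h | h
    · rw [← hr₀d]
      refine (hlow x r₀ ⟨hr₀pos.le, h⟩).trans (measureReal_mono fun z hz => ?_)
      rw [Metric.mem_ball]
      rcases hz with hz | hz
      · rw [hθ, div_lt_iff₀ hL] at hz
        nlinarith [mul_pos hr₀pos hL]
      · nlinarith [hdiam z x, mul_pos hr₀pos hL]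
    · have : Metric.ball x (2 * r₀ * L) = Set.univ := Set.eq_univ_of_forall fun z => by
        rw [Metric.mem_ball]; nlinarith [hdiam z x]
      rw [this, probReal_univ, div_le_one hN0]
      exact_mod_cast hN
  obtain ⟨P, hP, hPd, hPμ, hPδ⟩ := exists_equal_measure_partition hsplit hN (by positivity) hball
  set K := N * (c₂ * (2 * (20 * r₀))) with hK
  have hK0 : 0 < K := by positivity
  have hPpos : ∀ i, μ (P i) ≠ 0 := fun i h => by
    have h1 := hPμ i
    rw [measureReal_def, h] at h1
    simp only [ENNReal.toReal_zero] at h1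
    exact absurd h1.symm (by positivity)
  let ν : Fin N → Measure M := fun i => cond μ (P i)
  have hν : ∀ i, IsProbabilityMeasure (ν i) := fun i => cond_isProbabilityMeasure (hPpos i)
  have hPν : ∀ i, ∀ᵐ x ∂ν i, x ∈ P i := fun i =>
    ae_cond_of_forall_mem (hP i) fun x hx => hx
  have hcover : μ (⋃ i, P i)ᶜ = 0 := by
    have h1 : μ.real (⋃ i, P i) = 1 := by
      rw [measureReal_iUnion_fintype (fun i j hij => hPd i j hij) hP,
        Finset.sum_congr rfl fun i _ => hPμ i]
      simp [hN0.ne']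
    have h2 := measureReal_compl (μ := μ) (MeasurableSet.iUnion hP)
    rw [h1, probReal_univ, sub_self] at h2
    exact (measureReal_eq_zero_iff).1 h2
  have hmean : ∀ B : Set M, MeasurableSet B → ∑ i, (ν i).real B = N * μ.real B := by
    intro B hBm
    have h1 : ∀ i, (ν i).real B = N * μ.real (P i ∩ B) := fun i => by
      simp only [ν]
      rw [measureReal_def, cond_apply (hP i), ENNReal.toReal_mul, ENNReal.toReal_inv,
        ← measureReal_def, ← measureReal_def, hPμ]
      field_simp
    rw [Finset.sum_congr rfl fun i _ => h1 i, ← Finset.mul_sum,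
      ← measureReal_iUnion_fintype (fun i j hij =>
        (hPd i j hij).mono Set.inter_subset_left Set.inter_subset_left) fun i => (hP i).inter hBm,
      ← Set.iUnion_inter]
    congr 1
    refine measureReal_congr ?_
    rw [Set.inter_comm]
    exact inter_ae_eq_left_of_ae_eq_univ (ae_eq_univ.2 hcover)
  let B : M × unitInterval → Set M := fun z => distBall θ z.1 (z.2 : ℝ)
  have hBm : ∀ z, MeasurableSet (B z) := fun z => measurableSet_distBall z.1 z.2
  let Δ : (Fin N → M) → M × unitInterval → ℝ := fun x z =>
    ∑ i, (B z).indicator 1 (x i) - N * μ.real (B z)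
  have hset := measurableSet_setOf_mem_distBall (M := M) (L := L)
  have hΔ : Measurable (Function.uncurry Δ) := by
    refine Measurable.sub (Finset.measurable_sum _ fun i _ => ?_) (Measurable.const_mul ?_ _)
    · have h : Measurable fun w : (Fin N → M) × M × unitInterval => (w.1 i, w.2) := by fun_prop
      have h' := ((measurable_one (α := ℝ)).indicator hset).comp h
      exact h'
    · have h := measurable_measure_prodMk_right (μ := μ) hset
      exact (h.comp measurable_snd).ennreal_toReal
  have hq1 : 1 ≤ p + 1 := by linarith
  set b := 4 * √((p + 1) * K) with hb
  have hmom : ∀ z, ∫⁻ x, ENNReal.ofReal (|Δ x z| ^ (p + 1)) ∂(Measure.pi ν) ≤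
      ENNReal.ofReal (b ^ (p + 1)) := by
    intro z
    let S : Finset (Fin N) := Finset.univ.filter fun i =>
      (∃ x ∈ P i, x ∈ B z) ∧ ∃ x ∈ P i, x ∉ B z
    have hSK := card_boundary_parts_le hL hc₂ hlip hN hP hPd hPμ (δ := 20 * r₀)
      (fun i x hx y hy => by linarith [hPδ i x hx y hy]) (by positivity) z.1 z.2.2.1 S
      (fun i hi => (Finset.mem_filter.1 hi).2)
    have := lintegral_rpow_count_le ν (hBm z) S (fun i hi => by
      by_cases h : ∃ x ∈ P i, x ∈ B z
      · left
        filter_upwards [hPν i] with x hx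
        by_contra hxB
        exact hi (Finset.mem_filter.2 ⟨Finset.mem_univ _, h, x, hx, hxB⟩)
      · right
        filter_upwards [hPν i] with x hx
        exact fun hxB => h ⟨x, hx, hxB⟩) hK0 hSK hq1
    simpa only [hmean _ (hBm z)] using this
  have hΔq : Measurable (Function.uncurry fun x z => ENNReal.ofReal (|Δ x z| ^ (p + 1))) :=
    ((hΔ.abs).pow_const _).ennreal_ofReal
  have htot : ∫⁻ x, ∫⁻ z, ENNReal.ofReal (|Δ x z| ^ (p + 1)) ∂(μ.prod ξ) ∂(Measure.pi ν) ≤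
      ENNReal.ofReal (b ^ (p + 1)) := by
    rw [lintegral_lintegral_swap hΔq.aemeasurable]
    refine (lintegral_mono hmom).trans ?_
    simp
  have hnull : (Measure.pi ν) {x | ∀ i, x i ∈ P i}ᶜ = 0 := by
    have : ∀ᵐ x ∂Measure.pi ν, ∀ i, x i ∈ P i := by
      rw [ae_all_iff]
      exact fun i => (measurePreserving_eval ν i).quasiMeasurePreserving.ae (hPν i)
    exact this
  obtain ⟨x, hxP, hx⟩ := exists_notMem_null_le_lintegral
    (hΔq.lintegral_prod_right' (ν := μ.prod ξ)).aemeasurable hnull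
  have hxP : ∀ i, x i ∈ P i := by simpa using hxP
  have hinj : Function.Injective x := fun i j hij => by
    by_contra h
    exact Set.disjoint_left.1 (hPd i j h) (hxP i) (hij ▸ hxP j)
  set D : Finset M := Finset.univ.image x with hD
  have hDcard : D.card = N := by
    rw [hD, Finset.card_image_of_injective _ hinj, Finset.card_univ, Fintype.card_fin]
  have hloc : ∀ z : M × unitInterval, localDiscrepancy θ μ D z.1 z.2 = Δ x z := by
    intro z
    have h1 : distBall θ z.1 z.2 ∩ (D : Set M) =
        ↑((Finset.univ.filter fun i => x i ∈ B z).image x) := by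
      ext w
      simp only [hD, Finset.coe_image, Finset.coe_filter, Set.mem_inter_iff, Set.mem_image,
        Finset.mem_univ, true_and, Finset.coe_univ, Set.mem_univ, Set.mem_ofPred_eq]
      constructor
      · rintro ⟨h, i, rfl⟩; exact ⟨i, h, rfl⟩
      · rintro ⟨i, h, rfl⟩; exact ⟨h, i, rfl⟩
    rw [localDiscrepancy, h1, Set.ncard_coe_finset, Finset.card_image_of_injective _ hinj, hDcard]
    simp only [Δ, Set.indicator_apply, Pi.one_apply, Finset.sum_boole]
    rfl
  have hbound : lpDiscrepancy θ μ ξ p D ≤ ENNReal.ofReal b := by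
    have hΔx : Measurable (Δ x) := hΔ.of_uncurry_left
    rw [lpDiscrepancy]
    simp only [hloc]
    exact lintegral_rpow_rpow_le_of_succ hΔx hp (by positivity) (hx.trans htot)
  refine (iInf₂_le D hDcard).trans (hbound.trans (ENNReal.ofReal_le_ofReal (le_of_eq ?_)))
  have hKe : K = c₂ * 40 * c ^ (-(1 / d)) * (N : ℝ) ^ (1 - 1 / d) := by
    rw [hK, hr₀, Real.mul_rpow hc.le hN0.le, sub_eq_add_neg, Real.rpow_add hN0, Real.rpow_one]
    ring
  rw [hb, hKe, Real.sqrt_mul (by linarith), Real.sqrt_mul (by positivity),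
    Real.sqrt_eq_rpow (p + 1), Real.sqrt_eq_rpow ((N : ℝ) ^ (1 - 1 / d)), ← Real.rpow_mul hN0.le,
    show (1 - 1 / d) * (1 / 2) = 1 / 2 - 1 / (2 * d) by field_simp]
  ring

end Discrepancy

/-! ### Annuli of semiconcave distance functions in a chart -/

section Annulus

open MeasureTheory Metric

variable {E : Type*} [NormedAddCommGroup E] [MeasurableSpace E]

/-- The properties, on the ball `ball u₀ R`, of the distance to a fixed point of a Riemannian
manifold, read in a chart: it is Lipschitz, two points at small value are close to each other, its
square is semiconcave, and it can be decreased at unit speed. The constants do not involve the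
fixed point. Measurability and boundedness are required on the whole space, which a cutoff
outside the ball achieves. -/
structure IsDistanceLike (D : E → ℝ) (u₀ : E) (R l Λ C s₀ m : ℝ) : Prop where
  measurable : Measurable D
  nonneg : ∀ w, 0 ≤ D w
  le_bound : ∀ w, D w ≤ m
  lipschitz : ∀ w ∈ ball u₀ R, ∀ w' ∈ ball u₀ R, |D w - D w'| ≤ Λ * ‖w - w'‖
  separated : ∀ w ∈ ball u₀ R, ∀ w' ∈ ball u₀ R, l * ‖w - w'‖ ≤ D w + D w'
  semiconcave : ∀ w ∈ ball u₀ (R / 2), ∀ h : E, ‖h‖ < R / 2 →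
    D (w + h) ^ 2 + D (w - h) ^ 2 ≤ 2 * D w ^ 2 + C * ‖h‖ ^ 2
  descent : ∀ w ∈ ball u₀ (R / 2), ∀ s, 0 ≤ s → s ≤ s₀ → s ≤ D w →
    ∃ k : E, l * ‖k‖ ≤ s ∧ D (w + k) ≤ D w - s

variable [NormedSpace ℝ E] [FiniteDimensional ℝ E]

lemma integrable_of_bounded_of_support_subset_ball {ν : Measure E} [ν.IsAddHaarMeasure]
    {g : E → ℝ} (hg : Measurable g) {B ρ : ℝ} {u₀ : E} (hB : ∀ w, |g w| ≤ B)
    (hs : ∀ w ∉ ball u₀ ρ, g w = 0) : Integrable g ν := by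
  have h : IntegrableOn g (ball u₀ ρ) ν :=
    Measure.integrableOn_of_bounded measure_ball_lt_top.ne hg.aestronglyMeasurable
      (M := B) (ae_of_all _ fun w => by rw [Real.norm_eq_abs]; exact hB w)
  rwa [integrableOn_iff_integrable_of_support_subset] at h
  exact Function.support_subset_iff'.2 hs

namespace IsDistanceLike

variable [BorelSpace E] {D : E → ℝ} {u₀ : E} {R l Λ C s₀ m : ℝ}

/-- The sublevel set at height `ρ` has measure `O(ρ)`: its diameter is `O(ρ)`. -/
lemma measure_sublevel_le [Nontrivial E] (ν : Measure E) [ν.IsAddHaarMeasure]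
    (hR : 0 < R) (hl : 0 < l) (hD : IsDistanceLike D u₀ R l Λ C s₀ m) {ρ : ℝ} (hρ : 0 < ρ) :
    ν.real {w ∈ ball u₀ R | D w < ρ} ≤
      (2 / l * (2 * R) ^ (Module.finrank ℝ E - 1) * ν.real (ball (0 : E) 1)) * ρ := by
  rcases Set.eq_empty_or_nonempty {w ∈ ball u₀ R | D w < ρ} with h | ⟨w₀, hw₀, hw₀ρ⟩
  · rw [h, measureReal_empty]; positivity
  set r := min (2 * ρ / l) (2 * R) with hr
  have hr0 : 0 < r := lt_min (by positivity) (by positivity)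
  have hsub : {w ∈ ball u₀ R | D w < ρ} ⊆ ball w₀ r := by
    rintro w ⟨hw, hwρ⟩
    rw [mem_ball, hr, lt_min_iff]
    constructor
    · rw [lt_div_iff₀ hl, dist_eq_norm]
      linarith [hD.separated w hw w₀ hw₀]
    · rw [mem_ball] at hw hw₀
      linarith [dist_triangle_right w w₀ u₀]
  refine (measureReal_mono hsub measure_ball_lt_top.ne).trans ?_
  obtain ⟨n, hn⟩ : ∃ n, Module.finrank ℝ E = n + 1 :=
    ⟨Module.finrank ℝ E - 1, (Nat.succ_pred_eq_of_pos Module.finrank_pos).symm⟩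
  rw [measureReal_def, Measure.addHaar_ball _ _ hr0.le, ENNReal.toReal_mul,
    ENNReal.toReal_ofReal (by positivity), ← measureReal_def, hn, pow_succ, Nat.add_sub_cancel]
  have h1 : r ^ n ≤ (2 * R) ^ n := pow_le_pow_left₀ hr0.le (min_le_right _ _) n
  have h2 : r ≤ 2 * ρ / l := min_le_left _ _
  have h3 : r ^ n * r ≤ (2 * R) ^ n * (2 * ρ / l) := by gcongr
  calc r ^ n * r * ν.real (ball 0 1) ≤ (2 * R) ^ n * (2 * ρ / l) * ν.real (ball 0 1) := by gcongr
    _ = _ := by ring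

/-- Discrete integration by parts of the semiconcavity inequality against a cutoff `φ`. -/
lemma integral_mul_sub_le (ν : Measure E) [ν.IsAddHaarMeasure]
    (hD : IsDistanceLike D u₀ R l Λ C s₀ m) {φ : E → ℝ} (hφ : Measurable φ)
    (hφ0 : ∀ w, 0 ≤ φ w) (hφ1 : ∀ w, φ w ≤ 1) (hφs : ∀ w ∉ ball u₀ (R / 2), φ w = 0) {h : E}
    (hh : ‖h‖ < R / 2) :
    Integrable (fun w => (φ w - φ (w + h)) * (D (w + h) ^ 2 - D w ^ 2)) ν ∧
    ∫ w, (φ w - φ (w + h)) * (D (w + h) ^ 2 - D w ^ 2) ∂ν ≤ C * ‖h‖ ^ 2 * ∫ w, φ w ∂ν := by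
  have hDm := hD.measurable
  have hF : ∀ w, D w ^ 2 ≤ m ^ 2 := fun w => pow_le_pow_left₀ (hD.nonneg w) (hD.le_bound w) 2
  have hF0 : ∀ w, 0 ≤ D w ^ 2 := fun w => sq_nonneg _
  have hφabs : ∀ w, |φ w| ≤ 1 := fun w => by rw [abs_of_nonneg (hφ0 w)]; exact hφ1 w
  have hdiff : ∀ w w', |D w ^ 2 - D w' ^ 2| ≤ m ^ 2 := fun w w' => by
    rw [abs_le]; constructor <;> linarith [hF w, hF w', hF0 w, hF0 w']
  have hmulb : ∀ w v v', |φ w * (D v ^ 2 - D v' ^ 2)| ≤ 1 * m ^ 2 := fun w v v' => by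
    rw [abs_mul]; exact mul_le_mul (hφabs w) (hdiff v v') (abs_nonneg _) zero_le_one
  have i1 : Integrable (fun w => φ w * (D (w + h) ^ 2 - D w ^ 2)) ν :=
    integrable_of_bounded_of_support_subset_ball (ρ := R / 2) (u₀ := u₀) (by fun_prop)
      (fun w => hmulb _ _ _) fun w hw => by rw [hφs w hw, zero_mul]
  have i2 : Integrable (fun w => φ w * (D w ^ 2 - D (w - h) ^ 2)) ν :=
    integrable_of_bounded_of_support_subset_ball (ρ := R / 2) (u₀ := u₀) (by fun_prop)
      (fun w => hmulb _ _ _) fun w hw => by rw [hφs w hw, zero_mul]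
  have i3 : Integrable φ ν :=
    integrable_of_bounded_of_support_subset_ball (ρ := R / 2) hφ hφabs hφs
  have i2' : Integrable (fun w => φ (w + h) * (D (w + h) ^ 2 - D w ^ 2)) ν := by
    have := i2.comp_add_right h
    simpa only [add_sub_cancel_right] using this
  have e2 : ∫ w, φ (w + h) * (D (w + h) ^ 2 - D w ^ 2) ∂ν =
      ∫ w, φ w * (D w ^ 2 - D (w - h) ^ 2) ∂ν := by
    have := integral_add_right_eq_self (μ := ν) (fun w => φ w * (D w ^ 2 - D (w - h) ^ 2)) h
    simpa only [add_sub_cancel_right] using this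
  have e : (fun w => (φ w - φ (w + h)) * (D (w + h) ^ 2 - D w ^ 2)) =
      fun w => φ w * (D (w + h) ^ 2 - D w ^ 2) - φ (w + h) * (D (w + h) ^ 2 - D w ^ 2) := by
    funext w; ring
  rw [e]
  refine ⟨i1.sub i2', ?_⟩
  rw [integral_sub i1 i2', e2, ← integral_sub i1 i2, ← integral_const_mul]
  refine integral_mono (i1.sub i2) (i3.const_mul _) fun w => ?_
  by_cases hw : w ∈ ball u₀ (R / 2)
  · have := mul_le_mul_of_nonneg_left (hD.semiconcave w hw h hh) (hφ0 w)
    linarith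
  · simp [hφs w hw]

/-- The `L²` increments of `D ^ 2` over an annulus are of the order of the width of the annulus:
the cutoff in `integral_mul_sub_le` is a spatial cutoff `χ` times a decreasing function `η` of
`D ^ 2` that is affine, with slope `-1 / (3 (b - a))`, on a neighbourhood of `[a, b]`. -/
lemma integral_increment_le (ν : Measure E) [ν.IsAddHaarMeasure] (hR : 0 < R) (hC : 0 ≤ C)
    (hΛ : 0 ≤ Λ) (hm : 0 ≤ m)
    (hD : IsDistanceLike D u₀ R l Λ C s₀ m) {a b : ℝ} (ha : 0 < a) (hab : a < b) {h : E}
    (hhR : ‖h‖ < R / 16) (hhb : 2 * m * Λ * ‖h‖ ≤ b - a) :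
    ∫ w in {w ∈ ball u₀ (R / 4) | a ≤ D w ^ 2 ∧ D w ^ 2 ≤ b}, (D (w + h) ^ 2 - D w ^ 2) ^ 2 ∂ν ≤
      3 * (b - a) * ((8 / R * (2 * m * Λ) + C) * ‖h‖ ^ 2 *
        ν.real {w ∈ ball u₀ R | D w ^ 2 < 2 * b}) := by
  have hDm := hD.measurable
  set ℓ := b - a with hℓ
  have hℓ0 : 0 < ℓ := by linarith
  set A := {w ∈ ball u₀ (R / 4) | a ≤ D w ^ 2 ∧ D w ^ 2 ≤ b} with hA
  set T := {w ∈ ball u₀ R | D w ^ 2 < 2 * b} with hT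
  have hAm : MeasurableSet A := measurableSet_ball.inter
    ((measurableSet_le measurable_const (hDm.pow_const 2)).inter
      (measurableSet_le (hDm.pow_const 2) measurable_const))
  have hTm : MeasurableSet T :=
    measurableSet_ball.inter (measurableSet_lt (hDm.pow_const 2) measurable_const)
  let η : ℝ → ℝ := fun t => max 0 (min 1 ((b + ℓ - t) / (3 * ℓ)))
  let χ : E → ℝ := fun w => max 0 (min 1 (4 - 8 / R * ‖w - u₀‖))
  let φ : E → ℝ := fun w => χ w * η (D w ^ 2)
  have hη0 : ∀ t, 0 ≤ η t := fun t => le_max_left _ _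
  have hη1 : ∀ t, η t ≤ 1 := fun t => max_le zero_le_one (min_le_left _ _)
  have hηanti : Antitone η := fun t t' htt' => by
    refine max_le_max le_rfl (min_le_min le_rfl ?_)
    gcongr
  have hηlin : ∀ t, a - ℓ ≤ t → t ≤ b + ℓ → η t = (b + ℓ - t) / (3 * ℓ) := fun t h1 h2 => by
    have h3 : 0 ≤ (b + ℓ - t) / (3 * ℓ) := div_nonneg (by linarith) (by linarith)
    have h4 : (b + ℓ - t) / (3 * ℓ) ≤ 1 := by rw [div_le_one (by linarith)]; linarith
    simp only [η]
    rw [min_eq_right h4, max_eq_right h3]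
  have hηzero : ∀ t, b + ℓ ≤ t → η t = 0 := fun t ht => by
    simp only [η]
    have h3 : (b + ℓ - t) / (3 * ℓ) ≤ 0 := div_nonpos_of_nonpos_of_nonneg (by linarith) (by linarith)
    exact max_eq_left ((min_le_right _ _).trans h3)
  have hχ0 : ∀ w, 0 ≤ χ w := fun t => le_max_left _ _
  have hχ1 : ∀ w, χ w ≤ 1 := fun t => max_le zero_le_one (min_le_left _ _)
  have hχs : ∀ w ∉ ball u₀ (R / 2), χ w = 0 := fun w hw => by
    rw [mem_ball, dist_eq_norm, not_lt] at hw
    refine max_eq_left ((min_le_right _ _).trans ?_)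
    have : 8 / R * (R / 2) ≤ 8 / R * ‖w - u₀‖ := by gcongr
    have e : 8 / R * (R / 2) = 4 := by field_simp; norm_num
    linarith
  have hχone : ∀ w ∈ ball u₀ (3 * R / 8), χ w = 1 := fun w hw => by
    rw [mem_ball, dist_eq_norm] at hw
    have : 8 / R * ‖w - u₀‖ ≤ 8 / R * (3 * R / 8) := by gcongr
    have e : 8 / R * (3 * R / 8) = 3 := by field_simp
    simp only [χ]
    rw [min_eq_left (by linarith), max_eq_right zero_le_one]
  have hχlip : ∀ w, |χ w - χ (w + h)| ≤ 8 / R * ‖h‖ := fun w => by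
    refine (abs_max_sub_max_le_max _ _ _ _).trans ?_
    rw [sub_self, abs_zero, max_eq_right (abs_nonneg _)]
    refine (abs_min_sub_min_le_max _ _ _ _).trans ?_
    rw [sub_self, abs_zero, max_eq_right (abs_nonneg _),
      show 4 - 8 / R * ‖w - u₀‖ - (4 - 8 / R * ‖w + h - u₀‖) =
        8 / R * (‖w + h - u₀‖ - ‖w - u₀‖) by ring, abs_mul, abs_of_pos (by positivity : 0 < 8 / R)]
    gcongr
    refine (abs_norm_sub_norm_le _ _).trans_eq ?_
    congr 1; abel
  have hφm : Measurable φ := by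
    have h1 : Measurable χ := by fun_prop
    have h2 : Measurable η := by fun_prop
    exact h1.mul (h2.comp (hDm.pow_const 2))
  have hφ0 : ∀ w, 0 ≤ φ w := fun w => mul_nonneg (hχ0 w) (hη0 _)
  have hφ1 : ∀ w, φ w ≤ 1 := fun w => mul_le_one₀ (hχ1 w) (hη0 _) (hη1 _)
  have hφs : ∀ w ∉ ball u₀ (R / 2), φ w = 0 := fun w hw => by simp only [φ, hχs w hw, zero_mul]
  obtain ⟨hint, hmain⟩ := hD.integral_mul_sub_le ν hφm hφ0 hφ1 hφs (h := h) (by linarith)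
  have hTfin : ν T ≠ ⊤ := ((measure_mono (Set.sep_subset _ _)).trans_lt
    (measure_ball_lt_top (x := u₀) (r := R))).ne
  have hFlt : ∀ w, ¬ b + ℓ ≤ D w ^ 2 → D w ^ 2 < 2 * b := fun w hw => by linarith
  have hφT : ∀ w, φ w ≤ T.indicator 1 w := fun w => by
    by_cases hw : w ∈ T
    · simpa [hw] using hφ1 w
    · rw [Set.indicator_of_notMem hw]
      by_cases hwR : w ∈ ball u₀ (R / 2)
      · have : b + ℓ ≤ D w ^ 2 := by
          by_contra hlt
          exact hw ⟨ball_subset_ball (by linarith) hwR, hFlt w hlt⟩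
        simp only [φ, hηzero _ this, mul_zero, le_refl]
      · exact (hφs w hwR).le
  have hTint : Integrable (T.indicator (1 : E → ℝ)) ν :=
    (integrable_indicator_iff hTm).2 (integrableOn_const hTfin)
  have hφint : ∫ w, φ w ∂ν ≤ ν.real T := by
    rw [← integral_indicator_one hTm]
    exact integral_mono (integrable_of_bounded_of_support_subset_ball hφm
      (fun w => by rw [abs_of_nonneg (hφ0 w)]; exact hφ1 w) hφs) hTint hφT
  have hDlip : ∀ w ∈ ball u₀ (9 * R / 16), |D (w + h) ^ 2 - D w ^ 2| ≤ 2 * m * Λ * ‖h‖ := by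
    intro w hw
    rw [mem_ball, dist_eq_norm] at hw
    have hwh : w + h ∈ ball u₀ R := by
      rw [mem_ball, dist_eq_norm, show w + h - u₀ = (w - u₀) + h by abel]
      linarith [norm_add_le (w - u₀) h]
    have h1 := hD.lipschitz (w + h) hwh w (by rw [mem_ball, dist_eq_norm]; linarith)
    rw [add_sub_cancel_left] at h1
    rw [sq_sub_sq, abs_mul, abs_of_nonneg (add_nonneg (hD.nonneg _) (hD.nonneg _))]
    have h2 : D (w + h) + D w ≤ 2 * m := by linarith [hD.le_bound (w + h), hD.le_bound w]
    calc (D (w + h) + D w) * |D (w + h) - D w| ≤ (2 * m) * (Λ * ‖h‖) := by gcongr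
      _ = _ := by ring
  have hpt : ∀ w, A.indicator (fun w => (D (w + h) ^ 2 - D w ^ 2) ^ 2 / (3 * ℓ)) w -
      8 / R * ‖h‖ * (2 * m * Λ * ‖h‖) * T.indicator 1 w ≤
        (φ w - φ (w + h)) * (D (w + h) ^ 2 - D w ^ 2) := by
    intro w
    have hκ : 0 ≤ 8 / R * ‖h‖ * (2 * m * Λ * ‖h‖) := by positivity
    have hTind : 0 ≤ T.indicator (1 : E → ℝ) w := Set.indicator_nonneg (fun _ _ => zero_le_one) w
    by_cases hw : w ∈ ball u₀ (9 * R / 16)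
    · set δ := D (w + h) ^ 2 - D w ^ 2 with hδ
      have e : (φ w - φ (w + h)) * δ =
          χ (w + h) * ((η (D w ^ 2) - η (D (w + h) ^ 2)) * δ) +
            (χ w - χ (w + h)) * (η (D w ^ 2) * δ) := by
        simp only [φ]; ring
      have hsecond : -(8 / R * ‖h‖ * (2 * m * Λ * ‖h‖) * T.indicator 1 w) ≤
          (χ w - χ (w + h)) * (η (D w ^ 2) * δ) := by
        by_cases hb : b + ℓ ≤ D w ^ 2
        · rw [hηzero _ hb, zero_mul, mul_zero, neg_nonpos]
          positivity
        · have hwT : w ∈ T := ⟨ball_subset_ball (by linarith) hw, hFlt w hb⟩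
          rw [Set.indicator_of_mem hwT, Pi.one_apply, mul_one]
          refine (abs_le.1 ?_).1
          rw [abs_mul, abs_mul, abs_of_nonneg (hη0 _)]
          have h3 : η (D w ^ 2) * |δ| ≤ 1 * (2 * m * Λ * ‖h‖) :=
            mul_le_mul (hη1 _) (hDlip w hw) (abs_nonneg _) zero_le_one
          rw [one_mul] at h3
          exact mul_le_mul (hχlip w) h3 (mul_nonneg (hη0 _) (abs_nonneg _)) (by positivity)
      have hfirst : A.indicator (fun w => (D (w + h) ^ 2 - D w ^ 2) ^ 2 / (3 * ℓ)) w ≤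
          χ (w + h) * ((η (D w ^ 2) - η (D (w + h) ^ 2)) * δ) := by
        by_cases hwA : w ∈ A
        · rw [Set.indicator_of_mem hwA]
          obtain ⟨hw4, hwa, hwb⟩ := hwA
          rw [mem_ball, dist_eq_norm] at hw4
          have hχw : χ (w + h) = 1 := hχone _ (by
            rw [mem_ball, dist_eq_norm, show w + h - u₀ = (w - u₀) + h by abel]
            linarith [norm_add_le (w - u₀) h])
          have h5 := abs_le.1 ((hDlip w hw).trans hhb)
          rw [hχw, one_mul, hηlin _ (by linarith) (by linarith),
            hηlin _ (by linarith [h5.1]) (by linarith [h5.2])]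
          apply le_of_eq
          rw [hδ]; field_simp; ring
        · rw [Set.indicator_of_notMem hwA]
          refine mul_nonneg (hχ0 _) ?_
          rcases le_total 0 δ with hδ0 | hδ0
          · exact mul_nonneg (sub_nonneg.2 (hηanti (by linarith))) hδ0
          · exact mul_nonneg_of_nonpos_of_nonpos (sub_nonpos.2 (hηanti (by linarith))) hδ0
      rw [e]
      linarith
    · have h1 : w ∉ ball u₀ (R / 2) := fun h' => hw (ball_subset_ball (by linarith) h')
      have h2 : w + h ∉ ball u₀ (R / 2) := fun h' => hw (by
        rw [mem_ball, dist_eq_norm] at h' ⊢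
        have := norm_sub_le (w + h - u₀) h
        rw [show w + h - u₀ - h = w - u₀ by abel] at this
        linarith)
      have h3 : w ∉ A := fun h' => h1 (ball_subset_ball (by linarith) h'.1)
      rw [hφs w h1, hφs _ h2, Set.indicator_of_notMem h3]
      have := mul_nonneg hκ hTind
      linarith
  have hAint : IntegrableOn (fun w => (D (w + h) ^ 2 - D w ^ 2) ^ 2) A ν := by
    refine Measure.integrableOn_of_bounded (M := (m ^ 2) ^ 2) ((measure_mono
      (Set.sep_subset _ _)).trans_lt (measure_ball_lt_top (x := u₀) (r := R / 4))).ne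
      (by fun_prop) (ae_of_all _ fun w => ?_)
    have hF : ∀ w, D w ^ 2 ≤ m ^ 2 := fun w => pow_le_pow_left₀ (hD.nonneg w) (hD.le_bound w) 2
    rw [Real.norm_eq_abs, abs_of_nonneg (sq_nonneg _), sq_le_sq, abs_of_nonneg (sq_nonneg m), abs_le]
    constructor <;> linarith [hF w, hF (w + h), sq_nonneg (D w), sq_nonneg (D (w + h))]
  have hAind : Integrable
      (A.indicator fun w => (D (w + h) ^ 2 - D w ^ 2) ^ 2 / (3 * ℓ)) ν :=
    (integrable_indicator_iff hAm).2 (hAint.div_const _)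
  have hfinal := integral_mono (hAind.sub
    (hTint.const_mul (8 / R * ‖h‖ * (2 * m * Λ * ‖h‖)))) hint hpt
  have hE : ∫ w, (A.indicator (fun w => (D (w + h) ^ 2 - D w ^ 2) ^ 2 / (3 * ℓ)) w -
      8 / R * ‖h‖ * (2 * m * Λ * ‖h‖) * T.indicator 1 w) ∂ν =
      (∫ w in A, (D (w + h) ^ 2 - D w ^ 2) ^ 2 ∂ν) / (3 * ℓ) -
        8 / R * ‖h‖ * (2 * m * Λ * ‖h‖) * ν.real T := by
    rw [integral_sub hAind (hTint.const_mul _),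
      integral_indicator hAm, integral_div, integral_const_mul, integral_indicator_one hTm]
  have h6 : (∫ w in A, (D (w + h) ^ 2 - D w ^ 2) ^ 2 ∂ν) / (3 * ℓ) ≤
      (8 / R * (2 * m * Λ) + C) * ‖h‖ ^ 2 * ν.real T := by
    have h7 := mul_le_mul_of_nonneg_left hφint (by positivity : 0 ≤ C * ‖h‖ ^ 2)
    have h8 := (hE.symm.le.trans hfinal).trans (hmain.trans h7)
    linarith
  rw [div_le_iff₀ (by linarith)] at h6
  linarith

end IsDistanceLike

end Annulus

section AnnulusAverage

open MeasureTheory Metric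

variable {E : Type*} [NormedAddCommGroup E] [MeasurableSpace E] {D : E → ℝ} {u₀ : E}
  {R l Λ C s₀ m : ℝ}

namespace IsDistanceLike

/-- At every point of positive value, the increments of `D ^ 2` in a cone of directions around
a direction of steepest descent are bounded below. -/
lemma exists_ball_increment_ge (hD : IsDistanceLike D u₀ R l Λ C s₀ m) (hl : 0 < l) (hΛ : 0 < Λ)
    {τ s r : ℝ} (hτ : τ ≤ 1 / 2) (hτΛ : Λ * τ ≤ l / 4)
    (hs : 0 < s) (hsR : s < R / 2) (hss₀ : l * s / 2 ≤ s₀) (hsr : l * s / 2 ≤ r) {w : E}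
    (hw : w ∈ ball u₀ (R / 2)) (hDw : r ≤ D w) :
    ∃ k : E, ball k (τ * s) ⊆ ball 0 s ∧ ∀ h ∈ ball k (τ * s),
      (l * s / 4 * r) ^ 2 ≤ (D (w + h) ^ 2 - D w ^ 2) ^ 2 := by
  obtain ⟨k, hk, hdec⟩ := hD.descent w hw (l * s / 2) (by positivity) hss₀ (hsr.trans hDw)
  have hk2 : ‖k‖ ≤ s / 2 := by
    have : l * ‖k‖ ≤ l * (s / 2) := by linarith
    exact le_of_mul_le_mul_left this hl
  have hτs : τ * s ≤ s / 2 := by nlinarith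
  have hsub : ball k (τ * s) ⊆ ball (0 : E) s := fun h hh => by
    rw [mem_ball, dist_eq_norm] at hh
    rw [mem_ball, dist_zero_right]
    have := norm_add_le (h - k) k
    rw [sub_add_cancel] at this
    linarith
  refine ⟨k, hsub, fun h hh => ?_⟩
  have hmem : ∀ v : E, ‖v‖ < s → w + v ∈ ball u₀ R := fun v hv => by
    rw [mem_ball, dist_eq_norm] at hw ⊢
    rw [show w + v - u₀ = (w - u₀) + v by abel]
    linarith [norm_add_le (w - u₀) v]
  have hhs : ‖h‖ < s := by simpa using hsub hh
  have h1 := (abs_le.1 (hD.lipschitz _ (hmem h hhs) _ (hmem k (by linarith)))).2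
  rw [add_sub_add_left_eq_sub] at h1
  rw [mem_ball, dist_eq_norm] at hh
  have h2 : Λ * ‖h - k‖ ≤ l / 4 * s := by
    calc Λ * ‖h - k‖ ≤ Λ * (τ * s) := by gcongr
      _ = Λ * τ * s := by ring
      _ ≤ _ := by gcongr
  have h3 : l * s / 4 ≤ D w - D (w + h) := by linarith
  have hr : 0 ≤ r := le_trans (by positivity) hsr
  have h4 : l * s / 4 * r ≤ D w ^ 2 - D (w + h) ^ 2 := by
    rw [sq_sub_sq, mul_comm (D w + D (w + h))]
    have := hD.nonneg (w + h)
    exact mul_le_mul h3 (by linarith) hr (by linarith [mul_pos hl hs])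
  rw [sq_le_sq, abs_of_nonneg (by positivity), abs_sub_comm]
  exact h4.trans (le_abs_self _)

variable [NormedSpace ℝ E] [FiniteDimensional ℝ E] [BorelSpace E]

/-- The measure of the annulus `{r₁ ≤ D ≤ r₂}` is at most a constant times its width, when
`r₂ ≤ 2 r₁`: average the bound of `integral_increment_le` over all increments `h` of norm less
than a small `s`. -/
lemma measure_annulus_le_of_le_two_mul [Nontrivial E] (ν : Measure E) [ν.IsAddHaarMeasure]
    (hR : 0 < R) (hl : 0 < l) (hΛ : 0 < Λ) (hC : 0 ≤ C) (hs₀ : 0 < s₀) (hm : 0 ≤ m)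
    (hD : IsDistanceLike D u₀ R l Λ C s₀ m) {τ : ℝ} (hτ0 : 0 < τ) (hτ : τ ≤ 1 / 2)
    (hτΛ : Λ * τ ≤ l / 4) {K₁ : ℝ} (hK₁ : 0 ≤ K₁)
    (hsublevel : ∀ ρ > 0, ν.real {w ∈ ball u₀ R | D w < ρ} ≤ K₁ * ρ) {r₁ r₂ : ℝ}
    (hr₁ : 0 < r₁) (hr : r₁ < r₂) (hr2 : r₂ ≤ 2 * r₁) :
    ν.real {w ∈ ball u₀ (R / 4) | r₁ ≤ D w ∧ D w ≤ r₂} ≤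
      576 * (8 / R * (2 * m * Λ) + C) * K₁ / (l ^ 2 * τ ^ Module.finrank ℝ E) * (r₂ - r₁) := by
  have hDm := hD.measurable
  set C₄ := 8 / R * (2 * m * Λ) + C with hC₄
  have hC₄0 : 0 ≤ C₄ := by positivity
  set n := Module.finrank ℝ E
  have hab : r₁ ^ 2 < r₂ ^ 2 := pow_lt_pow_left₀ hr hr₁.le two_ne_zero
  set A := {w ∈ ball u₀ (R / 4) | r₁ ^ 2 ≤ D w ^ 2 ∧ D w ^ 2 ≤ r₂ ^ 2} with hA
  have hAeq : {w ∈ ball u₀ (R / 4) | r₁ ≤ D w ∧ D w ≤ r₂} = A := by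
    ext w
    simp only [hA, Set.mem_ofPred_eq]
    rw [pow_le_pow_iff_left₀ hr₁.le (hD.nonneg w) two_ne_zero,
      pow_le_pow_iff_left₀ (hD.nonneg w) (hr₁.le.trans hr.le) two_ne_zero]
  rw [hAeq]
  have hAm : MeasurableSet A := measurableSet_ball.inter
    ((measurableSet_le measurable_const (hDm.pow_const 2)).inter
      (measurableSet_le (hDm.pow_const 2) measurable_const))
  have hAfin : ν A ≠ ⊤ := ((measure_mono (Set.sep_subset _ _)).trans_lt
    (measure_ball_lt_top (x := u₀) (r := R / 4))).ne
  -- the scale `s` of the increments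
  obtain ⟨s, hs, hsR, hsb, hss₀, hsr⟩ : ∃ s, 0 < s ∧ s < R / 16 ∧
      2 * m * Λ * s ≤ r₂ ^ 2 - r₁ ^ 2 ∧ l * s / 2 ≤ s₀ ∧ l * s / 2 ≤ r₁ := by
    have hcont : ∀ c : ℝ, Filter.Tendsto (fun s : ℝ => c * s) (nhdsWithin 0 (Set.Ioi 0))
        (nhds 0) := fun c => by
      have : Filter.Tendsto (fun s : ℝ => c * s) (nhds 0) (nhds (c * 0)) :=
        (continuous_const.mul continuous_id).tendsto 0
      rw [mul_zero] at this
      exact this.mono_left nhdsWithin_le_nhds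
    have h1 := (hcont 1).eventually_lt_const (show 0 < R / 16 by positivity)
    have h2 := (hcont (2 * m * Λ)).eventually_lt_const (show 0 < r₂ ^ 2 - r₁ ^ 2 by linarith)
    have h3 := (hcont (l / 2)).eventually_lt_const hs₀
    have h4 := (hcont (l / 2)).eventually_lt_const hr₁
    obtain ⟨s, ⟨h1, h2, h3, h4⟩, hs⟩ :=
      ((h1.and (h2.and (h3.and h4))).and self_mem_nhdsWithin).exists
    exact ⟨s, hs, by linarith, h2.le, by linarith, by linarith⟩
  let g : E → E → ENNReal := fun w h => ENNReal.ofReal ((D (w + h) ^ 2 - D w ^ 2) ^ 2)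
  have hg : Measurable (Function.uncurry g) := by
    have : Measurable fun z : E × E => (D (z.1 + z.2) ^ 2 - D z.1 ^ 2) ^ 2 := by fun_prop
    exact this.ennreal_ofReal
  have hlow : ν A * (ENNReal.ofReal ((l * s / 4 * r₁) ^ 2) * ν (ball 0 (τ * s))) ≤
      ∫⁻ w in A, ∫⁻ h in ball 0 s, g w h ∂ν ∂ν := by
    rw [mul_comm, ← setLIntegral_const]
    refine setLIntegral_mono' hAm fun w hw => ?_
    have hDw : r₁ ≤ D w := (pow_le_pow_iff_left₀ hr₁.le (hD.nonneg w) two_ne_zero).1 hw.2.1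
    obtain ⟨k, hk, hinc⟩ := hD.exists_ball_increment_ge hl hΛ hτ hτΛ hs
      (by linarith) hss₀ hsr (ball_subset_ball (by linarith) hw.1) hDw
    rw [← Measure.addHaar_ball_center ν k, ← setLIntegral_const]
    exact (setLIntegral_mono' measurableSet_ball fun h hh =>
      ENNReal.ofReal_le_ofReal (hinc h hh)).trans (lintegral_mono_set hk)
  have hup : ∀ h ∈ ball (0 : E) s, ∫⁻ w in A, g w h ∂ν ≤
      ENNReal.ofReal (36 * C₄ * K₁ * (r₂ - r₁) * r₁ ^ 2 * s ^ 2) := by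
    intro h hh
    rw [mem_ball, dist_zero_right] at hh
    have hint : IntegrableOn (fun w => (D (w + h) ^ 2 - D w ^ 2) ^ 2) A ν := by
      refine Measure.integrableOn_of_bounded (M := (m ^ 2) ^ 2) hAfin
        (by fun_prop) (ae_of_all _ fun w => ?_)
      have hF : ∀ w, D w ^ 2 ≤ m ^ 2 := fun w => pow_le_pow_left₀ (hD.nonneg w) (hD.le_bound w) 2
      rw [Real.norm_eq_abs, abs_of_nonneg (sq_nonneg _), sq_le_sq, abs_of_nonneg (sq_nonneg m),
        abs_le]
      constructor <;> linarith [hF w, hF (w + h), sq_nonneg (D w), sq_nonneg (D (w + h))]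
    rw [← ofReal_integral_eq_lintegral_ofReal hint (ae_of_all _ fun w => sq_nonneg _)]
    refine ENNReal.ofReal_le_ofReal ?_
    refine (hD.integral_increment_le ν hR hC hΛ.le hm (by positivity) hab (hh.trans hsR)
      (le_trans (by gcongr) hsb)).trans ?_
    have hT : ν.real {w ∈ ball u₀ R | D w ^ 2 < 2 * r₂ ^ 2} ≤ K₁ * (4 * r₁) := by
      refine (measureReal_mono ?_ ((measure_mono (Set.sep_subset _ _)).trans_lt
        (measure_ball_lt_top (x := u₀) (r := R))).ne).trans (hsublevel (4 * r₁) (by positivity))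
      rintro w ⟨hw, hw2⟩
      refine ⟨hw, ?_⟩
      nlinarith [hD.nonneg w]
    have hℓ : r₂ ^ 2 - r₁ ^ 2 ≤ 3 * r₁ * (r₂ - r₁) := by nlinarith
    have hh2 : ‖h‖ ^ 2 ≤ s ^ 2 := pow_le_pow_left₀ (norm_nonneg _) hh.le 2
    calc 3 * (r₂ ^ 2 - r₁ ^ 2) * (C₄ * ‖h‖ ^ 2 *
          ν.real {w ∈ ball u₀ R | D w ^ 2 < 2 * r₂ ^ 2})
        ≤ 3 * (3 * r₁ * (r₂ - r₁)) * (C₄ * s ^ 2 * (K₁ * (4 * r₁))) := by gcongr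
      _ = _ := by ring
  have htot : ν A * (ENNReal.ofReal ((l * s / 4 * r₁) ^ 2) * ν (ball 0 (τ * s))) ≤
      ENNReal.ofReal (36 * C₄ * K₁ * (r₂ - r₁) * r₁ ^ 2 * s ^ 2) * ν (ball 0 s) := by
    refine hlow.trans ?_
    rw [lintegral_lintegral_swap hg.aemeasurable, ← setLIntegral_const]
    exact setLIntegral_mono' measurableSet_ball hup
  have hreal := ENNReal.toReal_mono (ENNReal.mul_ne_top ENNReal.ofReal_ne_top
    measure_ball_lt_top.ne) htot
  have hε : 0 < r₂ - r₁ := by linarith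
  rw [ENNReal.toReal_mul, ENNReal.toReal_mul, ENNReal.toReal_mul,
    ENNReal.toReal_ofReal (by positivity), ENNReal.toReal_ofReal (by positivity),
    Measure.addHaar_ball _ _ (by positivity), Measure.addHaar_ball ν (0 : E) hs.le,
    ENNReal.toReal_mul, ENNReal.toReal_mul, ENNReal.toReal_ofReal (by positivity),
    ENNReal.toReal_ofReal (by positivity), mul_pow τ s] at hreal
  have hv : 0 < (ν (ball (0 : E) 1)).toReal :=
    ENNReal.toReal_pos (measure_ball_pos ν 0 one_pos).ne' measure_ball_lt_top.ne
  change (ν A).toReal ≤ _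
  rw [div_mul_eq_mul_div, le_div_iff₀ (by positivity)]
  have hpos : 0 < s ^ n * (ν (ball (0 : E) 1)).toReal * (s ^ 2 * r₁ ^ 2) / 16 := by positivity
  refine le_of_mul_le_mul_right ?_ hpos
  calc (ν A).toReal * (l ^ 2 * τ ^ n) * (s ^ n * (ν (ball (0 : E) 1)).toReal *
        (s ^ 2 * r₁ ^ 2) / 16)
      = (ν A).toReal * ((l * s / 4 * r₁) ^ 2 *
          (τ ^ n * s ^ n * (ν (ball (0 : E) 1)).toReal)) := by ring
    _ ≤ _ := hreal
    _ = _ := by ring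

end IsDistanceLike

variable [NormedSpace ℝ E] [FiniteDimensional ℝ E] [BorelSpace E]

/-- The measure of annuli of a distance-like function is bounded by a constant times
their width, uniformly in the function. -/
theorem exists_measure_annulus_le [Nontrivial E] (ν : Measure E) [ν.IsAddHaarMeasure]
    (hR : 0 < R) (hl : 0 < l) (hΛ : 0 < Λ) (hC : 0 ≤ C) (hs₀ : 0 < s₀) (hm : 0 ≤ m) :
    ∃ K : ℝ, 0 < K ∧ ∀ D : E → ℝ, IsDistanceLike D u₀ R l Λ C s₀ m → ∀ r₁ r₂ : ℝ,
      0 ≤ r₁ → r₁ < r₂ → ν.real {w ∈ ball u₀ (R / 4) | r₁ ≤ D w ∧ D w < r₂} ≤ K * (r₂ - r₁) := by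
  set K₁ := 2 / l * (2 * R) ^ (Module.finrank ℝ E - 1) * ν.real (ball (0 : E) 1) with hK₁
  have hK₁0 : 0 ≤ K₁ := by positivity
  set τ := min (1 / 2) (l / (4 * Λ)) with hτ
  have hτ0 : 0 < τ := lt_min (by norm_num) (by positivity)
  have hτΛ : Λ * τ ≤ l / 4 := by
    calc Λ * τ ≤ Λ * (l / (4 * Λ)) := by gcongr; exact min_le_right _ _
      _ = _ := by field_simp
  set K₂ := 576 * (8 / R * (2 * m * Λ) + C) * K₁ / (l ^ 2 * τ ^ Module.finrank ℝ E) with hK₂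
  have hK₂0 : 0 ≤ K₂ := by positivity
  refine ⟨K₂ + 2 * K₁ + 1, by positivity, fun D hD r₁ r₂ hr₁ hr => ?_⟩
  have hsub := fun ρ (hρ : ρ > 0) => hD.measure_sublevel_le ν hR hl hρ
  have hε : 0 < r₂ - r₁ := by linarith
  rcases le_or_gt r₂ (2 * r₁) with h | h
  · have h1 := hD.measure_annulus_le_of_le_two_mul ν hR hl hΛ hC hs₀ hm hτ0 (min_le_left _ _)
      hτΛ hK₁0 hsub (by linarith : 0 < r₁) hr h
    refine (measureReal_mono ?_ ?_).trans (h1.trans ?_)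
    · exact fun w hw => ⟨hw.1, hw.2.1, hw.2.2.le⟩
    · exact ((measure_mono (Set.sep_subset _ _)).trans_lt
        (measure_ball_lt_top (x := u₀) (r := R / 4))).ne
    · gcongr
      linarith
  · have h1 := hsub r₂ (by linarith)
    refine (measureReal_mono ?_ ?_).trans (h1.trans ?_)
    · exact fun w hw => ⟨ball_subset_ball (by linarith) hw.1, hw.2.2⟩
    · exact ((measure_mono (Set.sep_subset _ _)).trans_lt
        (measure_ball_lt_top (x := u₀) (r := R))).ne
    · have h2 : K₁ * r₂ ≤ K₁ * (2 * (r₂ - r₁)) := by gcongr; linarith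
      have h3 : 0 ≤ K₂ * (r₂ - r₁) := by positivity
      change K₁ * r₂ ≤ _
      linarith

end AnnulusAverage

/-! ### Semiconcavity of the squared distance in a length space with a smooth chart -/

section Semiconcave

open Metric

variable {M : Type*} [MetricSpace M]

/-- In a space where points can be found at every intermediate distance on the way from one point
to another, points are joined by chains with equal steps. -/
lemma exists_equidistant_chain
    (hseg : ∀ x y : M, ∀ s, 0 ≤ s → s ≤ dist x y → ∃ z, dist x z = s ∧ dist z y = dist x y - s)
    {δ : ℝ} (hδ : 0 ≤ δ) (n : ℕ) : ∀ x z : M, dist x z = n * δ →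
      ∃ p : ℕ → M, p 0 = x ∧ p n = z ∧ ∀ i < n, dist (p i) (p (i + 1)) = δ := by
  induction n with
  | zero =>
    intro x z h
    exact ⟨fun _ => x, rfl, dist_eq_zero.1 (by simpa using h), fun i hi => by omega⟩
  | succ n ih =>
    intro x z h
    push_cast at h
    have hn : 0 ≤ (n : ℝ) * δ := by positivity
    obtain ⟨z', h1, h2⟩ := hseg x z δ hδ (by rw [h]; linarith)
    obtain ⟨p, hp0, hpn, hp⟩ := ih z' z (by rw [h2, h]; ring)
    refine ⟨fun i => Nat.casesOn i x p, rfl, hpn, fun i hi => ?_⟩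
    cases i with
    | zero => simpa [hp0] using h1
    | succ i => exact hp i (by omega)

variable {E : Type*} [NormedAddCommGroup E] [NormedSpace ℝ E]

/-- A parametrization `ψ` of a piece of a metric space by the ball `ball u₀ (4 R)`, in which the
distance is given, up to third order errors, by a metric tensor `G` with bounded second
derivatives. The bounds on the derivatives of `G` are phrased with finite differences. The
parametrization covers the balls of radius `ρ₀` around the points of `ψ (ball u₀ R)`. -/
structure IsMetricChart (ψ : E → M) (G : E → E →L[ℝ] E →L[ℝ] ℝ) (u₀ : E) (R l Λ B ρ₀ : ℝ) :
    Prop where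
  le_dist : ∀ u ∈ ball u₀ (4 * R), ∀ v ∈ ball u₀ (4 * R), l * ‖u - v‖ ≤ dist (ψ u) (ψ v)
  dist_le : ∀ u ∈ ball u₀ (4 * R), ∀ v ∈ ball u₀ (4 * R), dist (ψ u) (ψ v) ≤ Λ * ‖u - v‖
  dist_sq : ∀ u ∈ ball u₀ (4 * R), ∀ v ∈ ball u₀ (4 * R),
    |dist (ψ u) (ψ v) ^ 2 - G u (v - u) (v - u)| ≤ B * ‖v - u‖ ^ 3
  symm : ∀ u v w, G u v w = G u w v
  norm_le : ∀ u ∈ ball u₀ (4 * R), ‖G u‖ ≤ B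
  norm_sub_le : ∀ u k, u + k ∈ ball u₀ (4 * R) → u - k ∈ ball u₀ (4 * R) →
    ‖G (u + k) - G (u - k)‖ ≤ B * ‖k‖
  norm_add_sub_le : ∀ u k, u + k ∈ ball u₀ (4 * R) → u - k ∈ ball u₀ (4 * R) →
    ‖G (u + k) + G (u - k) - (2 : ℝ) • G u‖ ≤ B * ‖k‖ ^ 2
  exists_of_dist_lt : ∀ u ∈ ball u₀ R, ∀ q, dist (ψ u) q < ρ₀ → ∃ w ∈ ball u₀ (2 * R), ψ w = q

namespace IsMetricChart

variable {ψ : E → M} {G : E → E →L[ℝ] E →L[ℝ] ℝ} {u₀ : E} {R l Λ B ρ₀ : ℝ}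

/-- The energy of a step of a chain changes by a second order quantity, up to third order
errors, when the chain is moved in two opposite directions. -/
lemma dist_sq_add_dist_sq_le (hψ : IsMetricChart ψ G u₀ R l Λ B ρ₀) (hB : 0 ≤ B)
    {w v k η : E} (hw : w ∈ ball u₀ (4 * R)) (hwv : w + v ∈ ball u₀ (4 * R))
    (h1 : w + k ∈ ball u₀ (4 * R)) (h2 : w - k ∈ ball u₀ (4 * R))
    (h3 : w + k + (v + η) ∈ ball u₀ (4 * R)) (h4 : w - k + (v - η) ∈ ball u₀ (4 * R)) :
    dist (ψ (w + k)) (ψ (w + k + (v + η))) ^ 2 + dist (ψ (w - k)) (ψ (w - k + (v - η))) ^ 2 ≤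
      2 * dist (ψ w) (ψ (w + v)) ^ 2 +
        B * (‖k‖ ^ 2 * ‖v‖ ^ 2 + 2 * (‖k‖ * ‖v‖ * ‖η‖) + 2 * ‖η‖ ^ 2) +
        4 * B * (‖v‖ + ‖η‖) ^ 3 := by
  have e1 := (abs_le.1 (hψ.dist_sq _ h1 _ h3)).2
  have e2 := (abs_le.1 (hψ.dist_sq _ h2 _ h4)).2
  have e3 := (abs_le.1 (hψ.dist_sq _ hw _ hwv)).1
  rw [add_sub_cancel_left] at e1 e2 e3
  have happ : ∀ (T : E →L[ℝ] E →L[ℝ] ℝ) (x y : E), T x y ≤ ‖T‖ * ‖x‖ * ‖y‖ := fun T x y =>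
    (le_abs_self _).trans (T.le_opNorm₂ x y)
  have b1 : (G (w + k) + G (w - k) - (2 : ℝ) • G w) v v ≤ B * ‖k‖ ^ 2 * ‖v‖ * ‖v‖ :=
    (happ _ _ _).trans (by gcongr; exact hψ.norm_add_sub_le w k h1 h2)
  have b2 : (G (w + k) - G (w - k)) v η ≤ B * ‖k‖ * ‖v‖ * ‖η‖ :=
    (happ _ _ _).trans (by gcongr; exact hψ.norm_sub_le w k h1 h2)
  have b3 : G (w + k) η η ≤ B * ‖η‖ * ‖η‖ :=
    (happ _ _ _).trans (by gcongr; exact hψ.norm_le _ h1)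
  have b4 : G (w - k) η η ≤ B * ‖η‖ * ‖η‖ :=
    (happ _ _ _).trans (by gcongr; exact hψ.norm_le _ h2)
  simp only [sub_apply, add_apply,
    smul_apply, smul_eq_mul, map_add, map_sub] at e1 e2 e3 b1 b2
  rw [hψ.symm (w + k) η v] at e1
  rw [hψ.symm (w - k) η v] at e2
  have c1 : B * ‖v + η‖ ^ 3 ≤ B * (‖v‖ + ‖η‖) ^ 3 := by gcongr; exact norm_add_le _ _
  have c2 : B * ‖v - η‖ ^ 3 ≤ B * (‖v‖ + ‖η‖) ^ 3 := by gcongr; exact _root_.norm_sub_le _ _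
  have c3 : B * ‖v‖ ^ 3 ≤ B * (‖v‖ + ‖η‖) ^ 3 := by gcongr; linarith [norm_nonneg η]
  nlinarith

/-- Semiconcavity of the squared distance to a point `z` near `ψ w`: move a chain of `n` equal
steps from `ψ w` to `z`, its first point by `± h` and the following ones by linearly
decreasing amounts, and let `n` tend to infinity. -/
lemma dist_sq_add_dist_sq_le_of_dist_lt (hψ : IsMetricChart ψ G u₀ R l Λ B ρ₀) (hl : 0 < l)
    (hR : 0 < R) (hB : 0 ≤ B)
    (hseg : ∀ x y : M, ∀ s, 0 ≤ s → s ≤ dist x y → ∃ z, dist x z = s ∧ dist z y = dist x y - s)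
    {w h : E} (hw : w ∈ ball u₀ R) (hh : ‖h‖ < R) {z : M} (hz : dist (ψ w) z < ρ₀) {a : ℝ}
    (ha : dist (ψ w) z ≤ l * a) :
    dist z (ψ (w + h)) ^ 2 + dist z (ψ (w - h)) ^ 2 ≤
      2 * dist (ψ w) z ^ 2 + B * (a ^ 2 + 2 * a + 2) * ‖h‖ ^ 2 := by
  set δ := dist (ψ w) z with hδ
  have hδ0 : 0 ≤ δ := dist_nonneg
  have ha0 : 0 ≤ a := nonneg_of_mul_nonneg_right (hδ0.trans ha) hl
  have key : ∀ n : ℕ, 0 < n → dist z (ψ (w + h)) ^ 2 + dist z (ψ (w - h)) ^ 2 ≤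
      2 * δ ^ 2 + B * (a ^ 2 + 2 * a + 2) * ‖h‖ ^ 2 + 4 * B * (a + R) ^ 3 * (1 / n) := by
    intro n hn
    have hn0 : (0 : ℝ) < n := by exact_mod_cast hn
    obtain ⟨p, hp0, hpn, hp⟩ := exists_equidistant_chain hseg (δ := δ / n) (by positivity) n
      (ψ w) z (by rw [← hδ]; field_simp)
    have hpd : ∀ i ≤ n, dist (ψ w) (p i) ≤ δ := by
      intro i hi
      have h1 := dist_le_range_sum_dist p i
      rw [hp0, Finset.sum_congr rfl fun j hj => hp j (by have := Finset.mem_range.1 hj; omega),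
        Finset.sum_const, Finset.card_range, nsmul_eq_mul] at h1
      refine h1.trans ?_
      rw [mul_div_assoc', div_le_iff₀ hn0, mul_comm]
      gcongr
    have hex : ∀ i, ∃ v : E, i ≤ n → v ∈ ball u₀ (2 * R) ∧ ψ v = p i := fun i => by
      by_cases hi : i ≤ n
      · obtain ⟨v, hv, hv'⟩ := hψ.exists_of_dist_lt w hw (p i) ((hpd i hi).trans_lt hz)
        exact ⟨v, fun _ => ⟨hv, hv'⟩⟩
      · exact ⟨0, fun h => absurd h hi⟩
    choose f hf using hex
    have hf4 : ∀ i ≤ n, f i ∈ ball u₀ (4 * R) := fun i hi =>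
      ball_subset_ball (by linarith) (hf i hi).1
    have hf0 : f 0 = w := by
      have h1 := hψ.le_dist _ (hf4 0 (by omega)) w (ball_subset_ball (by linarith) hw)
      rw [(hf 0 (by omega)).2, hp0, dist_self] at h1
      have h2 : ‖f 0 - w‖ ≤ 0 := le_of_mul_le_mul_left (by simpa using h1) hl
      exact sub_eq_zero.1 (norm_le_zero_iff.1 h2)
    have hstep : ∀ i < n, ‖f (i + 1) - f i‖ ≤ a / n := fun i hi => by
      have h1 := hψ.le_dist _ (hf4 i (by omega)) _ (hf4 (i + 1) (by omega))
      rw [(hf i (by omega)).2, (hf (i + 1) (by omega)).2, hp i hi, norm_sub_rev] at h1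
      rw [le_div_iff₀ hn0]
      rw [le_div_iff₀ hn0] at h1
      refine le_of_mul_le_mul_left ?_ hl
      linarith
    let t : ℕ → ℝ := fun i => 1 - i / n
    have ht : ∀ i ≤ n, 0 ≤ t i ∧ t i ≤ 1 := fun i hi => by
      have h1 : (i : ℝ) / n ≤ 1 := by rw [div_le_one hn0]; exact_mod_cast hi
      have h2 : (0 : ℝ) ≤ (i : ℝ) / n := by positivity
      exact ⟨by simp only [t]; linarith, by simp only [t]; linarith⟩
    have hts : ∀ i, t (i + 1) = t i - 1 / n := fun i => by simp only [t]; push_cast; ring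
    have ht0 : t 0 = 1 := by simp [t]
    have htn : t n = 0 := by simp [t, hn0.ne']
    have hmem : ∀ i ≤ n, ∀ c : ℝ, |c| ≤ 1 → f i + c • h ∈ ball u₀ (4 * R) := by
      intro i hi c hc
      have h1 := (hf i hi).1
      rw [mem_ball, dist_eq_norm] at h1 ⊢
      rw [show f i + c • h - u₀ = (f i - u₀) + c • h by abel]
      have h2 : ‖c • h‖ ≤ 1 * ‖h‖ := by rw [norm_smul, Real.norm_eq_abs]; gcongr
      linarith [norm_add_le (f i - u₀) (c • h)]
    -- the two moved chains
    let q : ℝ → ℕ → M := fun ε i => ψ (f i + (ε * t i) • h)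
    have hq0 : ∀ ε, q ε 0 = ψ (w + ε • h) := fun ε => by simp only [q, hf0, ht0, mul_one]
    have hqn : ∀ ε, q ε n = z := fun ε => by
      simp only [q, htn, mul_zero, zero_smul, add_zero, (hf n le_rfl).2, hpn]
    have hlen : ∀ ε, dist z (ψ (w + ε • h)) ^ 2 ≤
        n * ∑ i ∈ Finset.range n, dist (q ε i) (q ε (i + 1)) ^ 2 := by
      intro ε
      have h1 := dist_le_range_sum_dist (q ε) n
      rw [hq0, hqn, dist_comm] at h1
      have h2 := sq_sum_le_card_mul_sum_sq (s := Finset.range n)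
        (f := fun i => dist (q ε i) (q ε (i + 1)))
      rw [Finset.card_range] at h2
      exact (pow_le_pow_left₀ dist_nonneg h1 2).trans h2
    have hone : ∀ i < n, dist (q 1 i) (q 1 (i + 1)) ^ 2 + dist (q (-1) i) (q (-1) (i + 1)) ^ 2 ≤
        2 * (δ / n) ^ 2 + B * (a ^ 2 + 2 * a + 2) * ‖h‖ ^ 2 / n ^ 2 +
          4 * B * (a + R) ^ 3 / n ^ 3 := by
      intro i hi
      obtain ⟨ht1, ht2⟩ := ht i hi.le
      obtain ⟨ht1', ht2'⟩ := ht (i + 1) hi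
      have e1 : q 1 i = ψ (f i + t i • h) := by simp only [q, one_mul]
      have e2 : q (-1) i = ψ (f i - t i • h) := by
        simp only [q, neg_mul, one_mul, neg_smul, ← sub_eq_add_neg]
      have p1 : f i + t i • h + ((f (i + 1) - f i) + (-(1 / n : ℝ)) • h) =
          f (i + 1) + t (i + 1) • h := by
        rw [hts]; module
      have p2 : f i - t i • h + ((f (i + 1) - f i) - (-(1 / n : ℝ)) • h) =
          f (i + 1) - t (i + 1) • h := by
        rw [hts]; module
      have e3 : q 1 (i + 1) =
          ψ (f i + t i • h + ((f (i + 1) - f i) + (-(1 / n : ℝ)) • h)) := by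
        rw [p1]; simp only [q, one_mul]
      have e4 : q (-1) (i + 1) =
          ψ (f i - t i • h + ((f (i + 1) - f i) - (-(1 / n : ℝ)) • h)) := by
        rw [p2]; simp only [q, neg_mul, one_mul, neg_smul, ← sub_eq_add_neg]
      have hmain := hψ.dist_sq_add_dist_sq_le hB (w := f i) (v := f (i + 1) - f i)
        (k := t i • h) (η := (-(1 / n : ℝ)) • h) (hf4 i hi.le)
        (by rw [add_sub_cancel]; exact hf4 (i + 1) hi)
        (hmem i hi.le _ (by rwa [abs_of_nonneg ht1]))
        (by rw [sub_eq_add_neg, ← neg_smul]; exact hmem i hi.le _ (by rwa [abs_neg, abs_of_nonneg ht1]))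
        (by rw [p1]; exact hmem (i + 1) hi _ (by rwa [abs_of_nonneg ht1']))
        (by rw [p2, sub_eq_add_neg, ← neg_smul]
            exact hmem (i + 1) hi _ (by rwa [abs_neg, abs_of_nonneg ht1']))
      rw [← e1, ← e2, ← e3, ← e4, add_sub_cancel, (hf i hi.le).2, (hf (i + 1) hi).2, hp i hi] at hmain
      refine hmain.trans ?_
      have n1 : ‖t i • h‖ ≤ ‖h‖ := by
        rw [norm_smul, Real.norm_eq_abs, abs_of_nonneg ht1]
        exact mul_le_of_le_one_left (norm_nonneg _) ht2
      have n2 : ‖(-(1 / n : ℝ)) • h‖ = ‖h‖ / n := by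
        rw [norm_smul, norm_neg, Real.norm_eq_abs, abs_of_pos (by positivity)]; ring
      rw [n2]
      have n3 := hstep i hi
      have n4 : ‖h‖ / n ≤ R / n := by gcongr
      calc 2 * (δ / n) ^ 2 + B * (‖t i • h‖ ^ 2 * ‖f (i + 1) - f i‖ ^ 2 +
            2 * (‖t i • h‖ * ‖f (i + 1) - f i‖ * (‖h‖ / n)) + 2 * (‖h‖ / n) ^ 2) +
            4 * B * (‖f (i + 1) - f i‖ + ‖h‖ / n) ^ 3
          ≤ 2 * (δ / n) ^ 2 + B * (‖h‖ ^ 2 * (a / n) ^ 2 +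
            2 * (‖h‖ * (a / n) * (‖h‖ / n)) + 2 * (‖h‖ / n) ^ 2) +
            4 * B * (a / n + R / n) ^ 3 := by gcongr
        _ = _ := by field_simp
    have hs1 := hlen 1
    have hs2 := hlen (-1)
    rw [one_smul] at hs1
    rw [neg_smul, one_smul, ← sub_eq_add_neg] at hs2
    refine (add_le_add hs1 hs2).trans ?_
    rw [← mul_add, ← Finset.sum_add_distrib]
    have hsum := Finset.sum_le_sum fun i hi => hone i (Finset.mem_range.1 hi)
    rw [Finset.sum_const, Finset.card_range, nsmul_eq_mul] at hsum
    refine (mul_le_mul_of_nonneg_left hsum hn0.le).trans_eq ?_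
    field_simp
  have htend : Filter.Tendsto (fun n : ℕ => 2 * δ ^ 2 + B * (a ^ 2 + 2 * a + 2) * ‖h‖ ^ 2 +
      4 * B * (a + R) ^ 3 * (1 / (n : ℝ))) Filter.atTop
      (nhds (2 * δ ^ 2 + B * (a ^ 2 + 2 * a + 2) * ‖h‖ ^ 2 + 4 * B * (a + R) ^ 3 * 0)) :=
    (tendsto_one_div_atTop_nhds_zero_nat.const_mul _).const_add _
  rw [mul_zero, add_zero] at htend
  exact ge_of_tendsto htend ((Filter.eventually_gt_atTop 0).mono key)

/-- Semiconcavity of the squared distance to an arbitrary point `y`: apply the local statement to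
a point `z` on the way from `ψ w` to `y`, at a fixed fraction `t` of the distance. -/
lemma dist_sq_add_dist_sq_le_of_bounded (hψ : IsMetricChart ψ G u₀ R l Λ B ρ₀) (hl : 0 < l)
    (hR : 0 < R) (hB : 0 ≤ B)
    (hseg : ∀ x y : M, ∀ s, 0 ≤ s → s ≤ dist x y → ∃ z, dist x z = s ∧ dist z y = dist x y - s)
    {m t : ℝ} (hm : ∀ x y : M, dist x y ≤ m) (ht0 : 0 < t) (ht1 : t < 1) (htm : t * m < ρ₀)
    (y : M) {w h : E} (hw : w ∈ ball u₀ R) (hh : ‖h‖ < R) :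
    dist y (ψ (w + h)) ^ 2 + dist y (ψ (w - h)) ^ 2 ≤
      2 * dist y (ψ w) ^ 2 +
        B * ((t * m / l) ^ 2 + 2 * (t * m / l) + 2) / t * ‖h‖ ^ 2 := by
  set δ := dist y (ψ w) with hδ
  have hδ0 : 0 ≤ δ := dist_nonneg
  have hδm : t * δ ≤ t * m := by gcongr; exact hm _ _
  obtain ⟨z, hz1, hz2⟩ := hseg (ψ w) y (t * δ) (by positivity) (by
    rw [dist_comm, ← hδ]; exact mul_le_of_le_one_left hδ0 ht1.le)
  rw [dist_comm (ψ w) y, ← hδ] at hz2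
  have hloc := hψ.dist_sq_add_dist_sq_le_of_dist_lt hl hR hB hseg hw hh (z := z)
    (by rw [hz1]; linarith) (a := t * m / l) (by rw [hz1, mul_div_cancel₀ _ hl.ne']; exact hδm)
  rw [hz1] at hloc
  have hconv : ∀ x : M, dist y x ^ 2 ≤ (1 - t) * δ ^ 2 + dist z x ^ 2 / t := by
    intro x
    have h1 : dist y x ≤ (1 - t) * δ + dist z x := by
      have := dist_triangle y z x
      rw [dist_comm y z, hz2] at this
      linarith
    refine (pow_le_pow_left₀ dist_nonneg h1 2).trans ?_
    rw [← sub_nonneg]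
    have e : (1 - t) * δ ^ 2 + dist z x ^ 2 / t - ((1 - t) * δ + dist z x) ^ 2 =
        (1 - t) / t * (t * δ - dist z x) ^ 2 := by field_simp; ring
    rw [e]
    have : 0 ≤ 1 - t := by linarith
    positivity
  have h1 := hconv (ψ (w + h))
  have h2 := hconv (ψ (w - h))
  have h3 : (dist z (ψ (w + h)) ^ 2 + dist z (ψ (w - h)) ^ 2) / t ≤
      (2 * (t * δ) ^ 2 + B * ((t * m / l) ^ 2 + 2 * (t * m / l) + 2) * ‖h‖ ^ 2) / t := by gcongr
  have e : (2 * (t * δ) ^ 2 + B * ((t * m / l) ^ 2 + 2 * (t * m / l) + 2) * ‖h‖ ^ 2) / t =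
      2 * t * δ ^ 2 + B * ((t * m / l) ^ 2 + 2 * (t * m / l) + 2) / t * ‖h‖ ^ 2 := by field_simp
  rw [e, add_div] at h3
  linarith

open MeasureTheory in
/-- In a metric chart the annuli around all points have measure at most a constant times
their width. -/
theorem exists_measure_preimage_annulus_le [FiniteDimensional ℝ E] [Nontrivial E]
    [MeasurableSpace E] [BorelSpace E] (ν : Measure E) [ν.IsAddHaarMeasure]
    (hψ : IsMetricChart ψ G u₀ R l Λ B ρ₀) (hl : 0 < l) (hΛ : 0 < Λ)
    (hR : 0 < R) (hB : 0 ≤ B) (hρ₀ : 0 < ρ₀)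
    (hseg : ∀ x y : M, ∀ s, 0 ≤ s → s ≤ dist x y → ∃ z, dist x z = s ∧ dist z y = dist x y - s)
    {m : ℝ} (hm : ∀ x y : M, dist x y ≤ m) :
    ∃ K : ℝ, 0 < K ∧ ∀ y : M, ∀ r₁ r₂ : ℝ, 0 ≤ r₁ → r₁ < r₂ →
      ν.real {w ∈ ball u₀ (R / 4) | r₁ ≤ dist (ψ w) y ∧ dist (ψ w) y < r₂} ≤ K * (r₂ - r₁) := by
  classical
  have hm0 : 0 ≤ m := dist_nonneg.trans (hm (ψ u₀) (ψ u₀))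
  set t := min (1 / 2) (ρ₀ / (2 * (m + 1))) with ht
  have ht0 : 0 < t := lt_min (by norm_num) (by positivity)
  have ht1 : t < 1 := (min_le_left _ _).trans_lt (by norm_num)
  have htm : t * m < ρ₀ := by
    calc t * m ≤ ρ₀ / (2 * (m + 1)) * m := by gcongr; exact min_le_right _ _
      _ < ρ₀ := by rw [div_mul_eq_mul_div, div_lt_iff₀ (by positivity)]; nlinarith
  set C := B * ((t * m / l) ^ 2 + 2 * (t * m / l) + 2) / t with hC
  have hC0 : 0 ≤ C := by positivity
  set s₀ := min (ρ₀ / 2) (l * R / 4) with hs₀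
  obtain ⟨K, hK, hbound⟩ := exists_measure_annulus_le (u₀ := u₀) ν hR hl hΛ hC0
    (lt_min (by positivity) (by positivity) : 0 < s₀) hm0
  refine ⟨K, hK, fun y r₁ r₂ hr₁ hr => ?_⟩
  let D : E → ℝ := (ball u₀ R).piecewise (fun w => dist y (ψ w)) 0
  have hDin : ∀ w ∈ ball u₀ R, D w = dist y (ψ w) := fun w hw =>
    Set.piecewise_eq_of_mem _ _ _ hw
  have hDout : ∀ w ∉ ball u₀ R, D w = 0 := fun w hw => Set.piecewise_eq_of_notMem _ _ _ hw
  have h4 : ball u₀ R ⊆ ball u₀ (4 * R) := ball_subset_ball (by linarith)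
  have hcont : ContinuousOn (fun w => dist y (ψ w)) (ball u₀ R) := by
    have : LipschitzOnWith Λ.toNNReal ψ (ball u₀ R) :=
      LipschitzOnWith.of_dist_le_mul fun u hu v hv => by
        rw [Real.coe_toNNReal _ hΛ.le, dist_eq_norm]
        exact hψ.dist_le u (h4 hu) v (h4 hv)
    exact (continuous_const.dist continuous_id).comp_continuousOn this.continuousOn
  have hD : IsDistanceLike D u₀ R l Λ C s₀ m :=
    { measurable := hcont.measurable_piecewise continuousOn_const measurableSet_ball
      nonneg := fun w => by
        by_cases hw : w ∈ ball u₀ R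
        · rw [hDin w hw]; exact dist_nonneg
        · rw [hDout w hw]
      le_bound := fun w => by
        by_cases hw : w ∈ ball u₀ R
        · rw [hDin w hw]; exact hm _ _
        · rw [hDout w hw]; exact hm0
      lipschitz := fun w hw w' hw' => by
        rw [hDin w hw, hDin w' hw', dist_comm y, dist_comm y]
        exact (abs_dist_sub_le _ _ _).trans (hψ.dist_le w (h4 hw) w' (h4 hw'))
      separated := fun w hw w' hw' => by
        rw [hDin w hw, hDin w' hw']
        exact (hψ.le_dist w (h4 hw) w' (h4 hw')).trans (dist_triangle_left _ _ _)
      semiconcave := fun w hw h hh => by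
        have hw' : w ∈ ball u₀ R := ball_subset_ball (by linarith) hw
        have h1 : ∀ v : E, ‖v‖ < R / 2 → w + v ∈ ball u₀ R := fun v hv => by
          rw [mem_ball, dist_eq_norm] at hw ⊢
          rw [show w + v - u₀ = (w - u₀) + v by abel]
          linarith [norm_add_le (w - u₀) v]
        have h2 := h1 (-h) (by rwa [norm_neg])
        rw [← sub_eq_add_neg] at h2
        rw [hDin w hw', hDin _ (h1 h hh), hDin _ h2]
        exact hψ.dist_sq_add_dist_sq_le_of_bounded hl hR hB hseg hm ht0 ht1 htm y hw'
          (by linarith)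
      descent := fun w hw s hs hss₀ hsD => by
        have hw' : w ∈ ball u₀ R := ball_subset_ball (by linarith) hw
        rw [hDin w hw', dist_comm] at hsD
        obtain ⟨z, hz1, hz2⟩ := hseg (ψ w) y s hs hsD
        have h1 : s ≤ ρ₀ / 2 := hss₀.trans (min_le_left _ _)
        have h2 : s ≤ l * R / 4 := hss₀.trans (min_le_right _ _)
        obtain ⟨v, hv, hvz⟩ := hψ.exists_of_dist_lt w hw' z (by linarith)
        have h3 := hψ.le_dist v (ball_subset_ball (by linarith) hv) w (h4 hw')
        rw [hvz, dist_comm, hz1] at h3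
        have h5 : ‖v - w‖ ≤ R / 4 := le_of_mul_le_mul_left (by linarith) hl
        refine ⟨v - w, h3, ?_⟩
        rw [add_sub_cancel, hDin v (by
          rw [mem_ball, dist_eq_norm] at hw ⊢
          rw [show v - u₀ = (v - w) + (w - u₀) by abel]
          linarith [norm_add_le (v - w) (w - u₀)]), hDin w hw', hvz, dist_comm, hz2, dist_comm] }
  have hset : {w ∈ ball u₀ (R / 4) | r₁ ≤ dist (ψ w) y ∧ dist (ψ w) y < r₂} =
      {w ∈ ball u₀ (R / 4) | r₁ ≤ D w ∧ D w < r₂} := by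
    ext w
    refine and_congr_right fun hw => ?_
    rw [hDin w (ball_subset_ball (by linarith) hw), dist_comm]
  rw [hset]
  exact hbound D hD r₁ r₂ hr₁ hr

end IsMetricChart

end Semiconcave

/-! ### The metric tensor in a chart -/

section ChartForm

open Metric

lemma exists_lipschitz_bound_closedBall {E F : Type*} [NormedAddCommGroup E] [NormedSpace ℝ E]
    [FiniteDimensional ℝ E] [NormedAddCommGroup F] [NormedSpace ℝ F] {G : E → F} {T : Set E}
    (hT : IsOpen T) (hG : ContDiffOn ℝ 1 G T) {u₀ : E} {R : ℝ} (hR : closedBall u₀ R ⊆ T) :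
    ∃ B : ℝ, ∀ u ∈ closedBall u₀ R, ∀ v ∈ closedBall u₀ R, ‖G u - G v‖ ≤ B * ‖u - v‖ := by
  obtain ⟨B, hB⟩ := (isCompact_closedBall u₀ R).exists_bound_of_continuousOn
    ((hG.continuousOn_fderiv_of_isOpen hT le_rfl).mono hR)
  exact ⟨B, fun u hu v hv => (convex_closedBall u₀ R).norm_image_sub_le_of_norm_fderiv_le
    (fun w hw => (hG.differentiableOn (by norm_num)).differentiableAt (hT.mem_nhds (hR hw)))
    hB hv hu⟩

/-- A twice continuously differentiable map on a neighbourhood of a closed ball is bounded and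
Lipschitz on the ball, and its symmetric second differences are of second order. -/
lemma exists_second_difference_bound {E F : Type*} [NormedAddCommGroup E] [NormedSpace ℝ E]
    [FiniteDimensional ℝ E] [NormedAddCommGroup F] [NormedSpace ℝ F] {G : E → F} {T : Set E}
    (hT : IsOpen T) (hG : ContDiffOn ℝ 2 G T) {u₀ : E} {R : ℝ} (hR : closedBall u₀ R ⊆ T) :
    ∃ B : ℝ, 0 < B ∧ (∀ u ∈ closedBall u₀ R, ‖G u‖ ≤ B) ∧
      (∀ u ∈ closedBall u₀ R, ∀ v ∈ closedBall u₀ R, ‖G u - G v‖ ≤ B * ‖u - v‖) ∧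
      ∀ u k, u + k ∈ closedBall u₀ R → u - k ∈ closedBall u₀ R →
        ‖G (u + k) + G (u - k) - (2 : ℝ) • G u‖ ≤ B * ‖k‖ ^ 2 := by
  have hG1 : ContDiffOn ℝ 1 (fderiv ℝ G) T := hG.fderiv_of_isOpen hT (by norm_num)
  obtain ⟨B₀, hB₀⟩ := (isCompact_closedBall u₀ R).exists_bound_of_continuousOn
    (hG.continuousOn.mono hR)
  obtain ⟨B₁, hlip⟩ := exists_lipschitz_bound_closedBall hT (hG.of_le (by norm_num)) hR
  obtain ⟨B₂, hlip1⟩ := exists_lipschitz_bound_closedBall hT hG1 hR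
  have hd : ∀ u ∈ closedBall u₀ R, DifferentiableAt ℝ G u := fun u hu =>
    (hG.differentiableOn (by norm_num)).differentiableAt (hT.mem_nhds (hR hu))
  have hB₂' : 0 ≤ |B₂| := abs_nonneg _
  refine ⟨|B₀| + |B₁| + 2 * |B₂| + 1, by positivity, fun u hu => ?_, fun u hu v hv => ?_,
    fun u k h1 h2 => ?_⟩
  · linarith [hB₀ u hu, le_abs_self B₀, abs_nonneg B₁]
  · refine (hlip u hu v hv).trans ?_
    gcongr
    linarith [le_abs_self B₁, abs_nonneg B₀]
  · have hmem : ∀ t ∈ Set.Icc (0 : ℝ) 1, u + t • k ∈ closedBall u₀ R ∧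
        u - t • k ∈ closedBall u₀ R := by
      intro t ht
      have hc := convex_closedBall u₀ R
      constructor
      · have := hc h1 h2 (a := (1 + t) / 2) (b := (1 - t) / 2) (by linarith [ht.1])
          (by linarith [ht.2]) (by ring)
        convert! this using 1
        module
      · have := hc h1 h2 (a := (1 - t) / 2) (b := (1 + t) / 2) (by linarith [ht.2])
          (by linarith [ht.1]) (by ring)
        convert! this using 1
        module
    let g : ℝ → F := fun t => G (u + t • k) + G (u - t • k)
    have hg : ∀ t ∈ Set.Icc (0 : ℝ) 1, HasDerivWithinAt g
        (fderiv ℝ G (u + t • k) k + fderiv ℝ G (u - t • k) (-k)) (Set.Icc 0 1) t := by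
      intro t ht
      have e1 : HasDerivAt (fun t : ℝ => u + t • k) k t := by
        simpa using ((hasDerivAt_id t).smul_const k).const_add u
      have e2 : HasDerivAt (fun t : ℝ => u - t • k) (-k) t := by
        simpa using ((hasDerivAt_id t).smul_const k).const_sub u
      exact (((hd _ (hmem t ht).1).hasFDerivAt.comp_hasDerivAt t e1).add
        ((hd _ (hmem t ht).2).hasFDerivAt.comp_hasDerivAt t e2)).hasDerivWithinAt
    have hbound : ∀ t ∈ Set.Ico (0 : ℝ) 1,
        ‖fderiv ℝ G (u + t • k) k + fderiv ℝ G (u - t • k) (-k)‖ ≤ 2 * |B₂| * ‖k‖ ^ 2 := by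
      intro t ht
      have ht' : t ∈ Set.Icc (0 : ℝ) 1 := ⟨ht.1, ht.2.le⟩
      have e : fderiv ℝ G (u + t • k) k + fderiv ℝ G (u - t • k) (-k) =
          (fderiv ℝ G (u + t • k) - fderiv ℝ G (u - t • k)) k := by
        rw [map_neg, sub_apply]; abel
      rw [e]
      refine (ContinuousLinearMap.le_opNorm _ _).trans ?_
      have h3 := hlip1 _ (hmem t ht').1 _ (hmem t ht').2
      rw [show u + t • k - (u - t • k) = (2 * t) • k by module, norm_smul, Real.norm_eq_abs,
        abs_of_nonneg (by linarith [ht.1])] at h3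
      have h4 : B₂ * (2 * t * ‖k‖) ≤ |B₂| * (2 * 1 * ‖k‖) := by
        have := ht.1
        gcongr
        · exact le_abs_self _
        · exact ht.2.le
      calc _ ≤ |B₂| * (2 * 1 * ‖k‖) * ‖k‖ := by gcongr; exact h3.trans h4
        _ = _ := by ring
    have := norm_image_sub_le_of_norm_deriv_le_segment_01' hg hbound
    simp only [g, one_smul, zero_smul, add_zero, sub_zero] at this
    rw [← two_smul ℝ (G u)] at this
    refine this.trans ?_
    gcongr
    linarith [abs_nonneg B₁, abs_nonneg B₀]

variable {d : ℕ} {M : Type*} [TopologicalSpace M] [ChartedSpace (EuclideanSpace ℝ (Fin d)) M]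

local notation:max "𝔼" n:max => EuclideanSpace ℝ (Fin n)

/-- The derivative at `u` of the inverse of the chart at `x`. -/
noncomputable def chartDeriv (x : M) (u v : 𝔼 d) : TangentSpace (𝓡 d) ((chartAt (𝔼 d) x).symm u) :=
  mfderiv (𝓡 d) (𝓡 d) (chartAt (𝔼 d) x).symm u v

lemma chartDeriv_add (x : M) (u v w : 𝔼 d) :
    chartDeriv x u (v + w) = chartDeriv x u v + chartDeriv x u w :=
  map_add (mfderiv (𝓡 d) (𝓡 d) (chartAt (𝔼 d) x).symm u) v w

lemma chartDeriv_smul (x : M) (c : ℝ) (u v : 𝔼 d) :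
    chartDeriv x u (c • v) = c • chartDeriv x u v :=
  map_smul (mfderiv (𝓡 d) (𝓡 d) (chartAt (𝔼 d) x).symm u) c v

section Smooth

variable [IsManifold (𝓡 d) ∞ M]

lemma contMDiffOn_chartDeriv (x : M) (v : 𝔼 d) : ContMDiffOn (𝓡 d) (𝓡 d).tangent ∞
    (fun u => (⟨(chartAt (𝔼 d) x).symm u, chartDeriv x u v⟩ : TangentBundle (𝓡 d) M))
    (chartAt (𝔼 d) x).target := by
  have h := (contMDiffOn_chart_symm (I := 𝓡 d) (n := ∞) (x := x)).contMDiffOn_tangentMapWithin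
    (m := ∞) (by simp) (chartAt (𝔼 d) x).open_target.uniqueMDiffOn
  have hc : ContMDiffOn (𝓡 d) (𝓡 d).tangent ∞ (fun u : 𝔼 d => (⟨u, v⟩ : TangentBundle (𝓡 d) (𝔼 d)))
      (chartAt (𝔼 d) x).target :=
    (contMDiffOn_vectorSpace_iff_contDiffOn (V := fun _ => v)).2 contDiffOn_const
  refine (h.comp hc fun u hu => hu).congr fun u hu => ?_
  simp only [Function.comp_apply, tangentMapWithin, chartDeriv]
  rw [mfderivWithin_of_isOpen (chartAt (𝔼 d) x).open_target hu]

lemma mdifferentiableAt_chart_symm (x : M) {u : 𝔼 d} (hu : u ∈ (chartAt (𝔼 d) x).target) :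
    MDifferentiableAt (𝓡 d) (𝓡 d) (chartAt (𝔼 d) x).symm u :=
  have : IsManifold (𝓡 d) 1 M := IsManifold.of_le (n := ∞) (by simp)
  mdifferentiableAt_atlas_symm (chart_mem_atlas _ x) hu

lemma chartDeriv_ne_zero (x : M) {u : 𝔼 d} (hu : u ∈ (chartAt (𝔼 d) x).target) {v : 𝔼 d} (hv : v ≠ 0) :
    chartDeriv x u v ≠ 0 := by
  intro h
  have : IsManifold (𝓡 d) 1 M := IsManifold.of_le (n := ∞) (by simp)
  have h1 := (mdifferentiable_of_mem_atlas (I := 𝓡 d) (chart_mem_atlas (𝔼 d) x)).comp_symm_deriv hu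
  have h2 := congrArg (fun T => T v) h1
  refine hv (h2.symm.trans ?_)
  have h3 : mfderiv (𝓡 d) (𝓡 d) (chartAt (𝔼 d) x) ((chartAt (𝔼 d) x).symm u)
      (chartDeriv x u v) = 0 := by rw [h]; exact map_zero _
  exact h3

end Smooth

variable [Bundle.RiemannianBundle (fun x : M => TangentSpace (𝓡 d) x)]

/-- The metric tensor at the point with coordinates `u` in the chart at `x`. -/
noncomputable def chartForm (x : M) (u : 𝔼 d) : 𝔼 d →L[ℝ] 𝔼 d →L[ℝ] ℝ :=
  (LinearMap.mk₂ ℝ (fun v w : 𝔼 d => inner ℝ (chartDeriv x u v) (chartDeriv x u w))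
    (fun v v' w => by rw [chartDeriv_add, inner_add_left])
    (fun c v w => by rw [chartDeriv_smul, real_inner_smul_left, smul_eq_mul])
    (fun v w w' => by rw [chartDeriv_add, inner_add_right])
    (fun c v w => by
      rw [chartDeriv_smul, real_inner_smul_right, smul_eq_mul])).toContinuousBilinearMap

lemma chartForm_apply (x : M) (u v w : 𝔼 d) :
    chartForm x u v w = inner ℝ (chartDeriv x u v) (chartDeriv x u w) := rfl

lemma chartForm_self (x : M) (u v : 𝔼 d) : chartForm x u v v = ‖chartDeriv x u v‖ ^ 2 :=
  real_inner_self_eq_norm_sq (chartDeriv x u v)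

lemma chartForm_symm (x : M) (u v w : 𝔼 d) : chartForm x u v w = chartForm x u w v :=
  real_inner_comm (chartDeriv x u w) (chartDeriv x u v)

lemma metricMatrix_apply (x : M) (u : 𝔼 d) (i j : Fin d) : metricMatrix x u i j =
    chartForm x u (EuclideanSpace.single i 1) (EuclideanSpace.single j 1) := rfl

variable [IsManifold (𝓡 d) ∞ M] [IsContMDiffRiemannianBundle (𝓡 d) ∞ (𝔼 d)
  (fun x : M => TangentSpace (𝓡 d) x)]

lemma contDiffOn_chartForm (x : M) :
    ContDiffOn ℝ ∞ (chartForm (d := d) x) (chartAt (𝔼 d) x).target := by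
  rw [contDiffOn_clm_apply]
  intro v
  rw [contDiffOn_clm_apply]
  intro w
  rw [← contMDiffOn_iff_contDiffOn]
  exact (contMDiffOn_chartDeriv x v).inner_bundle (contMDiffOn_chartDeriv x w)

/-- On a compact ball in the chart domain, the metric tensor is comparable to the Euclidean
metric. -/
lemma exists_norm_chartDeriv_bounds (x : M) {u₀ : 𝔼 d} {R : ℝ} (hR : 0 ≤ R)
    (hT : closedBall u₀ R ⊆ (chartAt (𝔼 d) x).target) :
    ∃ l Λ : ℝ, 0 < l ∧ l ≤ Λ ∧ ∀ u ∈ closedBall u₀ R, ∀ v,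
      l * ‖v‖ ≤ ‖chartDeriv x u v‖ ∧ ‖chartDeriv x u v‖ ≤ Λ * ‖v‖ := by
  have hcont : ContinuousOn (fun z : 𝔼 d × 𝔼 d => ‖chartDeriv x z.1 z.2‖ ^ 2)
      (closedBall u₀ R ×ˢ sphere 0 1) := by
    have h1 : ContinuousOn (fun z : 𝔼 d × 𝔼 d => chartForm x z.1) (closedBall u₀ R ×ˢ sphere 0 1) :=
      ((contDiffOn_chartForm x).continuousOn.mono hT).comp continuousOn_fst fun z hz => hz.1
    have h2 := (h1.clm_apply continuousOn_snd).clm_apply continuousOn_snd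
    exact h2.congr fun z _ => (chartForm_self x z.1 z.2).symm
  have hK : IsCompact (closedBall u₀ R ×ˢ sphere (0 : 𝔼 d) 1) :=
    (isCompact_closedBall u₀ R).prod (isCompact_sphere 0 1)
  have hscale : ∀ u, ∀ v : 𝔼 d, v ≠ 0 →
      ‖chartDeriv x u v‖ = ‖chartDeriv x u (‖v‖⁻¹ • v)‖ * ‖v‖ := fun u v hv => by
    rw [chartDeriv_smul, norm_smul, norm_inv, norm_norm]
    field_simp
  have hzero : ∀ u, ‖chartDeriv x u 0‖ = 0 := fun u => by
    rw [← zero_smul ℝ (0 : 𝔼 d), chartDeriv_smul, zero_smul, norm_zero]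
  rcases (sphere (0 : 𝔼 d) 1).eq_empty_or_nonempty with hem | hne
  · refine ⟨1, 1, one_pos, le_rfl, fun u _ v => ?_⟩
    have hv : v = 0 := by
      by_contra hv
      have : ‖v‖⁻¹ • v ∈ sphere (0 : 𝔼 d) 1 := by
        rw [mem_sphere_zero_iff_norm, norm_smul, norm_inv, norm_norm]
        exact inv_mul_cancel₀ (norm_ne_zero_iff.2 hv)
      rw [hem] at this
      exact this
    rw [hv, hzero, norm_zero]
    simp
  have hne' : (closedBall u₀ R ×ˢ sphere (0 : 𝔼 d) 1).Nonempty :=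
    (nonempty_closedBall.2 hR).prod hne
  obtain ⟨z₁, hz₁, hmin⟩ := hK.exists_isMinOn hne' hcont
  obtain ⟨z₂, hz₂, hmax⟩ := hK.exists_isMaxOn hne' hcont
  have hz₁0 : z₁.2 ≠ 0 := fun h => by
    have := hz₁.2
    rw [h] at this
    simp at this
  have hb : ∀ u ∈ closedBall u₀ R, ∀ v,
      ‖chartDeriv x z₁.1 z₁.2‖ * ‖v‖ ≤ ‖chartDeriv x u v‖ ∧
        ‖chartDeriv x u v‖ ≤ ‖chartDeriv x z₂.1 z₂.2‖ * ‖v‖ := by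
    intro u hu v
    by_cases hv : v = 0
    · rw [hv, hzero]; simp
    have hmem : (u, ‖v‖⁻¹ • v) ∈ closedBall u₀ R ×ˢ sphere (0 : 𝔼 d) 1 := by
      refine ⟨hu, ?_⟩
      rw [mem_sphere_zero_iff_norm, norm_smul, norm_inv, norm_norm]
      exact inv_mul_cancel₀ (norm_ne_zero_iff.2 hv)
    have h1 := (pow_le_pow_iff_left₀ (norm_nonneg _) (norm_nonneg _) two_ne_zero).1 (hmin hmem)
    have h2 := (pow_le_pow_iff_left₀ (norm_nonneg _) (norm_nonneg _) two_ne_zero).1 (hmax hmem)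
    rw [hscale u v hv]
    exact ⟨by gcongr, by gcongr⟩
  refine ⟨‖chartDeriv x z₁.1 z₁.2‖, ‖chartDeriv x z₂.1 z₂.2‖,
    norm_pos_iff.2 (chartDeriv_ne_zero x (hT hz₁.1) hz₁0), ?_, hb⟩
  obtain ⟨h1, h2⟩ := hb z₁.1 hz₁.1 z₁.2
  refine le_of_mul_le_mul_right (h1.trans h2) (norm_pos_iff.2 hz₁0)

end ChartForm

/-! ### Riemannian distance in a chart -/

section ChartDistance

open Metric MeasureTheory Manifold

variable {d : ℕ} {M : Type*} [MetricSpace M] [ChartedSpace (EuclideanSpace ℝ (Fin d)) M]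
  [IsManifold (𝓡 d) ∞ M] [Bundle.RiemannianBundle (fun x : M => TangentSpace (𝓡 d) x)]

local notation:max "𝔼" n:max => EuclideanSpace ℝ (Fin n)

lemma pathELength_chart_symm_comp (x : M) {c : ℝ → 𝔼 d} {a b : ℝ}
    (hc : ContDiffOn ℝ 1 c (Set.Icc a b))
    (hT : Set.MapsTo c (Set.Icc a b) (chartAt (𝔼 d) x).target) :
    pathELength (𝓡 d) ((chartAt (𝔼 d) x).symm ∘ c) a b =
      ∫⁻ t in Set.Icc a b, ‖chartDeriv x (c t) (derivWithin c (Set.Icc a b) t)‖ₑ := by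
  rcases le_or_gt b a with hab | hab
  · have h0 : volume (Set.Icc a b) = 0 := by simp [hab]
    rw [pathELength_eq_lintegral_mfderivWithin_Icc, Measure.restrict_eq_zero.2 h0,
      lintegral_zero_measure, lintegral_zero_measure]
  rw [pathELength_eq_lintegral_mfderivWithin_Icc]
  refine setLIntegral_congr_fun measurableSet_Icc fun t ht => ?_
  have h1 : mfderivWithin 𝓘(ℝ, ℝ) (𝓡 d) ((chartAt (𝔼 d) x).symm ∘ c) (Set.Icc a b) t =
      (mfderiv (𝓡 d) (𝓡 d) (chartAt (𝔼 d) x).symm (c t)) ∘L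
        (mfderivWithin 𝓘(ℝ, ℝ) (𝓡 d) c (Set.Icc a b) t) := by
    apply mfderiv_comp_mfderivWithin
    · exact mdifferentiableAt_chart_symm x (hT ht)
    · rw [mdifferentiableWithinAt_iff_differentiableWithinAt]
      exact hc.differentiableOn one_ne_zero t ht
    · rw [uniqueMDiffWithinAt_iff_uniqueDiffWithinAt]
      exact uniqueDiffOn_Icc hab t ht
  have h2 : mfderivWithin 𝓘(ℝ, ℝ) (𝓡 d) ((chartAt (𝔼 d) x).symm ∘ c) (Set.Icc a b) t 1 =
      chartDeriv x (c t) (derivWithin c (Set.Icc a b) t) := by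
    rw [h1]
    simp_rw [← fderivWithin_derivWithin, chartDeriv, mfderivWithin_eq_fderivWithin]
    rfl
  exact congrArg (fun v => ‖v‖ₑ) h2

/-- The distance between two points of a chart is at most the length of the segment between
them. -/
lemma dist_chart_symm_le [IsRiemannianManifold (𝓡 d) M] (x : M) {u v : 𝔼 d}
    (hT : segment ℝ u v ⊆ (chartAt (𝔼 d) x).target) {C : ℝ} (hC : 0 ≤ C)
    (hb : ∀ w ∈ segment ℝ u v, ‖chartDeriv x w (v - u)‖ ≤ C) :
    dist ((chartAt (𝔼 d) x).symm u) ((chartAt (𝔼 d) x).symm v) ≤ C := by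
  let c : ℝ → 𝔼 d := fun t => u + t • (v - u)
  have hmem : ∀ t ∈ Set.Icc (0 : ℝ) 1, c t ∈ segment ℝ u v := fun t ht => by
    rw [segment_eq_image']
    exact ⟨t, ht, rfl⟩
  have hc : ContDiff ℝ 1 c := contDiff_const.add (contDiff_id.smul contDiff_const)
  have hmaps : Set.MapsTo c (Set.Icc 0 1) (chartAt (𝔼 d) x).target := fun t ht => hT (hmem t ht)
  have hderiv : ∀ t ∈ Set.Icc (0 : ℝ) 1, derivWithin c (Set.Icc 0 1) t = v - u := fun t ht => by
    have : HasDerivAt c (v - u) t := by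
      simpa [c] using ((hasDerivAt_id t).smul_const (v - u)).const_add u
    exact this.hasDerivWithinAt.derivWithin (uniqueDiffOn_Icc one_pos t ht)
  have hsmooth : ContMDiffOn 𝓘(ℝ, ℝ) (𝓡 d) 1 ((chartAt (𝔼 d) x).symm ∘ c) (Set.Icc 0 1) :=
    ((contMDiffOn_chart_symm (I := 𝓡 d) (n := ∞) (x := x)).of_le (by simp)).comp
      (contMDiffOn_iff_contDiffOn.2 hc.contDiffOn) hmaps
  have h := riemannianEDist_le_pathELength hsmooth rfl rfl zero_le_one
  rw [← IsRiemannianManifold.out, pathELength_chart_symm_comp x hc.contDiffOn hmaps,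
    edist_dist] at h
  simp only [Function.comp_apply, c, zero_smul, add_zero, one_smul, add_sub_cancel] at h
  have h2 : ∫⁻ t in Set.Icc (0 : ℝ) 1, ‖chartDeriv x (c t) (derivWithin c (Set.Icc 0 1) t)‖ₑ ≤
      ∫⁻ _ in Set.Icc (0 : ℝ) 1, ENNReal.ofReal C := by
    refine setLIntegral_mono' measurableSet_Icc fun t ht => ?_
    rw [hderiv t ht, ← ofReal_norm]
    exact ENNReal.ofReal_le_ofReal (hb _ (hmem t ht))
  rw [setLIntegral_const] at h2
  simp only [Real.volume_Icc, sub_zero, ENNReal.ofReal_one, mul_one] at h2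
  exact (ENNReal.ofReal_le_ofReal_iff hC).1 (h.trans h2)

/-- A path inside the chart, starting at `u`, is at least as long as the segment between its
endpoints, measured with the metric tensor at `u`, up to the distortion `κ` of the metric tensor.
The length is bounded below by integrating the derivative of the linear functional that is dual to
the displacement. -/
lemma norm_chartDeriv_sub_le (x : M) {u : 𝔼 d} {κ t ℓ : ℝ} {K : Set (𝔼 d)}
    (hK : K ⊆ (chartAt (𝔼 d) x).target) (hκ : 0 ≤ κ)
    (hb : ∀ w ∈ K, ∀ a, ‖chartDeriv x u a‖ ≤ κ * ‖chartDeriv x w a‖)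
    {γ : ℝ → M} (hγ : ContMDiff 𝓘(ℝ, ℝ) (𝓡 d) 1 γ) (ht : 0 ≤ t)
    (h0 : γ 0 = (chartAt (𝔼 d) x).symm u) (hu : u ∈ (chartAt (𝔼 d) x).target)
    (hγK : ∀ s ∈ Set.Icc 0 t, γ s ∈ (chartAt (𝔼 d) x).symm '' K)
    (hℓ : 0 ≤ ℓ) (hlen : pathELength (𝓡 d) γ 0 t ≤ ENNReal.ofReal ℓ) :
    ‖chartDeriv x u (chartAt (𝔼 d) x (γ t) - u)‖ ≤ κ * ℓ := by
  let ψ := (chartAt (𝔼 d) x).symm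
  let c : ℝ → 𝔼 d := chartAt (𝔼 d) x ∘ γ
  have hcK : ∀ s ∈ Set.Icc 0 t, c s ∈ K ∧ ψ (c s) = γ s := by
    intro s hs
    obtain ⟨w, hw, hws⟩ := hγK s hs
    have : c s = w := by
      simp only [c, Function.comp_apply, ← hws]
      exact (chartAt (𝔼 d) x).right_inv (hK hw)
    rw [this]
    exact ⟨hw, hws⟩
  have hsource : Set.MapsTo γ (Set.Icc 0 t) (chartAt (𝔼 d) x).source := fun s hs => by
    rw [← (hcK s hs).2]
    exact (chartAt (𝔼 d) x).map_target (hK (hcK s hs).1)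
  have hc : ContDiffOn ℝ 1 c (Set.Icc 0 t) := by
    rw [← contMDiffOn_iff_contDiffOn]
    exact ((contMDiffOn_chart (I := 𝓡 d) (n := ∞) (x := x)).of_le (by simp)).comp
      hγ.contMDiffOn hsource
  rw [pathELength_congr (γ' := ψ ∘ c) fun s hs => (hcK s hs).2.symm,
    pathELength_chart_symm_comp x hc fun s hs => hK (hcK s hs).1] at hlen
  have hc0 : c 0 = u := by
    simp only [c, Function.comp_apply, h0]
    exact (chartAt (𝔼 d) x).right_inv hu
  let a := c t - u
  let f : 𝔼 d →L[ℝ] ℝ := chartForm x u a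
  have hfc : ContDiffOn ℝ 1 (f ∘ c) (Set.Icc 0 t) := f.contDiff.comp_contDiffOn hc
  have h1 := enorm_sub_le_lintegral_derivWithin_Icc_of_contDiffOn_Icc hfc ht
  have h2 : ∫⁻ s in Set.Icc 0 t, ‖derivWithin (f ∘ c) (Set.Icc 0 t) s‖ₑ ≤
      ∫⁻ s in Set.Icc 0 t, ENNReal.ofReal (‖chartDeriv x u a‖ * κ) *
        ‖chartDeriv x (c s) (derivWithin c (Set.Icc 0 t) s)‖ₑ := by
    refine setLIntegral_mono' measurableSet_Icc fun s hs => ?_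
    have h3 : derivWithin (f ∘ c) (Set.Icc 0 t) s = f (derivWithin c (Set.Icc 0 t) s) := by
      rcases ht.eq_or_lt with rfl | ht'
      · have : ¬AccPt s (Filter.principal (Set.Icc (0 : ℝ) 0)) := by
          rw [accPt_iff_frequently]
          simp only [Set.Icc_self, Set.mem_singleton_iff] at hs ⊢
          subst hs
          simp
        rw [derivWithin_zero_of_not_accPt this, derivWithin_zero_of_not_accPt this, map_zero]
      · have hd := ((hc.differentiableOn one_ne_zero) s hs).hasDerivWithinAt
        exact (f.hasFDerivAt.comp_hasDerivWithinAt s hd).derivWithin (uniqueDiffOn_Icc ht' s hs)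
    rw [h3, ← ofReal_norm, ← ofReal_norm, ← ENNReal.ofReal_mul (by positivity)]
    refine ENNReal.ofReal_le_ofReal ?_
    calc ‖f (derivWithin c (Set.Icc 0 t) s)‖
        ≤ ‖chartDeriv x u a‖ * ‖chartDeriv x u (derivWithin c (Set.Icc 0 t) s)‖ :=
          norm_inner_le_norm (chartDeriv x u a) (chartDeriv x u (derivWithin c (Set.Icc 0 t) s))
      _ ≤ ‖chartDeriv x u a‖ * (κ * ‖chartDeriv x (c s) (derivWithin c (Set.Icc 0 t) s)‖) := by
          gcongr
          exact hb _ (hcK s hs).1 _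
      _ = _ := by ring
  rw [lintegral_const_mul' _ _ ENNReal.ofReal_ne_top] at h2
  have h4 : ‖(f ∘ c) t - (f ∘ c) 0‖ₑ = ENNReal.ofReal (‖chartDeriv x u a‖ ^ 2) := by
    rw [← chartForm_self, Function.comp_apply, Function.comp_apply, hc0, ← map_sub,
      ← ofReal_norm, Real.norm_of_nonneg]
    change 0 ≤ chartForm x u a a
    rw [chartForm_self]
    positivity
  rw [h4] at h1
  have h5 := h1.trans (h2.trans (mul_le_mul_right hlen _))
  rw [← ENNReal.ofReal_mul (by positivity), ENNReal.ofReal_le_ofReal_iff (by positivity)] at h5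
  change ‖chartDeriv x u a‖ ≤ κ * ℓ
  rcases (norm_nonneg (chartDeriv x u a)).eq_or_lt with h6 | h6
  · rw [← h6]; positivity
  · nlinarith

/-- A point is either in the chart ball around `u`, at a distance that is bounded below in terms
of the metric tensor at `u`, or its distance from the centre is at least that of the boundary of
the ball. -/
lemma exists_mem_ball_or_le_dist [IsRiemannianManifold (𝓡 d) M] (x : M) {u : 𝔼 d} {r κ l : ℝ}
    (hr : 0 < r) (hT : closedBall u r ⊆ (chartAt (𝔼 d) x).target) (hκ : 0 ≤ κ)
    (hb : ∀ w ∈ closedBall u r, ∀ a, ‖chartDeriv x u a‖ ≤ κ * ‖chartDeriv x w a‖)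
    (hl : ∀ a, l * ‖a‖ ≤ ‖chartDeriv x u a‖) (q : M) :
    (∃ w ∈ ball u r, (chartAt (𝔼 d) x).symm w = q ∧
      ‖chartDeriv x u (w - u)‖ ≤ κ * dist ((chartAt (𝔼 d) x).symm u) q) ∨
    l * r ≤ κ * dist ((chartAt (𝔼 d) x).symm u) q := by
  set ψ := (chartAt (𝔼 d) x).symm with hψ
  have hu : u ∈ (chartAt (𝔼 d) x).target := hT (mem_closedBall_self hr.le)
  -- the alternative holds with the length of any path in place of the distance
  have key : ∀ ℓ, dist (ψ u) q < ℓ →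
      (∃ w ∈ ball u r, ψ w = q ∧ ‖chartDeriv x u (w - u)‖ ≤ κ * ℓ) ∨ l * r ≤ κ * ℓ := by
    intro ℓ hℓ
    have hℓ0 : 0 ≤ ℓ := dist_nonneg.trans hℓ.le
    have hlt : riemannianEDist (𝓡 d) (ψ u) q < ENNReal.ofReal ℓ := by
      rw [← IsRiemannianManifold.out, edist_dist]
      exact (ENNReal.ofReal_lt_ofReal_iff (dist_nonneg.trans_lt hℓ)).2 hℓ
    obtain ⟨γ, h0, h1, hγ, hlen, -⟩ := exists_lt_locally_constant_of_riemannianEDist_lt hlt one_pos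
    have hopen : IsOpen (ψ '' ball u r) := (chartAt (𝔼 d) x).isOpen_image_symm_of_subset_target
      isOpen_ball (ball_subset_closedBall.trans hT)
    have hclosed : IsClosed (ψ '' closedBall u r) :=
      ((isCompact_closedBall u r).image_of_continuousOn
        ((chartAt (𝔼 d) x).continuousOn_symm.mono hT)).isClosed
    have hright : ∀ w ∈ closedBall u r, chartAt (𝔼 d) x (ψ w) = w := fun w hw =>
      (chartAt (𝔼 d) x).right_inv (hT hw)
    let A : Set ℝ := Set.Icc 0 1 ∩ γ ⁻¹' (ψ '' ball u r)ᶜ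
    have hA : IsClosed A := isClosed_Icc.inter (hopen.isClosed_compl.preimage hγ.continuous)
    rcases A.eq_empty_or_nonempty with hem | hne
    · left
      have hmem : ∀ t ∈ Set.Icc (0 : ℝ) 1, γ t ∈ ψ '' ball u r := fun t ht => by
        by_contra hn
        have : t ∈ A := ⟨ht, hn⟩
        rw [hem] at this
        exact this
      obtain ⟨w, hw, hwq⟩ := hmem 1 (by simp)
      have h2 := norm_chartDeriv_sub_le x hT hκ hb hγ zero_le_one h0 hu
        (fun s hs => Set.image_mono ball_subset_closedBall (hmem s hs)) hℓ0 hlen.le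
      rw [← hwq, hright w (ball_subset_closedBall hw)] at h2
      exact ⟨w, hw, hwq.trans h1, h2⟩
    · right
      have hbdd : BddBelow A := ⟨0, fun t ht => ht.1.1⟩
      -- the first exit time from the ball
      set t₁ := sInf A
      have ht₁ : t₁ ∈ A := hA.csInf_mem hne hbdd
      have hbefore : ∀ t ∈ Set.Ico 0 t₁, γ t ∈ ψ '' ball u r := fun t ht => by
        by_contra hn
        exact absurd (csInf_le hbdd (⟨⟨ht.1, ht.2.le.trans ht₁.1.2⟩, hn⟩ : t ∈ A)) (not_le.2 ht.2)
      have hpos : 0 < t₁ := by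
        refine lt_of_le_of_ne ht₁.1.1 fun h => ht₁.2 ?_
        rw [← h, h0]
        exact ⟨u, mem_ball_self hr, rfl⟩
      have hend : γ t₁ ∈ ψ '' closedBall u r := by
        refine hclosed.mem_of_tendsto (b := nhdsWithin t₁ (Set.Iio t₁))
          (hγ.continuous.continuousAt.tendsto.mono_left nhdsWithin_le_nhds) ?_
        filter_upwards [Ico_mem_nhdsLT hpos] with t ht
        exact Set.image_mono ball_subset_closedBall (hbefore t ht)
      have h2 := norm_chartDeriv_sub_le x hT hκ hb hγ hpos.le h0 hu
        (fun s hs => by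
          rcases hs.2.eq_or_lt with h | h
          · rw [h]; exact hend
          · exact Set.image_mono ball_subset_closedBall (hbefore s ⟨hs.1, h⟩)) hℓ0
        ((pathELength_mono le_rfl ht₁.1.2).trans hlen.le)
      obtain ⟨w, hw, hwt⟩ := hend
      have hwr : r ≤ ‖w - u‖ := by
        by_contra hn
        exact ht₁.2 ⟨w, mem_ball_iff_norm.2 (not_le.1 hn), hwt⟩
      rw [← hwt, hright w hw] at h2
      have hnonneg : 0 ≤ ‖w - u‖ := norm_nonneg _
      rcases le_or_gt l 0 with hl0 | hl0
      · have : 0 ≤ κ * ℓ := by positivity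
        nlinarith
      · exact ((mul_le_mul_of_nonneg_left hwr hl0.le).trans (hl _)).trans h2
  by_cases hle : l * r ≤ κ * dist (ψ u) q
  · exact Or.inr hle
  left
  have hev : ∀ᶠ ℓ in nhdsWithin (dist (ψ u) q) (Set.Ioi (dist (ψ u) q)),
      κ * ℓ < l * r ∧ dist (ψ u) q < ℓ := by
    refine Filter.Eventually.and ?_ self_mem_nhdsWithin
    exact nhdsWithin_le_nhds ((continuous_const.mul continuous_id).continuousAt.eventually_lt
      continuousAt_const (not_le.1 hle))
  have hw : ∃ w ∈ ball u r, ψ w = q := by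
    obtain ⟨ℓ, h1, h2⟩ := hev.exists
    obtain ⟨w, hw, hwq, -⟩ := (key ℓ h2).resolve_right (not_le.2 h1)
    exact ⟨w, hw, hwq⟩
  obtain ⟨w, hw, hwq⟩ := hw
  refine ⟨w, hw, hwq, ?_⟩
  refine ge_of_tendsto (f := fun ℓ => κ * ℓ)
    (x := nhdsWithin (dist (ψ u) q) (Set.Ioi (dist (ψ u) q))) ?_ ?_
  · exact ((continuous_const.mul continuous_id).tendsto _).mono_left nhdsWithin_le_nhds
  · filter_upwards [hev] with ℓ hℓ
    obtain ⟨w', hw', hwq', h⟩ := (key ℓ hℓ.2).resolve_right (not_le.2 hℓ.1)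
    have : w' = w := (chartAt (𝔼 d) x).symm.injOn (hT (ball_subset_closedBall hw'))
      (hT (ball_subset_closedBall hw)) (hwq'.trans hwq.symm)
    rwa [this] at h

variable [IsContMDiffRiemannianBundle (𝓡 d) ∞ (𝔼 d) (fun x : M => TangentSpace (𝓡 d) x)]
  [IsRiemannianManifold (𝓡 d) M]

/-- Near every point, the inverse of a chart of a Riemannian manifold, with the metric tensor in
the chart, is a metric chart for the Riemannian distance. -/
lemma exists_isMetricChart (x : M) : ∃ R l Λ B ρ₀ : ℝ, 0 < R ∧ 0 < l ∧ 0 < Λ ∧ 0 ≤ B ∧ 0 < ρ₀ ∧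
    ball (chartAt (𝔼 d) x x) (4 * R) ⊆ (chartAt (𝔼 d) x).target ∧
    IsMetricChart (chartAt (𝔼 d) x).symm (chartForm x) (chartAt (𝔼 d) x x) R l Λ B ρ₀ := by
  set u₀ := chartAt (𝔼 d) x x with hu₀
  set ψ := (chartAt (𝔼 d) x).symm with hψ
  obtain ⟨R₀, hR₀, hT⟩ := nhds_basis_closedBall.mem_iff.1
    ((chartAt (𝔼 d) x).open_target.mem_nhds (mem_chart_target (𝔼 d) x))
  obtain ⟨lam, Λ, hlam, hlamΛ, hbd⟩ := exists_norm_chartDeriv_bounds x hR₀.le hT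
  obtain ⟨B, hB, hGB, hGlip, hG2⟩ := exists_second_difference_bound
    (chartAt (𝔼 d) x).open_target
    ((contDiffOn_chartForm x).of_le ENat.LEInfty.out) hT
  have hΛ : 0 < Λ := hlam.trans_le hlamΛ
  obtain ⟨R, hR, hRR⟩ : ∃ R : ℝ, 0 < R ∧ R₀ = 16 * R := ⟨R₀ / 16, by positivity, by ring⟩
  subst hRR
  have hsub : ball u₀ (4 * R) ⊆ closedBall u₀ (16 * R) :=
    ball_subset_closedBall.trans (closedBall_subset_closedBall (by linarith))
  have hsubT : ball u₀ (4 * R) ⊆ (chartAt (𝔼 d) x).target := hsub.trans hT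
  have hcb : ∀ u ∈ ball u₀ (4 * R), ∀ r ≤ 12 * R, closedBall u r ⊆ closedBall u₀ (16 * R) := by
    intro u hu r hr
    refine closedBall_subset_closedBall' ?_
    linarith [mem_ball.1 hu]
  have hκ : ∀ u ∈ ball u₀ (4 * R), ∀ r ≤ 12 * R, ∀ w ∈ closedBall u r, ∀ a,
      ‖chartDeriv x u a‖ ≤ Λ / lam * ‖chartDeriv x w a‖ := by
    intro u hu r hr w hw a
    have h1 := (hbd u (hsub hu) a).2
    have h2 := (hbd w (hcb u hu r hr hw) a).1
    rw [div_mul_eq_mul_div, le_div_iff₀ hlam]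
    calc ‖chartDeriv x u a‖ * lam ≤ Λ * ‖a‖ * lam := by gcongr
      _ = Λ * (lam * ‖a‖) := by ring
      _ ≤ _ := by gcongr
  have hleft : ∀ u ∈ ball u₀ (4 * R), ∀ v ∈ ball u₀ (4 * R), ∀ w ∈ ball u (12 * R),
      ψ w = ψ v → w = v := fun u hu v hv w hw h =>
    (chartAt (𝔼 d) x).symm.injOn (hT (hcb u hu _ le_rfl (ball_subset_closedBall hw)))
      (hsubT hv) h
  have hnorm : ∀ u ∈ ball u₀ (4 * R), ∀ v ∈ ball u₀ (4 * R), ‖v - u‖ < 8 * R := by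
    intro u hu v hv
    rw [← dist_eq_norm]
    linarith [dist_triangle_right v u u₀, mem_ball.1 hu, mem_ball.1 hv]
  have hseg : ∀ u ∈ ball u₀ (4 * R), ∀ v ∈ ball u₀ (4 * R), ∀ w ∈ segment ℝ u v,
      w ∈ ball u₀ (4 * R) := fun u hu v hv w hw => (convex_ball u₀ (4 * R)).segment_subset hu hv hw
  have hdist_le : ∀ u ∈ ball u₀ (4 * R), ∀ v ∈ ball u₀ (4 * R),
      dist (ψ u) (ψ v) ≤ Λ * ‖v - u‖ := fun u hu v hv =>
    dist_chart_symm_le x (fun w hw => hsubT (hseg u hu v hv w hw)) (by positivity)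
      fun w hw => (hbd w (hsub (hseg u hu v hv w hw)) _).2
  have hform : ∀ u ∈ ball u₀ (4 * R), ∀ w ∈ closedBall u₀ (16 * R), ∀ a,
      |chartForm x u a a - chartForm x w a a| ≤ B * ‖u - w‖ * ‖a‖ ^ 2 := by
    intro u hu w hw a
    calc |chartForm x u a a - chartForm x w a a| = ‖(chartForm x u - chartForm x w) a a‖ := rfl
      _ ≤ ‖chartForm x u - chartForm x w‖ * ‖a‖ * ‖a‖ := ContinuousLinearMap.le_opNorm₂ _ _ _
      _ ≤ B * ‖u - w‖ * ‖a‖ * ‖a‖ := by gcongr; exact hGlip u (hsub hu) w hw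
      _ = _ := by ring
  set B' := 2 * B + B * Λ ^ 3 / lam ^ 3 + Λ ^ 3 / (12 * R * lam) with hB'
  have hB1 : 0 ≤ B * Λ ^ 3 / lam ^ 3 := by positivity
  have hB2 : 0 ≤ Λ ^ 3 / (12 * R * lam) := by positivity
  refine ⟨R, lam ^ 2 / Λ, Λ, B', lam ^ 2 * R / Λ, hR, by positivity, hΛ, by positivity,
    by positivity, hsubT, ?_, fun u hu v hv => ?_, ?_, chartForm_symm x, fun u hu => ?_,
    fun u k h1 h2 => ?_, fun u k h1 h2 => ?_, ?_⟩
  · intro u hu v hv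
    have h := exists_mem_ball_or_le_dist x (r := 12 * R) (by positivity)
      ((hcb u hu _ le_rfl).trans hT) (by positivity) (hκ u hu _ le_rfl)
      (fun a => (hbd u (hsub hu) a).1) (ψ v)
    have h3 : lam * ‖u - v‖ ≤ Λ / lam * dist (ψ u) (ψ v) := by
      rw [norm_sub_rev]
      rcases h with ⟨w, hw, hwv, h⟩ | h
      · rw [hleft u hu v hv w hw hwv] at h
        exact (hbd u (hsub hu) _).1.trans h
      · refine le_trans ?_ h
        gcongr
        linarith [hnorm u hu v hv]
    rw [div_mul_eq_mul_div, le_div_iff₀ hlam] at h3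
    rw [div_mul_eq_mul_div, div_le_iff₀ hΛ]
    linarith
  · rw [norm_sub_rev]
    exact hdist_le u hu v hv
  · intro u hu v hv
    set ε := ‖v - u‖ with hε
    rw [abs_le]
    constructor
    · rcases (norm_nonneg (v - u)).eq_or_lt with h0 | hpos
      · have h1 : ε = 0 := h0.symm
        rw [h1, norm_eq_zero.1 h1, map_zero]
        nlinarith [sq_nonneg (dist (ψ u) (ψ v))]
      rw [← hε] at hpos
      have hGu : chartForm x u (v - u) (v - u) ≤ Λ ^ 2 * ε ^ 2 := by
        rw [chartForm_self, ← mul_pow]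
        gcongr
        exact (hbd u (hsub hu) _).2
      rcases le_or_gt (Λ / lam * ε) (12 * R) with hr | hr
      · -- the ball has radius `Λ / lam * ε`, so that leaving it costs at least `Λ * ε`
        have hdist : chartForm x u (v - u) (v - u) ≤
            (1 + B * (Λ / lam * ε) / lam ^ 2) * dist (ψ u) (ψ v) ^ 2 := by
          set κ := Real.sqrt (1 + B * (Λ / lam * ε) / lam ^ 2) with hκdef
          have hκ2 : κ ^ 2 = 1 + B * (Λ / lam * ε) / lam ^ 2 := Real.sq_sqrt (by positivity)
          have hdistort : ∀ w ∈ closedBall u (Λ / lam * ε), ∀ a,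
              ‖chartDeriv x u a‖ ≤ κ * ‖chartDeriv x w a‖ := by
            intro w hw a
            refine (pow_le_pow_iff_left₀ (norm_nonneg _) (by positivity) two_ne_zero).1 ?_
            rw [mul_pow, hκ2, ← chartForm_self, ← chartForm_self]
            have hw' := hcb u hu _ hr hw
            have h1 := (abs_le.1 (hform u hu w hw' a)).2
            have h2 := (hbd w hw' a).1
            have h3 : ‖a‖ ^ 2 ≤ chartForm x w a a / lam ^ 2 := by
              rw [le_div_iff₀ (by positivity), chartForm_self, ← mul_pow, mul_comm]
              gcongr
            have h4 : ‖u - w‖ ≤ Λ / lam * ε := by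
              rw [← dist_eq_norm, dist_comm]; exact hw
            calc chartForm x u a a ≤ chartForm x w a a + B * ‖u - w‖ * ‖a‖ ^ 2 := by linarith
              _ ≤ chartForm x w a a +
                  B * (Λ / lam * ε) * (chartForm x w a a / lam ^ 2) := by gcongr
              _ = _ := by ring
          rw [← hκ2, ← mul_pow, chartForm_self]
          refine pow_le_pow_left₀ (norm_nonneg _) ?_ 2
          rcases exists_mem_ball_or_le_dist x (r := Λ / lam * ε) (by positivity)
            ((hcb u hu _ hr).trans hT) (by positivity) hdistort
            (fun a => (hbd u (hsub hu) a).1) (ψ v) with ⟨w, hw, hwv, h⟩ | h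
          · rwa [hleft u hu v hv w (ball_subset_ball hr hw) hwv] at h
          · refine le_trans ((hbd u (hsub hu) _).2.trans (le_of_eq ?_)) h
            rw [← hε]
            field_simp
        have hd2 : dist (ψ u) (ψ v) ^ 2 ≤ Λ ^ 2 * ε ^ 2 := by
          rw [← mul_pow]
          exact pow_le_pow_left₀ dist_nonneg (hdist_le u hu v hv) 2
        have h5 : B * (Λ / lam * ε) / lam ^ 2 * dist (ψ u) (ψ v) ^ 2 ≤
            B * (Λ / lam * ε) / lam ^ 2 * (Λ ^ 2 * ε ^ 2) := by gcongr
        have h6 : B * (Λ / lam * ε) / lam ^ 2 * (Λ ^ 2 * ε ^ 2) =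
            B * Λ ^ 3 / lam ^ 3 * ε ^ 3 := by field_simp
        have h7 : B * Λ ^ 3 / lam ^ 3 * ε ^ 3 ≤ B' * ε ^ 3 := by
          gcongr
          linarith
        nlinarith
      · have h5 : Λ ^ 2 * ε ^ 2 ≤ Λ ^ 3 / (12 * R * lam) * ε ^ 3 := by
          have h6 : 12 * R * lam ≤ Λ * ε := by
            rw [div_mul_eq_mul_div, lt_div_iff₀ hlam] at hr
            exact hr.le
          rw [div_mul_eq_mul_div, le_div_iff₀ (by positivity)]
          calc Λ ^ 2 * ε ^ 2 * (12 * R * lam) ≤ Λ ^ 2 * ε ^ 2 * (Λ * ε) := by gcongr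
            _ = _ := by ring
        have h7 : Λ ^ 3 / (12 * R * lam) * ε ^ 3 ≤ B' * ε ^ 3 := by
          gcongr
          linarith
        nlinarith [sq_nonneg (dist (ψ u) (ψ v))]
    · have hnn : 0 ≤ chartForm x u (v - u) (v - u) := by rw [chartForm_self]; positivity
      have hnn2 : 0 ≤ chartForm x u (v - u) (v - u) + B * ε ^ 3 := by positivity
      have h : dist (ψ u) (ψ v) ≤ Real.sqrt (chartForm x u (v - u) (v - u) + B * ε ^ 3) := by
        refine dist_chart_symm_le x (fun w hw => hsubT (hseg u hu v hv w hw))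
          (Real.sqrt_nonneg _) fun w hw => Real.le_sqrt_of_sq_le ?_
        rw [← chartForm_self]
        have h1 := (abs_le.1 (hform u hu w (hsub (hseg u hu v hv w hw)) (v - u))).1
        have h2 : ‖u - w‖ ≤ ε := by
          rw [segment_eq_image'] at hw
          obtain ⟨t, ht, rfl⟩ := hw
          rw [sub_add_cancel_left, norm_neg, norm_smul, Real.norm_of_nonneg ht.1]
          exact mul_le_of_le_one_left (norm_nonneg _) ht.2
        have h3 : B * ‖u - w‖ * ε ^ 2 ≤ B * ε * ε ^ 2 := by gcongr
        nlinarith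
      have h2 := pow_le_pow_left₀ dist_nonneg h 2
      rw [Real.sq_sqrt hnn2] at h2
      have h3 : B * ε ^ 3 ≤ B' * ε ^ 3 := by
        gcongr
        linarith
      linarith
  · linarith [hGB u (hsub hu)]
  · refine (hGlip _ (hsub h1) _ (hsub h2)).trans ?_
    rw [show u + k - (u - k) = (2 : ℝ) • k by module, norm_smul, Real.norm_ofNat]
    nlinarith [norm_nonneg k]
  · refine (hG2 u k (hsub h1) (hsub h2)).trans ?_
    gcongr
    linarith
  · intro u hu q hq
    have hu4 : u ∈ ball u₀ (4 * R) := ball_subset_ball (by linarith) hu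
    rcases exists_mem_ball_or_le_dist x (r := R) hR
      ((hcb u hu4 _ (by linarith)).trans hT) (by positivity) (hκ u hu4 _ (by linarith))
      (fun a => (hbd u (hsub hu4) a).1) q with ⟨w, hw, hwq, -⟩ | h
    · refine ⟨w, ?_, hwq⟩
      rw [mem_ball] at hw hu ⊢
      linarith [dist_triangle w u u₀]
    · rw [lt_div_iff₀ hΛ] at hq
      rw [div_mul_eq_mul_div, le_div_iff₀ hlam] at h
      nlinarith

end ChartDistance

section LengthSpace

open Metric MeasureTheory Manifold

/-- A compact Riemannian manifold is a geodesic space. The intermediate point is a point of the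
sphere around `x` that is closest to `y`; almost minimizing paths show that it is close enough. -/
lemma exists_dist_eq_and_dist_eq_sub (d : ℕ) {M : Type*} [MetricSpace M] [CompactSpace M]
    [ChartedSpace (EuclideanSpace ℝ (Fin d)) M]
    [Bundle.RiemannianBundle (fun x : M => TangentSpace (𝓡 d) x)] [IsRiemannianManifold (𝓡 d) M]
    (x y : M) {s : ℝ} (hs : 0 ≤ s) (hsd : s ≤ dist x y) : ∃ z, dist x z = s ∧ dist z y = dist x y - s := by
  have key : ∀ ε > 0, ∃ z, dist x z = s ∧ dist z y ≤ dist x y - s + ε := by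
    intro ε hε
    have hlt : riemannianEDist (𝓡 d) x y < ENNReal.ofReal (dist x y + ε) := by
      rw [← IsRiemannianManifold.out, edist_dist]
      exact (ENNReal.ofReal_lt_ofReal_iff (by positivity)).2 (by linarith)
    obtain ⟨γ, h0, h1, hγ, hlen, -⟩ := exists_lt_locally_constant_of_riemannianEDist_lt hlt one_pos
    have hcont : ContinuousOn (fun t => dist x (γ t)) (Set.Icc 0 1) :=
      (continuous_const.dist hγ.continuous).continuousOn
    have hmem : s ∈ Set.Icc (dist x (γ 0)) (dist x (γ 1)) := by
      rw [h0, h1, dist_self]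
      exact ⟨hs, hsd⟩
    obtain ⟨t, ht, hts⟩ := intermediate_value_Icc zero_le_one hcont hmem
    refine ⟨γ t, hts, ?_⟩
    have e1 : edist x (γ t) ≤ pathELength (𝓡 d) γ 0 t := by
      rw [IsRiemannianManifold.out (I := 𝓡 d)]
      exact riemannianEDist_le_pathELength hγ.contMDiffOn h0 rfl ht.1
    have e2 : edist (γ t) y ≤ pathELength (𝓡 d) γ t 1 := by
      rw [IsRiemannianManifold.out (I := 𝓡 d)]
      exact riemannianEDist_le_pathELength hγ.contMDiffOn rfl h1 ht.2
    have e3 := (add_le_add e1 e2).trans_lt ((pathELength_add ht.1 ht.2).trans_lt hlen)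
    rw [edist_dist, edist_dist, ← ENNReal.ofReal_add dist_nonneg dist_nonneg,
      ENNReal.ofReal_lt_ofReal_iff (by positivity)] at e3
    simp only at hts
    linarith
  have hK : IsCompact {z | dist x z = s} :=
    (isClosed_eq (continuous_const.dist continuous_id) continuous_const).isCompact
  obtain ⟨z₀, hz₀, -⟩ := key 1 one_pos
  obtain ⟨z, hz, hmin⟩ := hK.exists_isMinOn ⟨z₀, hz₀⟩
    (continuous_id.dist continuous_const : Continuous fun z => dist z y).continuousOn
  refine ⟨z, hz, le_antisymm (le_of_forall_pos_le_add fun ε hε => ?_) ?_⟩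
  · obtain ⟨z', hz', h⟩ := key ε hε
    exact (hmin hz').trans h
  · have : dist x z = s := hz
    linarith [dist_triangle x z y]

end LengthSpace

/-! ### The Riemannian measure in a chart -/

section ChartMeasure

open MeasureTheory Metric

variable {d : ℕ} {M : Type*} [TopologicalSpace M] [ChartedSpace (EuclideanSpace ℝ (Fin d)) M]

local notation:max "𝔼" n:max => EuclideanSpace ℝ (Fin n)

lemma measurableSet_target_inter_preimage [MeasurableSpace M] [BorelSpace M] (x : M) {A : Set M}
    (hA : MeasurableSet A) :
    MeasurableSet ((chartAt (𝔼 d) x).target ∩ (chartAt (𝔼 d) x).symm ⁻¹' A) := by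
  have h := (continuousOn_iff_continuous_domRestrict.1
    (chartAt (𝔼 d) x).continuousOn_symm).measurable hA
  have h2 := (chartAt (𝔼 d) x).open_target.measurableSet.subtype_image h
  convert! h2 using 1
  ext u
  simp [and_comm]

variable [Bundle.RiemannianBundle (fun x : M => TangentSpace (𝓡 d) x)]

lemma chartMeasure_apply [MeasurableSpace M] [BorelSpace M] (x : M) {A : Set M}
    (hA : MeasurableSet A) :
    chartMeasure (d := d) x A =
      ∫⁻ u in (chartAt (𝔼 d) x).target ∩ (chartAt (𝔼 d) x).symm ⁻¹' A,
        ENNReal.ofReal (√(metricMatrix x u).det) := by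
  have hT := (chartAt (𝔼 d) x).open_target.measurableSet
  have hm : AEMeasurable (chartAt (𝔼 d) x).symm
      ((volume.restrict (chartAt (𝔼 d) x).target).withDensity
        fun u => ENNReal.ofReal (√(metricMatrix x u).det)) :=
    ((chartAt (𝔼 d) x).continuousOn_symm.aemeasurable hT).mono_ac
      (withDensity_absolutelyContinuous _ _)
  rw [chartMeasure, Measure.map_apply_of_aemeasurable hm hA, withDensity_apply',
    Measure.restrict_restrict' hT, Set.inter_comm]

lemma chartMeasure_inter_source [MeasurableSpace M] [BorelSpace M] (y : M) {A : Set M}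
    (hA : MeasurableSet A) :
    chartMeasure (d := d) y (A ∩ (chartAt (𝔼 d) y).source) = chartMeasure (d := d) y A := by
  rw [chartMeasure_apply y hA,
    chartMeasure_apply y (hA.inter (chartAt (𝔼 d) y).open_source.measurableSet)]
  congr 2
  ext u
  simp only [Set.mem_inter_iff, Set.mem_preimage]
  exact ⟨fun h => ⟨h.1, h.2.1⟩, fun h => ⟨h.1, h.2, (chartAt (𝔼 d) y).map_target h.1⟩⟩

lemma inner_tangentSpace_congr {p q : M} (h : p = q) (v w : 𝔼 d) :
    inner ℝ (show TangentSpace (𝓡 d) p from v) (show TangentSpace (𝓡 d) p from w) =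
      inner ℝ (show TangentSpace (𝓡 d) q from v) (show TangentSpace (𝓡 d) q from w) := by
  subst h
  rfl

variable [IsManifold (𝓡 d) ∞ M]

/-- The transformation of the metric tensor under the change of coordinates `φ`. -/
lemma chartForm_eq_chartForm_fderiv (x y : M) {u : 𝔼 d} (hu : u ∈ (chartAt (𝔼 d) x).target)
    (hy : (chartAt (𝔼 d) x).symm u ∈ (chartAt (𝔼 d) y).source) (v w : 𝔼 d) :
    chartForm x u v w = chartForm y (chartAt (𝔼 d) y ((chartAt (𝔼 d) x).symm u))
      (fderiv ℝ (chartAt (𝔼 d) y ∘ (chartAt (𝔼 d) x).symm) u v)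
      (fderiv ℝ (chartAt (𝔼 d) y ∘ (chartAt (𝔼 d) x).symm) u w) := by
  have : IsManifold (𝓡 d) 1 M := IsManifold.of_le (n := ∞) (by simp)
  set φ := chartAt (𝔼 d) y ∘ (chartAt (𝔼 d) x).symm with hφ
  have hev : (chartAt (𝔼 d) x).symm =ᶠ[nhds u] (chartAt (𝔼 d) y).symm ∘ φ := by
    filter_upwards [(chartAt (𝔼 d) x).open_target.mem_nhds hu,
      ((chartAt (𝔼 d) x).continuousAt_symm hu).preimage_mem_nhds
        ((chartAt (𝔼 d) y).open_source.mem_nhds hy)] with w _ hw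
    exact ((chartAt (𝔼 d) y).left_inv hw).symm
  have hφd : MDifferentiableAt (𝓡 d) (𝓡 d) φ u :=
    (mdifferentiableAt_atlas (chart_mem_atlas _ y) hy).comp u (mdifferentiableAt_chart_symm x hu)
  have hcomp := mfderiv_comp u
    (mdifferentiableAt_chart_symm y ((chartAt (𝔼 d) y).map_source hy)) hφd
  have hD : ∀ a : 𝔼 d, (chartDeriv x u a : 𝔼 d) = chartDeriv y (φ u) (fderiv ℝ φ u a) := by
    intro a
    have h1 := congrArg (fun T : 𝔼 d →L[ℝ] 𝔼 d => T a)
      (hev.mfderiv_eq (I := 𝓡 d) (I' := 𝓡 d))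
    have h2 := congrArg (fun T : 𝔼 d →L[ℝ] 𝔼 d => T a) hcomp
    refine h1.trans (h2.trans ?_)
    rw [← mfderiv_eq_fderiv]
    rfl
  rw [chartForm_apply, chartForm_apply]
  have h3 := inner_tangentSpace_congr (d := d) hev.self_of_nhds (chartDeriv x u v)
    (chartDeriv x u w)
  refine h3.trans ?_
  rw [hD v, hD w]
  rfl

lemma sqrt_det_metricMatrix_eq (x y : M) {u : 𝔼 d} (hu : u ∈ (chartAt (𝔼 d) x).target)
    (hy : (chartAt (𝔼 d) x).symm u ∈ (chartAt (𝔼 d) y).source) :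
    √(metricMatrix x u).det =
      |(fderiv ℝ (chartAt (𝔼 d) y ∘ (chartAt (𝔼 d) x).symm) u).det| *
        √(metricMatrix y (chartAt (𝔼 d) y ((chartAt (𝔼 d) x).symm u))).det := by
  set T := fderiv ℝ (chartAt (𝔼 d) y ∘ (chartAt (𝔼 d) x).symm) u with hT
  set b := (EuclideanSpace.basisFun (Fin d) ℝ).toBasis with hb
  set J := LinearMap.toMatrix b b T.toLinearMap with hJ
  have hsum : ∀ i, T (EuclideanSpace.single i 1) = ∑ k, J k i • EuclideanSpace.single k (1 : ℝ) := by
    intro i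
    have h := b.sum_repr (T (EuclideanSpace.single i 1))
    rw [← h]
    refine Finset.sum_congr rfl fun k _ => ?_
    simp [hJ, hb, LinearMap.toMatrix_apply]
  have hmat : metricMatrix x u =
      J.transpose * metricMatrix y (chartAt (𝔼 d) y ((chartAt (𝔼 d) x).symm u)) * J := by
    ext i j
    rw [metricMatrix_apply, chartForm_eq_chartForm_fderiv x y hu hy, ← hT, hsum i, hsum j]
    simp only [map_sum, map_smul, sum_apply, smul_apply, smul_eq_mul,
      Matrix.mul_apply, Matrix.transpose_apply, Finset.sum_mul, Finset.mul_sum, metricMatrix_apply]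
    refine Finset.sum_congr rfl fun k _ => Finset.sum_congr rfl fun l _ => ?_
    ring
  have hdet : T.det = J.det := (LinearMap.det_toMatrix b T.toLinearMap).symm
  rw [hmat, Matrix.det_mul, Matrix.det_mul, Matrix.det_transpose, hdet, ← Real.sqrt_sq_eq_abs,
    ← Real.sqrt_mul (sq_nonneg _)]
  congr 1
  ring

lemma metricMatrix_det_pos (x : M) {u : 𝔼 d} (hu : u ∈ (chartAt (𝔼 d) x).target) :
    0 < (metricMatrix x u).det := by
  have hinj : LinearIndependent ℝ (coordVector x u) := by
    rw [Fintype.linearIndependent_iff]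
    intro g hg
    have h1 : chartDeriv x u (∑ i, g i • EuclideanSpace.single i (1 : ℝ)) = 0 := by
      rw [← hg]
      refine (map_sum (mfderiv (𝓡 d) (𝓡 d) (chartAt (𝔼 d) x).symm u) _ _).trans ?_
      exact Finset.sum_congr rfl fun i _ => chartDeriv_smul x (g i) u _
    have h2 : ∑ i, g i • EuclideanSpace.single i (1 : ℝ) = 0 := by
      by_contra hne
      exact chartDeriv_ne_zero x hu hne h1
    intro i
    have := congrArg (fun v : 𝔼 d => v i) h2
    simpa [Finset.sum_apply, PiLp.single_apply, Pi.single_apply] using this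
  exact (Matrix.posDef_gram_of_linearIndependent hinj).det_pos

lemma continuousOn_sqrt_det_metricMatrix [IsContMDiffRiemannianBundle (𝓡 d) ∞ (𝔼 d)
    (fun x : M => TangentSpace (𝓡 d) x)] (x : M) :
    ContinuousOn (fun u => √(metricMatrix x u).det) (chartAt (𝔼 d) x).target := by
  refine Real.continuous_sqrt.comp_continuousOn ?_
  have h : ContinuousOn (metricMatrix x) (chartAt (𝔼 d) x).target := by
    refine continuousOn_pi.2 fun i => continuousOn_pi.2 fun j => ?_
    simp only [metricMatrix_apply]
    exact ((contDiffOn_chartForm x).continuousOn.clm_apply continuousOn_const).clm_apply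
      continuousOn_const
  exact continuous_id.matrix_det.comp_continuousOn h

variable [MeasurableSpace M] [BorelSpace M]

/-- The measures `√(det g) du` of two charts agree on the overlap of their domains. -/
lemma chartMeasure_apply_eq (x y : M) {A : Set M} (hA : MeasurableSet A)
    (hx : A ⊆ (chartAt (𝔼 d) x).source) (hy : A ⊆ (chartAt (𝔼 d) y).source) :
    chartMeasure (d := d) x A = chartMeasure (d := d) y A := by
  set φ := chartAt (𝔼 d) y ∘ (chartAt (𝔼 d) x).symm with hφ
  set s := (chartAt (𝔼 d) x).target ∩ (chartAt (𝔼 d) x).symm ⁻¹' A with hs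
  have himage : (chartAt (𝔼 d) y).target ∩ (chartAt (𝔼 d) y).symm ⁻¹' A = φ '' s := by
    ext w
    constructor
    · rintro ⟨hw, hwA⟩
      refine ⟨chartAt (𝔼 d) x ((chartAt (𝔼 d) y).symm w),
        ⟨(chartAt (𝔼 d) x).map_source (hx hwA), ?_⟩, ?_⟩
      · rw [Set.mem_preimage, (chartAt (𝔼 d) x).left_inv (hx hwA)]
        exact hwA
      · rw [hφ, Function.comp_apply, (chartAt (𝔼 d) x).left_inv (hx hwA),
          (chartAt (𝔼 d) y).right_inv hw]
    · rintro ⟨u, ⟨hu, huA⟩, rfl⟩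
      refine ⟨(chartAt (𝔼 d) y).map_source (hy huA), ?_⟩
      rw [Set.mem_preimage, hφ, Function.comp_apply, (chartAt (𝔼 d) y).left_inv (hy huA)]
      exact huA
  have hinj : Set.InjOn φ s := by
    intro u hu v hv huv
    exact (chartAt (𝔼 d) x).symm.injOn hu.1 hv.1
      ((chartAt (𝔼 d) y).injOn (hy hu.2) (hy hv.2) huv)
  have hderiv : ∀ u ∈ s, HasFDerivWithinAt φ (fderiv ℝ φ u) s u := by
    intro u hu
    have : IsManifold (𝓡 d) 1 M := IsManifold.of_le (n := ∞) (by simp)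
    have h : MDifferentiableAt (𝓡 d) (𝓡 d) φ u :=
      (mdifferentiableAt_atlas (chart_mem_atlas _ y) (hy hu.2)).comp u
        (mdifferentiableAt_chart_symm x hu.1)
    exact h.differentiableAt.hasFDerivAt.hasFDerivWithinAt
  rw [chartMeasure_apply x hA, chartMeasure_apply y hA, himage,
    lintegral_image_eq_lintegral_abs_det_fderiv_mul volume
      (measurableSet_target_inter_preimage x hA) hderiv hinj]
  refine setLIntegral_congr_fun (measurableSet_target_inter_preimage x hA) fun u hu => ?_
  simp only [sqrt_det_metricMatrix_eq x y hu.1 (hy hu.2), ENNReal.ofReal_mul (abs_nonneg _)]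
  rfl

lemma chartMeasure_apply_le (x y : M) {A : Set M} (hA : MeasurableSet A)
    (hx : A ⊆ (chartAt (𝔼 d) x).source) :
    chartMeasure (d := d) y A ≤ chartMeasure (d := d) x A := by
  rw [← chartMeasure_inter_source y hA, ← chartMeasure_apply_eq x y
    (hA.inter (chartAt (𝔼 d) y).open_source.measurableSet) (Set.inter_subset_left.trans hx)
    Set.inter_subset_right]
  exact measure_mono Set.inter_subset_left

/-- In the domain of a chart, the Riemannian measure is `√(det g) du`. -/
lemma riemannianMeasure_apply (x : M) {A : Set M} (hA : MeasurableSet A)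
    (hx : A ⊆ (chartAt (𝔼 d) x).source) :
    riemannianMeasure d M A =
      ∫⁻ u in (chartAt (𝔼 d) x).target ∩ (chartAt (𝔼 d) x).symm ⁻¹' A,
        ENNReal.ofReal (√(metricMatrix x u).det) := by
  rw [← chartMeasure_apply x hA]
  have hS := (chartAt (𝔼 d) x).open_source.measurableSet
  have hle : riemannianMeasure d M ≤ chartMeasure (d := d) x +
      (riemannianMeasure d M).restrict (chartAt (𝔼 d) x).sourceᶜ := by
    refine iSup_le fun y => Measure.le_iff.2 fun B hB => ?_
    rw [← measure_inter_add_sdiff B hS, Measure.add_apply, Measure.restrict_apply hB]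
    refine add_le_add ((chartMeasure_apply_le x y (hB.inter hS) Set.inter_subset_right).trans
      (measure_mono Set.inter_subset_left)) ?_
    exact le_iSup (fun y : M => chartMeasure (d := d) y) y _
  refine le_antisymm ((hle A).trans ?_) (le_iSup (fun y : M => chartMeasure (d := d) y) x A)
  rw [Measure.add_apply, Measure.restrict_apply hA, ← Set.sdiff_eq,
    Set.sdiff_eq_empty.2 hx, measure_empty, add_zero]

/-- In a compact ball of the chart domain, the Riemannian measure is comparable to Lebesgue
measure. -/
lemma exists_riemannianMeasure_bounds [IsContMDiffRiemannianBundle (𝓡 d) ∞ (𝔼 d)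
    (fun x : M => TangentSpace (𝓡 d) x)] (x : M) {u₀ : 𝔼 d} {R : ℝ} (hR : 0 ≤ R)
    (hT : closedBall u₀ R ⊆ (chartAt (𝔼 d) x).target) :
    ∃ a b : ℝ, 0 < a ∧ 0 < b ∧ ∀ A : Set M, MeasurableSet A →
      A ⊆ (chartAt (𝔼 d) x).symm '' closedBall u₀ R →
      ENNReal.ofReal a * volume (closedBall u₀ R ∩ (chartAt (𝔼 d) x).symm ⁻¹' A) ≤
          riemannianMeasure d M A ∧
        riemannianMeasure d M A ≤
          ENNReal.ofReal b * volume (closedBall u₀ R ∩ (chartAt (𝔼 d) x).symm ⁻¹' A) := by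
  have hcont := (continuousOn_sqrt_det_metricMatrix x).mono hT
  have hne : (closedBall u₀ R).Nonempty := nonempty_closedBall.2 hR
  obtain ⟨u₁, hu₁, hmin⟩ := (isCompact_closedBall u₀ R).exists_isMinOn hne hcont
  obtain ⟨u₂, hu₂, hmax⟩ := (isCompact_closedBall u₀ R).exists_isMaxOn hne hcont
  refine ⟨_, _, Real.sqrt_pos.2 (metricMatrix_det_pos x (hT hu₁)),
    Real.sqrt_pos.2 (metricMatrix_det_pos x (hT hu₂)), fun A hA hAR => ?_⟩
  have hset : (chartAt (𝔼 d) x).target ∩ (chartAt (𝔼 d) x).symm ⁻¹' A =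
      closedBall u₀ R ∩ (chartAt (𝔼 d) x).symm ⁻¹' A := by
    refine Set.Subset.antisymm (fun u hu => ⟨?_, hu.2⟩) (Set.inter_subset_inter_left _ hT)
    obtain ⟨w, hw, hwu⟩ := hAR hu.2
    rwa [← (chartAt (𝔼 d) x).symm.injOn (hT hw) hu.1 hwu]
  have hmeas := measurableSet_target_inter_preimage (d := d) x hA
  have hAs : A ⊆ (chartAt (𝔼 d) x).source := fun q hq => by
    obtain ⟨w, hw, rfl⟩ := hAR hq
    exact (chartAt (𝔼 d) x).map_target (hT hw)
  rw [hset] at hmeas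
  rw [riemannianMeasure_apply x hA hAs, hset, ← setLIntegral_const, ← setLIntegral_const]
  exact ⟨setLIntegral_mono' hmeas fun u hu => ENNReal.ofReal_le_ofReal (hmin hu.1),
    setLIntegral_mono' hmeas fun u hu => ENNReal.ofReal_le_ofReal (hmax hu.1)⟩

end ChartMeasure

/-! ### Volumes of balls and annuli in a compact Riemannian manifold -/

section CompactManifold

open MeasureTheory Metric

variable {d : ℕ} {M : Type*} [MetricSpace M] [MeasurableSpace M] [BorelSpace M]
  [ChartedSpace (EuclideanSpace ℝ (Fin d)) M]
  [IsManifold (𝓡 d) ∞ M] [Bundle.RiemannianBundle (fun x : M => TangentSpace (𝓡 d) x)]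
  [IsContMDiffRiemannianBundle (𝓡 d) ∞ (EuclideanSpace ℝ (Fin d))
    (fun x : M => TangentSpace (𝓡 d) x)]
  [IsRiemannianManifold (𝓡 d) M]

local notation:max "𝔼" n:max => EuclideanSpace ℝ (Fin n)

/-- Near `x`, the metric chart gives the annulus bound, and the comparison of the metric with the
Euclidean one gives the lower volume bound. -/
lemma exists_nhds_measure_bounds [CompactSpace M] [Nonempty (Fin d)] (x : M) :
    ∃ U ∈ nhds x, ∃ K c ρ : ℝ, 0 < K ∧ 0 < c ∧ 0 < ρ ∧
      (∀ y r₁ r₂, 0 ≤ r₁ → r₁ < r₂ → riemannianMeasure d M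
        {q ∈ U | r₁ ≤ dist q y ∧ dist q y < r₂} ≤ ENNReal.ofReal (K * (r₂ - r₁))) ∧
      ∀ p ∈ U, ∀ r, 0 ≤ r → r ≤ ρ →
        ENNReal.ofReal (c * r ^ d) ≤ riemannianMeasure d M (ball p r) := by
  obtain ⟨R, l, Λ, B, ρ₀, hR, hl, hΛ, hB, hρ₀, hT, hψ⟩ := exists_isMetricChart (d := d) x
  set u₀ := chartAt (𝔼 d) x x with hu₀
  set ψ := (chartAt (𝔼 d) x).symm with hψdef
  have hTR : closedBall u₀ R ⊆ (chartAt (𝔼 d) x).target :=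
    (closedBall_subset_ball (by linarith)).trans hT
  obtain ⟨a, b, ha, hb, hab⟩ := exists_riemannianMeasure_bounds (d := d) x hR.le hTR
  obtain ⟨K, hK, hann⟩ := hψ.exists_measure_preimage_annulus_le (volume : Measure (𝔼 d)) hl hΛ hR
    hB hρ₀ (fun x y s => exists_dist_eq_and_dist_eq_sub d x y)
    (fun x y => dist_le_diam_of_mem isCompact_univ.isBounded (Set.mem_univ x) (Set.mem_univ y))
  have hsub4 : ball u₀ (R / 4) ⊆ closedBall u₀ R :=
    ball_subset_closedBall.trans (closedBall_subset_closedBall (by linarith))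
  have hopen : IsOpen (ψ '' ball u₀ (R / 4)) :=
    (chartAt (𝔼 d) x).isOpen_image_symm_of_subset_target isOpen_ball (hsub4.trans hTR)
  have hxU : x ∈ ψ '' ball u₀ (R / 4) :=
    ⟨u₀, mem_ball_self (by positivity), (chartAt (𝔼 d) x).left_inv (mem_chart_source _ x)⟩
  have hv : 0 < volume.real (ball (0 : 𝔼 d) 1) :=
    ENNReal.toReal_pos (measure_ball_pos _ _ one_pos).ne' measure_ball_lt_top.ne
  refine ⟨ψ '' ball u₀ (R / 4), hopen.mem_nhds hxU, b * K,
    a * (volume.real (ball (0 : 𝔼 d) 1) / Λ ^ d), Λ * (R / 2), by positivity, by positivity,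
    by positivity, fun y r₁ r₂ hr₁ hr₁₂ => ?_, ?_⟩
  · set A := {q ∈ ψ '' ball u₀ (R / 4) | r₁ ≤ dist q y ∧ dist q y < r₂} with hA
    have hAmeas : MeasurableSet A := by
      have hd : Measurable fun q => dist q y := measurable_id.dist measurable_const
      exact hopen.measurableSet.inter
        ((measurableSet_le measurable_const hd).inter (measurableSet_lt hd measurable_const))
    refine (hab A hAmeas fun q hq => Set.image_mono hsub4 hq.1).2.trans ?_
    have hset : closedBall u₀ R ∩ ψ ⁻¹' A ⊆
        {w ∈ ball u₀ (R / 4) | r₁ ≤ dist (ψ w) y ∧ dist (ψ w) y < r₂} := by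
      rintro w ⟨hw, ⟨w', hw', hww'⟩, hwA⟩
      rw [(chartAt (𝔼 d) x).symm.injOn (hTR (hsub4 hw')) (hTR hw) hww'] at hw'
      exact ⟨hw', hwA⟩
    have hfin : volume {w ∈ ball u₀ (R / 4) | r₁ ≤ dist (ψ w) y ∧ dist (ψ w) y < r₂} ≠ ⊤ :=
      ((measure_mono fun w hw => hw.1).trans_lt measure_ball_lt_top).ne
    calc _ ≤ ENNReal.ofReal b *
          volume {w ∈ ball u₀ (R / 4) | r₁ ≤ dist (ψ w) y ∧ dist (ψ w) y < r₂} := by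
          gcongr
      _ ≤ ENNReal.ofReal b * ENNReal.ofReal (K * (r₂ - r₁)) := by
          gcongr
          rw [← ENNReal.ofReal_toReal hfin]
          exact ENNReal.ofReal_le_ofReal (hann y r₁ r₂ hr₁ hr₁₂)
      _ = _ := by rw [← ENNReal.ofReal_mul hb.le, mul_assoc]
  · rintro p ⟨u, hu, rfl⟩ r hr hrρ
    have hrR : r / Λ ≤ R / 2 := by
      rw [div_le_iff₀ hΛ]
      linarith
    have hsub : ball u (r / Λ) ⊆ closedBall u₀ R := by
      refine ball_subset_closedBall.trans (closedBall_subset_closedBall' ?_)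
      linarith [mem_ball.1 hu]
    have hsub' : ψ '' ball u (r / Λ) ⊆ ball (ψ u) r := by
      rintro _ ⟨w, hw, rfl⟩
      have h1 := hψ.dist_le w (closedBall_subset_ball (by linarith) (hsub hw)) u
        (ball_subset_ball (by linarith) hu)
      rw [mem_ball, dist_eq_norm, lt_div_iff₀ hΛ] at hw
      rw [mem_ball]
      linarith
    refine le_trans ?_ (measure_mono hsub')
    refine le_trans ?_ (hab _ ((chartAt (𝔼 d) x).isOpen_image_symm_of_subset_target isOpen_ball
      (hsub.trans hTR)).measurableSet (Set.image_mono hsub)).1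
    have hvol : volume (ball u (r / Λ)) =
        ENNReal.ofReal (volume.real (ball (0 : 𝔼 d) 1) / Λ ^ d * r ^ d) := by
      rw [Measure.addHaar_ball volume u (by positivity : 0 ≤ r / Λ),
        ← ENNReal.ofReal_toReal (measure_ball_lt_top (μ := volume) (x := (0 : 𝔼 d)) (r := 1)).ne,
        ← ENNReal.ofReal_mul (by positivity), finrank_euclideanSpace_fin]
      congr 1
      rw [div_pow, Measure.real]
      ring
    rw [mul_assoc, ENNReal.ofReal_mul ha.le, ← hvol]
    gcongr
    exact fun w hw => ⟨hsub hw, w, hw, rfl⟩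

/-- The Riemannian measure of an annulus is bounded by its width, and small balls have at least
Euclidean volume growth, uniformly over a compact manifold. -/
lemma exists_riemannianMeasure_annulus_le_and_le_ball (d : ℕ) [Nonempty (Fin d)] (M : Type*)
    [MetricSpace M] [MeasurableSpace M] [BorelSpace M] [CompactSpace M]
    [ChartedSpace (EuclideanSpace ℝ (Fin d)) M]
    [IsManifold (𝓡 d) ∞ M] [Bundle.RiemannianBundle (fun x : M => TangentSpace (𝓡 d) x)]
    [IsContMDiffRiemannianBundle (𝓡 d) ∞ (EuclideanSpace ℝ (Fin d))
      (fun x : M => TangentSpace (𝓡 d) x)]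
    [IsRiemannianManifold (𝓡 d) M] :
    ∃ K c ρ : ℝ, 0 < K ∧ 0 < c ∧ 0 < ρ ∧
      (∀ (y : M) r₁ r₂, 0 ≤ r₁ → r₁ < r₂ → riemannianMeasure d M
        {q | r₁ ≤ dist q y ∧ dist q y < r₂} ≤ ENNReal.ofReal (K * (r₂ - r₁))) ∧
      ∀ (p : M) r, 0 ≤ r → r ≤ ρ →
        ENNReal.ofReal (c * r ^ d) ≤ riemannianMeasure d M (ball p r) := by
  have h : ∃ K c ρ : ℝ, 0 < K ∧ 0 < c ∧ 0 < ρ ∧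
      (∀ (y : M) r₁ r₂, 0 ≤ r₁ → r₁ < r₂ → riemannianMeasure d M
        {q ∈ Set.univ | r₁ ≤ dist q y ∧ dist q y < r₂} ≤ ENNReal.ofReal (K * (r₂ - r₁))) ∧
      ∀ p ∈ (Set.univ : Set M), ∀ r, 0 ≤ r → r ≤ ρ →
        ENNReal.ofReal (c * r ^ d) ≤ riemannianMeasure d M (ball p r) := by
    refine isCompact_univ.induction_on (p := fun U => ∃ K c ρ : ℝ, 0 < K ∧ 0 < c ∧ 0 < ρ ∧
      (∀ (y : M) r₁ r₂, 0 ≤ r₁ → r₁ < r₂ → riemannianMeasure d M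
        {q ∈ U | r₁ ≤ dist q y ∧ dist q y < r₂} ≤ ENNReal.ofReal (K * (r₂ - r₁))) ∧
      ∀ p ∈ U, ∀ r, 0 ≤ r → r ≤ ρ →
        ENNReal.ofReal (c * r ^ d) ≤ riemannianMeasure d M (ball p r)) ?_ ?_ ?_ ?_
    · exact ⟨1, 1, 1, one_pos, one_pos, one_pos, by simp, by simp⟩
    · rintro s t hst ⟨K, c, ρ, hK, hc, hρ, h1, h2⟩
      exact ⟨K, c, ρ, hK, hc, hρ, fun y r₁ r₂ hr hr' =>
        (measure_mono (Set.inter_subset_inter_left _ hst)).trans (h1 y r₁ r₂ hr hr'),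
        fun p hp => h2 p (hst hp)⟩
    · rintro s t ⟨K, c, ρ, hK, hc, hρ, h1, h2⟩ ⟨K', c', ρ', hK', hc', hρ', h1', h2'⟩
      refine ⟨K + K', min c c', min ρ ρ', by positivity, lt_min hc hc', lt_min hρ hρ',
        fun y r₁ r₂ hr hr' => ?_, ?_⟩
      · rw [add_mul, ENNReal.ofReal_add (mul_nonneg hK.le (by linarith))
          (mul_nonneg hK'.le (by linarith))]
        refine (measure_mono ?_).trans ((measure_union_le _ _).trans
          (add_le_add (h1 y r₁ r₂ hr hr') (h1' y r₁ r₂ hr hr')))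
        rintro q ⟨hq | hq, hq'⟩
        · exact Or.inl ⟨hq, hq'⟩
        · exact Or.inr ⟨hq, hq'⟩
      · rintro p (hp | hp) r hr hrρ
        · refine le_trans (ENNReal.ofReal_le_ofReal ?_) (h2 p hp r hr (hrρ.trans (min_le_left _ _)))
          gcongr
          exact min_le_left _ _
        · refine le_trans (ENNReal.ofReal_le_ofReal ?_)
            (h2' p hp r hr (hrρ.trans (min_le_right _ _)))
          gcongr
          exact min_le_right _ _
    · intro x _
      obtain ⟨U, hU, h⟩ := exists_nhds_measure_bounds (d := d) x
      exact ⟨U, nhdsWithin_le_nhds hU, h⟩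
  simpa using h

end CompactManifold

/-- The discrepancy bound for the normalized distance and measure, if the measure of an annulus is
bounded by its width and small balls have at least Euclidean volume growth. These bounds give
Condition B and the lower volume bound after scaling, and force the diameter to be positive. -/
lemma exists_extremalLpDiscrepancy_normalized_le {M : Type*} [MetricSpace M] [CompactSpace M]
    [ConnectedSpace M] [MeasurableSpace M] [BorelSpace M] (ν : MeasureTheory.Measure M) {d : ℕ}
    (hd : 0 < d) {K c ρ : ℝ} (hK : 0 < K)
    (hc : 0 < c) (hρ : 0 < ρ)
    (hann : ∀ (y : M) r₁ r₂, 0 ≤ r₁ → r₁ < r₂ →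
      ν {q | r₁ ≤ dist q y ∧ dist q y < r₂} ≤ ENNReal.ofReal (K * (r₂ - r₁)))
    (hball : ∀ (p : M) r, 0 ≤ r → r ≤ ρ → ENNReal.ofReal (c * r ^ d) ≤ ν (Metric.ball p r)) :
    ∃ c₃ : ℝ, 0 < c₃ ∧
      ∀ (N : ℕ), 1 ≤ N → ∀ (p : ℝ), 0 < p →
      ∀ (ξ : MeasureTheory.Measure unitInterval) [MeasureTheory.IsProbabilityMeasure ξ],
        extremalLpDiscrepancy (fun x y : M => dist x y / Metric.diam (Set.univ : Set M))
            ((ν Set.univ)⁻¹ • ν) ξ p N ≤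
          ENNReal.ofReal
            (c₃ * (p + 1) ^ (1 / 2 : ℝ) * (N : ℝ) ^ (1 / 2 - 1 / (2 * (d : ℝ)) : ℝ)) := by
  set m := Metric.diam (Set.univ : Set M) with hm
  have hle : ∀ x y : M, dist x y ≤ m := fun x y =>
    Metric.dist_le_diam_of_mem isCompact_univ.isBounded (Set.mem_univ x) (Set.mem_univ y)
  obtain ⟨x₀⟩ : Nonempty M := inferInstance
  have hdiam : 0 < m := by
    by_contra hm0
    have hρd : 0 < c * ρ ^ d := by positivity
    obtain ⟨δ, hδ, hδK⟩ : ∃ δ : ℝ, 0 < δ ∧ K * δ < c * ρ ^ d :=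
      ⟨c * ρ ^ d / (2 * K), by positivity, by field_simp; linarith⟩
    have hsub : Metric.ball x₀ ρ ⊆ {q | 0 ≤ dist q x₀ ∧ dist q x₀ < δ} := fun q _ =>
      ⟨dist_nonneg, by linarith [hle q x₀]⟩
    have h1 := (hball x₀ ρ hρ.le le_rfl).trans
      ((MeasureTheory.measure_mono hsub).trans (hann x₀ 0 δ le_rfl hδ))
    rw [ENNReal.ofReal_le_ofReal_iff (by positivity)] at h1
    linarith
  have hpos : ν Set.univ ≠ 0 := fun h => by
    have h1 := (hball x₀ ρ hρ.le le_rfl).trans (MeasureTheory.measure_mono (Set.subset_univ _))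
    rw [h, nonpos_iff_eq_zero, ENNReal.ofReal_eq_zero] at h1
    exact absurd h1 (not_le.2 (by positivity))
  have hfin : ν Set.univ ≠ ⊤ := by
    refine ne_top_of_le_ne_top ENNReal.ofReal_ne_top
      (le_trans (MeasureTheory.measure_mono fun q _ => ?_) (hann x₀ 0 (m + 1) le_rfl (by linarith)))
    exact ⟨dist_nonneg, by linarith [hle q x₀]⟩
  have : MeasureTheory.IsFiniteMeasure ν := ⟨lt_top_iff_ne_top.2 hfin⟩
  have : NeZero ν := ⟨fun h => hpos (by rw [h]; rfl)⟩
  set V := ν.real Set.univ with hV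
  have hVpos : 0 < V := ENNReal.toReal_pos hpos hfin
  set μ := (ν Set.univ)⁻¹ • ν with hμ
  have hprob : MeasureTheory.IsProbabilityMeasure μ := by
    constructor
    rw [hμ, MeasureTheory.Measure.smul_apply, smul_eq_mul, ENNReal.inv_mul_cancel hpos hfin]
  have hreal : ∀ A, μ.real A = ν.real A / V := by
    intro A
    rw [hμ, MeasureTheory.measureReal_ennreal_smul_apply, ENNReal.toReal_inv, div_eq_inv_mul]
    rfl
  have hannr : ∀ (y : M) r₁ r₂, 0 ≤ r₁ → r₁ < r₂ →
      μ.real {q | r₁ ≤ dist q y ∧ dist q y < r₂} ≤ K / V * (r₂ - r₁) := by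
    intro y r₁ r₂ hr hr'
    rw [hreal, div_mul_eq_mul_div]
    gcongr
    exact ENNReal.toReal_le_of_le_ofReal (mul_nonneg hK.le (by linarith)) (hann y r₁ r₂ hr hr')
  refine exists_extremalLpDiscrepancy_le μ hdiam hle (d := d) (by exact_mod_cast hd)
    (c := c * min m ρ ^ d / V) (by positivity) ?_ ?_
  · intro y r hr
    have h1 : 0 ≤ r * min m ρ := mul_nonneg hr.1 (by positivity)
    have h2 := hball y (r * min m ρ) h1
      ((mul_le_of_le_one_left (by positivity) hr.2).trans (min_le_right _ _))
    have h3 : c * (r * min m ρ) ^ d ≤ ν.real (Metric.ball y (r * min m ρ)) :=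
      (ENNReal.ofReal_le_iff_le_toReal (MeasureTheory.measure_ne_top _ _)).1 h2
    have h4 : μ.real (Metric.ball y (r * min m ρ)) ≤
        μ.real (distBall (fun x y => dist x y / m) y r) := by
      refine MeasureTheory.measureReal_mono fun q hq => Or.inl ?_
      rw [div_lt_iff₀ hdiam]
      exact (Metric.mem_ball.1 hq).trans_le
        (mul_le_mul_of_nonneg_left (min_le_left _ _) hr.1)
    rw [ballVolume]
    refine le_trans ?_ h4
    rw [hreal, Real.rpow_natCast, div_mul_eq_mul_div]
    gcongr
    refine le_trans (le_of_eq ?_) h3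
    ring
  · have key : ∀ y : M, ∀ r₁ ∈ Set.Icc (0 : ℝ) 1, ∀ r₂ ∈ Set.Icc (0 : ℝ) 1, r₁ ≤ r₂ →
        |ballVolume (fun x y => dist x y / m) μ y r₁ -
            ballVolume (fun x y => dist x y / m) μ y r₂| ≤
          K / V * m * |r₁ - r₂| := by
      intro y r₁ hr₁ r₂ hr₂ h12
      have hmono : μ.real (distBall (fun x y => dist x y / m) y r₁) ≤
          μ.real (distBall (fun x y => dist x y / m) y r₂) :=
        MeasureTheory.measureReal_mono (distBall_mono h12)
      simp only [ballVolume]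
      rw [abs_sub_comm, abs_sub_comm r₁, abs_of_nonneg (sub_nonneg.2 h12), abs_of_nonneg
        (sub_nonneg.2 hmono)]
      rcases h12.eq_or_lt with rfl | h12
      · simp
      -- the extra width `δ` makes room for the points at distance `m` when `r₂ = 1`
      refine le_of_forall_pos_le_add fun ε hε => ?_
      obtain ⟨δ, hδ, hδε⟩ : ∃ δ : ℝ, 0 < δ ∧ K / V * δ = ε :=
        ⟨ε / (K / V), by positivity, by field_simp⟩
      have h1 := hannr y (m * r₁) (m * r₂ + δ) (mul_nonneg hdiam.le hr₁.1) (by nlinarith)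
      have h2 : distBall (fun x y : M => dist x y / m) y r₂ ⊆
          distBall (fun x y : M => dist x y / m) y r₁ ∪
            {q | m * r₁ ≤ dist q y ∧ dist q y < m * r₂ + δ} := by
        intro q hq
        by_cases hq1 : dist q y / m < r₁
        · exact Or.inl (Or.inl hq1)
        refine Or.inr ⟨?_, ?_⟩
        · rw [not_lt, le_div_iff₀ hdiam] at hq1
          linarith
        · rcases hq with hq | hq
          · rw [div_lt_iff₀ hdiam] at hq
            linarith
          · have := hle q y
            nlinarith
      have h3 := (MeasureTheory.measureReal_mono h2).trans (MeasureTheory.measureReal_union_le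
        (μ := μ) _ _)
      have h4 : K / V * (m * r₂ + δ - m * r₁) = K / V * m * (r₂ - r₁) + ε := by
        rw [← hδε]; ring
      linarith
    refine ⟨K / V * m, by positivity, fun y r₁ hr₁ r₂ hr₂ => ?_⟩
    rcases le_total r₁ r₂ with h | h
    · exact key y r₁ hr₁ r₂ hr₂ h
    · rw [abs_sub_comm, abs_sub_comm r₁]
      exact key y r₂ hr₂ r₁ hr₁ h

theorem theorem1p1 :
    -- the bound for metric measure spaces satisfying Conditions A and B
    (∀ (M : Type*) [MetricSpace M] [CompactSpace M] [ConnectedSpace M]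
        [MeasurableSpace M] [BorelSpace M]
        (μ : MeasureTheory.Measure M) [MeasureTheory.IsProbabilityMeasure μ],
      Metric.diam (Set.univ : Set M) = 1 →
      ∀ d : ℝ, ConditionA (fun x y : M => dist x y) μ d →
      ConditionB (fun x y : M => dist x y) μ →
      ∃ c₃ : ℝ, 0 < c₃ ∧
        ∀ (N : ℕ), 1 ≤ N → ∀ (p : ℝ), 0 < p →
        ∀ (ξ : MeasureTheory.Measure unitInterval) [MeasureTheory.IsProbabilityMeasure ξ],
          extremalLpDiscrepancy (fun x y : M => dist x y) μ ξ p N ≤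
            ENNReal.ofReal
              (c₃ * (p + 1) ^ (1 / 2 : ℝ) * (N : ℝ) ^ (1 / 2 - 1 / (2 * d) : ℝ))) ∧
    -- the bound for compact connected Riemannian manifolds, with distance and measure normalized
    (∀ (d : ℕ), 1 ≤ d →
      ∀ (M : Type*) [MetricSpace M] [CompactSpace M] [ConnectedSpace M]
        [MeasurableSpace M] [BorelSpace M]
        [ChartedSpace (EuclideanSpace ℝ (Fin d)) M] [IsManifold (𝓡 d) ∞ M]
        [Bundle.RiemannianBundle (fun x : M => TangentSpace (𝓡 d) x)]
        [IsContMDiffRiemannianBundle (𝓡 d) ∞ (EuclideanSpace ℝ (Fin d))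
          (fun x : M => TangentSpace (𝓡 d) x)]
        [IsRiemannianManifold (𝓡 d) M],
      ∃ c₃ : ℝ, 0 < c₃ ∧
        ∀ (N : ℕ), 1 ≤ N → ∀ (p : ℝ), 0 < p →
        ∀ (ξ : MeasureTheory.Measure unitInterval) [MeasureTheory.IsProbabilityMeasure ξ],
          extremalLpDiscrepancy
              (fun x y : M => dist x y / Metric.diam (Set.univ : Set M))
              ((riemannianMeasure d M Set.univ)⁻¹ • riemannianMeasure d M) ξ p N ≤
            ENNReal.ofReal
              (c₃ * (p + 1) ^ (1 / 2 : ℝ) * (N : ℝ) ^ (1 / 2 - 1 / (2 * (d : ℝ)) : ℝ))) := by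
  refine ⟨fun M _ _ _ _ _ μ _ hdiam d hA hB => ?_, fun d hd M _ _ _ _ _ _ _ _ _ _ => ?_⟩
  · obtain ⟨hd, c₁, hc₁, hc⟩ := hA
    have h := exists_extremalLpDiscrepancy_le μ one_pos (fun x y => by
      rw [← hdiam]
      exact Metric.dist_le_diam_of_mem isCompact_univ.isBounded (Set.mem_univ x) (Set.mem_univ y))
      hd (inv_pos.2 hc₁) (by simpa only [div_one] using fun y r hr => (hc y r hr).1)
      (by simpa only [div_one] using hB)
    simpa only [div_one] using h
  · have : Nonempty (Fin d) := ⟨⟨0, hd⟩⟩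
    obtain ⟨K, c, ρ, hK, hc, hρ, hann, hball⟩ :=
      exists_riemannianMeasure_annulus_le_and_le_ball d M
    exact exists_extremalLpDiscrepancy_normalized_le _ hd hK hc hρ hann hball
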